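/- Let $(X,d)$ be a locally compact, separable, complete metric space with at least two points, let $m$ be a Radon measure on $X$ with full topological support, and let $p\in(1,\infty)$. A functional $E\ge 0$ on a real vector space is called a $p$-energy if $E^{1/p}$ is a seminorm. Let $\mathcal F_p\subset L^p(X,m)$ be a linear subspace, $\mathcal E_p:\mathcal F_p\to[0,\infty)$ a $p$-energy, and $\{\Gamma_p\langle u\rangle\}_{u\in\mathcal F_p}$ a family of finite Borel measures on $X$ such that: 1. if $u\in\mathcal F_p$ and $\varphi:\mathbb R\to\mathbb R$ is $1$-Lipschitz with $\varphi(0)=0$, then $\varphi(u)\in\mathcal F_p$ and $\mathcal E_p(\varphi(u))\le\mathcal E_p(u)$; and $\mathcal E_p(u)=0$ implies that $u$ is $m$-a.e. constant; 2. $\mathcal F_p$ with the norm $\|u\|_{L^p(X,m)}+\mathcal E_p(u)^{1/p}$ is a reflexive Banach space; 3. $\mathcal F_p\cap C_c(X)$ is dense in $\mathcal F_p$, and dense in $C_c(X)$ with respect to the uniform norm; 4. for every Borel set $A$, $u\mapsto\Gamma_p\langle u\rangle(A)$ is a $p$-energy on $\mathcal F_p$; 5. $\mathcal E_p(u)=\Gamma_p\langle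 u\rangle(X)$ for all $u\in\mathcal F_p$; 6. if $u,v\in\mathcal F_p\cap C_c(X)$ and $u-v$ is constant on an open set $V$, then $\Gamma_p\langle u\rangle$ and $\Gamma_p\langle v\rangle$ coincide on the Borel subsets of $V$. Let $\Psi:(0,\infty)\to(0,\infty)$ be a continuous increasing bijection such that, for some $C_\Psi\ge 1$ and $\beta_1,\beta_2>0$, $C_\Psi^{-1}(R/r)^{\beta_1}\le\Psi(R)/\Psi(r)\le C_\Psi(R/r)^{\beta_2}$ for all $0<r\le R$. Write $B(x,r)=\{y: d(x,y)<r\}$ and $u_B=\frac1{m(B)}\int_B u\,dm$, and assume: - (VD) there is $c_D\ge1$ with $m(B(x,2r))\le c_D\,m(B(x,r))$ for all $x\in X$, $r>0$; - (PI$_p(\Psi)$) there are $C_P>0$, $A_P\ge1$ with $\int_{B(x,r)}|u-u_{B(x,r)}|^p\,dm\le C_P\Psi(r)\,\Gamma_p\langle u\rangle(B(x,A_Pr))$ for all $x\in X$, $r>0$, $u\in\mathcal F_p$; - (cap$_p(\Psi)_\le$) there are $C_{cap},A_1,A_2>1$ such that for all $x\in X$ and $0<R<\operatorname{diam}(X)/A_2$,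 $$\inf\{\mathcal E_p(u): u\in\mathcal F_p,\ u=1\ m\text{-a.e. on }B(x,R),\ u=0\ m\text{-a.e. on }X\setminus B(x,A_1R)\}\le C_{cap}\frac{m(B(x,R))}{\Psi(R)},\qquad \inf\emptyset=\infty.$$ For an open set $U\subset X$, let $\mathcal F_{p,\mathrm{loc}}(U)$ be the set of ($m$-classes of) real-valued Borel functions $f$ on $U$ such that for each relatively compact open subset $A$ of $U$ there is $f^\#\in\mathcal F_p$ with $f=f^\#$ $m$-a.e. on $A$. For such $f$ let $\Gamma_{p,U}\langle f\rangle$ be the Borel measure on $U$ with $\Gamma_{p,U}\langle f\rangle(E)=\Gamma_p\langle f^\#\rangle(E)$ for Borel $E\subset A$, with $A$ and $f^\#$ as above, and $\Gamma_{p,U}\langle f\rangle(E)=\lim_n\Gamma_{p,U}\langle f\rangle(E\cap A_n)$ for all Borel $E\subset U$, where $(A_n)$ is any non-decreasing exhaustion of $U$ by relatively compact open subsets of $U$. Let $\mathcal F_p(U)$ be the set of $f\in\mathcal F_{p,\mathrm{loc}}(U)$ with $\int_U|f|^p\,dm+\Gamma_{p,U}\langle f\rangle(U)<\infty$. A non-empty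 connected open set $U\ne X$ is called a uniform domain if there is $A\ge1$ such that any $x,y\in U$ are joined by a continuous curve $\gamma$ in $U$ with $\operatorname{diam}(\gamma)\le A\,d(x,y)$ and $d(z,X\setminus U)\ge A^{-1}\min\{d(x,z),d(y,z)\}$ for all $z\in\gamma$. **Theorem.** Under these assumptions, every uniform domain $U$ of $X$ has the extension property (E): for every $f\in\mathcal F_p(U)$ there is $F\in\mathcal F_p$ with $F=f$ $m$-a.e. on $U$ and $\Gamma_p\langle F\rangle(\partial U)=0$. -/

import Mathlib

open MeasureTheory Set Metric
open scoped ENNReal NNReal CompactlySupported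

noncomputable section

instance factOneLeOfReal (p : ℝ) [hp : Fact (1 < p)] : Fact (1 ≤ ENNReal.ofReal p) :=
  ⟨by simpa using hp.out.le⟩

/-- A functional `E : V → [0, ∞)` on a real vector space such that `E ^ (1/p)` is a seminorm. -/
def IsPEnergy (p : ℝ) {V : Type*} [AddCommGroup V] [Module ℝ V] (E : V → ℝ) : Prop :=
  (∀ u, 0 ≤ E u) ∧ ∃ N : Seminorm ℝ V, ∀ u, N u = E u ^ (1 / p)

/-- A `p`-energy form `(E_p, F_p)` on `(X, m)` whose domain `F_p` is a linear subspace
of `L^p(X, m)`. -/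
structure PEnergyForm (p : ℝ) [Fact (1 < p)] {X : Type*} [MeasurableSpace X]
    (m : Measure X) where
  domain : Submodule ℝ (Lp ℝ (ENNReal.ofReal p) m)
  energy : domain → ℝ
  isPEnergy : IsPEnergy p energy

namespace PEnergyForm

section Norm

variable {p : ℝ} [Fact (1 < p)] {X : Type*} [MeasurableSpace X] {m : Measure X}

/-- The Borel-measurable representative of an element of the domain, as a function on `X`. -/
def toFun (𝓔 : PEnergyForm p m) (u : 𝓔.domain) : X → ℝ :=
  ((u : Lp ℝ (ENNReal.ofReal p) m) : X → ℝ)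

/-- The domain `F_p`, to be equipped with the norm `‖u‖_{L^p} + E_p(u)^{1/p}`
(the type `𝓔.domain` itself carries the norm of `L^p`). -/
def Space (𝓔 : PEnergyForm p m) : Type _ := 𝓔.domain

instance (𝓔 : PEnergyForm p m) : AddCommGroup 𝓔.Space :=
  inferInstanceAs (AddCommGroup 𝓔.domain)

instance (𝓔 : PEnergyForm p m) : Module ℝ 𝓔.Space :=
  inferInstanceAs (Module ℝ 𝓔.domain)

/-- The identity map from `F_p` with its energy norm to the underlying vector space. -/
def ofSpace (𝓔 : PEnergyForm p m) : 𝓔.Space ≃ₗ[ℝ] 𝓔.domain :=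
  LinearEquiv.refl ℝ 𝓔.domain

instance (𝓔 : PEnergyForm p m) : Norm 𝓔.Space :=
  ⟨fun u => ‖(𝓔.ofSpace u : Lp ℝ (ENNReal.ofReal p) m)‖ + 𝓔.energy (𝓔.ofSpace u) ^ (1 / p)⟩

theorem space_norm_def (𝓔 : PEnergyForm p m) (u : 𝓔.Space) :
    ‖u‖ = ‖(𝓔.ofSpace u : Lp ℝ (ENNReal.ofReal p) m)‖
      + 𝓔.energy (𝓔.ofSpace u) ^ (1 / p) := rfl

theorem space_core (𝓔 : PEnergyForm p m) : NormedSpace.Core ℝ 𝓔.Space where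
  norm_nonneg u := add_nonneg (norm_nonneg _) (Real.rpow_nonneg (𝓔.isPEnergy.1 _) _)
  norm_smul c u := by
    obtain ⟨N, hN⟩ := 𝓔.isPEnergy.2
    simp only [space_norm_def, ← hN, map_smul, map_smul_eq_mul, Submodule.coe_smul, norm_smul,
      mul_add]
  norm_triangle u v := by
    obtain ⟨N, hN⟩ := 𝓔.isPEnergy.2
    simp only [space_norm_def, ← hN, map_add, Submodule.coe_add]
    have h1 := norm_add_le (𝓔.ofSpace u : Lp ℝ (ENNReal.ofReal p) m) (𝓔.ofSpace v)
    have h2 := map_add_le_add N (𝓔.ofSpace u) (𝓔.ofSpace v)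
    linarith
  norm_eq_zero_iff u := by
    obtain ⟨N, hN⟩ := 𝓔.isPEnergy.2
    simp only [space_norm_def, ← hN]
    constructor
    · intro h
      have h1 := norm_nonneg (𝓔.ofSpace u : Lp ℝ (ENNReal.ofReal p) m)
      have h2 := apply_nonneg N (𝓔.ofSpace u)
      have h3 : ‖(𝓔.ofSpace u : Lp ℝ (ENNReal.ofReal p) m)‖ = 0 := by linarith
      have h4 : 𝓔.ofSpace u = 0 := Subtype.ext (norm_eq_zero.1 h3)
      simpa using h4
    · rintro rfl
      simp

instance (𝓔 : PEnergyForm p m) : NormedAddCommGroup 𝓔.Space :=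
  NormedAddCommGroup.ofCore 𝓔.space_core

instance (𝓔 : PEnergyForm p m) : NormedSpace ℝ 𝓔.Space :=
  NormedSpace.ofCore 𝓔.space_core

end Norm

/-- The setting: a regular `p`-energy form `(E_p, F_p)` with `p`-energy measures `Γ`. -/
structure IsRegularWithEnergyMeasures {p : ℝ} [Fact (1 < p)] {X : Type*} [MetricSpace X]
    [MeasurableSpace X] {m : Measure X} (𝓔 : PEnergyForm p m)
    (Γ : 𝓔.domain → Measure X) : Prop where
  finite : ∀ u, IsFiniteMeasure (Γ u)
  /-- Lipschitz contraction property. -/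
  lipschitz_contraction : ∀ (u : 𝓔.domain) (φ : ℝ → ℝ), LipschitzWith 1 φ → φ 0 = 0 →
    ∃ v : 𝓔.domain, 𝓔.toFun v =ᵐ[m] φ ∘ 𝓔.toFun u ∧ 𝓔.energy v ≤ 𝓔.energy u
  const_of_energy_eq_zero : ∀ u : 𝓔.domain, 𝓔.energy u = 0 →
    ∃ c : ℝ, 𝓔.toFun u =ᵐ[m] fun _ => c
  complete : CompleteSpace 𝓔.Space
  reflexive : Function.Surjective (NormedSpace.inclusionInDoubleDual ℝ 𝓔.Space)
  dense_domain : Dense {u : 𝓔.Space | ∃ g : C_c(X, ℝ), 𝓔.toFun (𝓔.ofSpace u) =ᵐ[m] g}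
  dense_Cc : ∀ (g : C_c(X, ℝ)) (ε : ℝ), 0 < ε →
    ∃ (u : 𝓔.domain) (h : C_c(X, ℝ)), 𝓔.toFun u =ᵐ[m] h ∧ ∀ x, |g x - h x| < ε
  measure_isPEnergy : ∀ A : Set X, MeasurableSet A → IsPEnergy p fun u => (Γ u).real A
  energy_eq : ∀ u : 𝓔.domain, 𝓔.energy u = (Γ u).real univ
  /-- Strong locality. -/
  strongly_local : ∀ (u v : 𝓔.domain) (f g : C_c(X, ℝ)),
    𝓔.toFun u =ᵐ[m] f → 𝓔.toFun v =ᵐ[m] g →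
    ∀ U : Set X, IsOpen U → (∃ c : ℝ, ∀ x ∈ U, f x - g x = c) →
    (Γ u).restrict U = (Γ v).restrict U

/-- The `(p,p)`-Poincaré inequality with scale function `Ψ`. -/
def PoincareInequality {p : ℝ} [Fact (1 < p)] {X : Type*} [MetricSpace X]
    [MeasurableSpace X] {m : Measure X} (𝓔 : PEnergyForm p m)
    (Γ : 𝓔.domain → Measure X) (Ψ : ℝ → ℝ) : Prop :=
  ∃ C A : ℝ, 0 < C ∧ 1 ≤ A ∧ ∀ (x : X) (r : ℝ), 0 < r → ∀ u : 𝓔.domain,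
    ∫⁻ y in ball x r, ENNReal.ofReal (|𝓔.toFun u y - ⨍ z in ball x r, 𝓔.toFun u z ∂m| ^ p) ∂m
      ≤ ENNReal.ofReal (C * Ψ r) * Γ u (ball x (A * r))

/-- The functions in the domain which are `1` a.e. on `E₁` and `0` a.e. on `E₀`. -/
def capFunctions {p : ℝ} [Fact (1 < p)] {X : Type*} [MeasurableSpace X] {m : Measure X}
    (𝓔 : PEnergyForm p m) (E₁ E₀ : Set X) : Set 𝓔.domain :=
  {u | (∀ᵐ x ∂m, x ∈ E₁ → 𝓔.toFun u x = 1) ∧ (∀ᵐ x ∂m, x ∈ E₀ → 𝓔.toFun u x = 0)}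

/-- The `p`-capacity upper estimate with scale function `Ψ`. The infimum is taken in `[0, ∞]`,
so that it is `∞` over the empty set; `R < diam X / A₂` is written as `A₂ R < diam X`. -/
def CapacityUpperBound {p : ℝ} [Fact (1 < p)] {X : Type*} [MetricSpace X]
    [MeasurableSpace X] {m : Measure X} (𝓔 : PEnergyForm p m) (Ψ : ℝ → ℝ) : Prop :=
  ∃ C A₁ A₂ : ℝ, 1 < C ∧ 1 < A₁ ∧ 1 < A₂ ∧ ∀ (x : X) (R : ℝ), 0 < R →
    ENNReal.ofReal (A₂ * R) < ediam (univ : Set X) →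
    ⨅ u ∈ 𝓔.capFunctions (ball x R) (ball x (A₁ * R))ᶜ, ENNReal.ofReal (𝓔.energy u)
      ≤ ENNReal.ofReal C * m (ball x R) / ENNReal.ofReal (Ψ R)

end PEnergyForm

/-- `A` is a relatively compact open subset of `U`. -/
def IsRelCompactOpenIn {X : Type*} [TopologicalSpace X] (A U : Set X) : Prop :=
  IsOpen A ∧ IsCompact (closure A) ∧ closure A ⊆ U

namespace PEnergyForm

section Local

variable {p : ℝ} [Fact (1 < p)] {X : Type*} [MetricSpace X] [MeasurableSpace X]
  {m : Measure X}

/-- `v ∈ F_p` agrees `m`-a.e. with `f ∈ L⁰(U, m|_U)` on the subset `A` of `U`. -/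
def AgreesOn (𝓔 : PEnergyForm p m) {U : Set X} (f : X →ₘ[m.restrict U] ℝ) (A : Set X)
    (v : 𝓔.domain) : Prop :=
  ∀ᵐ x ∂(m.restrict U), x ∈ A → f x = 𝓔.toFun v x

/-- The local space `F_{p,loc}(U)`, a set of elements of `L⁰(U, m|_U)`. -/
def localDomain (𝓔 : PEnergyForm p m) (U : Set X) : Set (X →ₘ[m.restrict U] ℝ) :=
  {f | ∀ A, IsRelCompactOpenIn A U → ∃ v : 𝓔.domain, 𝓔.AgreesOn f A v}

/-- The `p`-energy measure `Γ_{p,U}⟨f⟩` of `f ∈ F_{p,loc}(U)`, as a measure on `X` concentrated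
on `U`: the supremum of the measures `Γ_p⟨v⟩|_A`, where `A` is a relatively compact open subset of
`U` and `v ∈ F_p` agrees with `f` on `A`. By strong locality `Γ_p⟨v⟩|_A` does not depend on
`v`, and for `f ∈ F_{p,loc}(U)` these measures are directed upwards, so that this is the
measure whose value on `E` is the limit of `Γ_p⟨vₙ⟩(E ∩ Aₙ)` along any exhaustion `(Aₙ)` of `U`
by relatively compact open subsets, `vₙ` agreeing with `f` on `Aₙ`. -/
def localEnergyMeasure (𝓔 : PEnergyForm p m) (Γ : 𝓔.domain → Measure X) {U : Set X}
    (f : X →ₘ[m.restrict U] ℝ) : Measure X :=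
  ⨆ (A : Set X) (v : 𝓔.domain) (_ : IsRelCompactOpenIn A U ∧ 𝓔.AgreesOn f A v),
    (Γ v).restrict A

/-- The space `F_p(U)`. -/
def domainOn (𝓔 : PEnergyForm p m) (Γ : 𝓔.domain → Measure X) (U : Set X) :
    Set (X →ₘ[m.restrict U] ℝ) :=
  {f | f ∈ 𝓔.localDomain U ∧
    ∫⁻ x in U, ENNReal.ofReal (|f x| ^ p) ∂m + 𝓔.localEnergyMeasure Γ f U < ∞}

/-- The extension property (E) of an open set `U ≠ X`. -/
def ExtensionProperty (𝓔 : PEnergyForm p m) (Γ : 𝓔.domain → Measure X) (U : Set X) : Prop :=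
  ∀ f ∈ 𝓔.domainOn Γ U, ∃ F : 𝓔.domain,
    (∀ᵐ x ∂(m.restrict U), f x = 𝓔.toFun F x) ∧ Γ F (frontier U) = 0

end Local

end PEnergyForm

/-- Volume doubling (VD). -/
def VolumeDoubling {X : Type*} [MetricSpace X] [MeasurableSpace X] (m : Measure X) : Prop :=
  ∃ c : ℝ≥0, 1 ≤ c ∧ ∀ (x : X) (r : ℝ), 0 < r → m (ball x (2 * r)) ≤ c * m (ball x r)

/-- `Ψ` restricts to a continuous increasing bijection of `(0, ∞)` onto itself with two-sided
power bounds; the values of `Ψ` outside `(0, ∞)` are irrelevant. -/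
structure IsScaleFunction (Ψ : ℝ → ℝ) : Prop where
  continuousOn : ContinuousOn Ψ (Ioi 0)
  strictMonoOn : StrictMonoOn Ψ (Ioi 0)
  bijOn : BijOn Ψ (Ioi 0) (Ioi 0)
  bounds : ∃ C β₁ β₂ : ℝ, 1 ≤ C ∧ 0 < β₁ ∧ 0 < β₂ ∧ ∀ r R : ℝ, 0 < r → r ≤ R →
    C⁻¹ * (R / r) ^ β₁ ≤ Ψ R / Ψ r ∧ Ψ R / Ψ r ≤ C * (R / r) ^ β₂

/-- Uniform domains. -/
def IsUniformDomain {X : Type*} [MetricSpace X] (U : Set X) : Prop :=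
  IsOpen U ∧ IsConnected U ∧ U ≠ univ ∧ ∃ A : ℝ, 1 ≤ A ∧ ∀ x ∈ U, ∀ y ∈ U,
    ∃ γ : Path x y, range γ ⊆ U ∧ diam (range γ) ≤ A * dist x y ∧
      ∀ z ∈ range γ, A⁻¹ * min (dist x z) (dist y z) ≤ infDist z Uᶜ

end

set_option linter.unusedSectionVars false

/-! ### Weak limits in reflexive spaces, and scalar truncations. -/

noncomputable section

open Filter Topology

/-! The proof is a Whitney-type extension carried out at a positive scale `s`, followed by a weak
limit as `s → 0`. All estimates for `f` are made against one finite measure `μ`, the sum of the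
local energy measure of `f` on `U` and of `|f|^p m` on `U`; together with the Poincaré inequality on
balls well inside `U` it forms the structure `LocalPoincare`.

At scale `s` the whole space is covered by balls whose radius is `dist(y, U) / (8A)` truncated to
`[s, r₀]`: small balls of radius `s` in `U` and along its boundary, growing Whitney balls outside.
The capacity bound gives a partition of unity `ψ i` subordinate to the cover with energies of order
`m(B i) / Ψ(ρ i)` (`exists_partition`). The approximation is `G = ∑ b i • ψ i`, where `b i` is
essentially the average of `f` over a ball inside `U`, of size, distance from `B i` and depth in `U`
comparable to `ρ i`. Such a ball is found by `exists_corkscrew`; `b i` is set to zero at the largest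
radius and is cut off far away to make the sum finite (`exists_coefficients`).

On a ball of the cover, `G` differs by a constant from a short sum of `(b i - b j) • ψ i`, so strong
locality bounds its energy there by differences of neighbouring coefficients. Since the `ψ i` need
not be continuous, locality must first be extended to bounded elements of the domain
(`measure_eq_zero_of_ae_eq_const`). The differences are bounded by the Poincaré inequality along the
curve of the uniform condition (`exists_chain_bound`), at the cost of `μ` of `innerRegion`, a piece
of `U` at distance comparable to `ρ j` from the complement. These regions overlap boundedly, so the
energy and the `L^p` norm of `G` are bounded uniformly in `s`.

Balls meeting the boundary have radius at most `2s`, and their inner regions lie in the layer of `U`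
within `T * s` of the complement. Hence `Γ G (∂U)` is at most a constant times `μ` of that layer,
which tends to zero because the layers shrink to the empty set. Locally in `U`, Poincaré at scale
`s` gives `G → f` in `L^p`. Reflexivity yields a weak limit `F`, and both properties pass to it
because they are expressed by closed convex sets (`exists_extension_of_bounded`). In particular it
is never necessary to know that `∂U` is `m`-null. -/

/-- A bounded family in a reflexive space has a point lying in every closed convex set
that contains the family eventually. -/
theorem exists_mem_of_eventually_mem_of_reflexive {Y : Type*} [NormedAddCommGroup Y]
    [NormedSpace ℝ Y] (hY : Function.Surjective (NormedSpace.inclusionInDoubleDual ℝ Y))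
    {α : Type*} {l : Filter α} [l.NeBot] (u : α → Y) {M : ℝ} (hM : ∀ a, ‖u a‖ ≤ M) :
    ∃ F : Y, ∀ C : Set Y, Convex ℝ C → IsClosed C → (∀ᶠ a in l, u a ∈ C) → F ∈ C := by
  set v : α → WeakDual ℝ (StrongDual ℝ Y) := fun a =>
    StrongDual.toWeakDual (NormedSpace.inclusionInDoubleDual ℝ Y (u a)) with hv
  have hK := WeakDual.isCompact_closedBall (𝕜 := ℝ) (E := StrongDual ℝ Y) 0 M
  -- Banach–Alaoglu in the bidual gives a weak-* limit along an ultrafilter finer than `l`;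
  -- reflexivity brings it back to `Y`.
  obtain ⟨φ, -, hφ⟩ := hK.ultrafilter_le_nhds ((Ultrafilter.of l).map v) (by
    rw [le_principal_iff]
    refine Filter.mem_map.2 (Filter.mem_of_superset univ_mem fun a _ => ?_)
    simp only [mem_preimage, mem_closedBall, dist_zero_right]
    exact (NormedSpace.double_dual_bound ℝ Y (u a)).trans (hM a))
  obtain ⟨F, hF⟩ := hY (WeakDual.toStrongDual φ)
  refine ⟨F, fun C hC hCc hu => ?_⟩
  by_contra hFC
  -- Mazur's argument: a functional separating `F` from `C` would contradict the convergence of its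
  -- values along the ultrafilter.
  obtain ⟨f, s, h1, h2⟩ := geometric_hahn_banach_closed_point hC hCc hFC
  have hlim : Tendsto (fun a => f (u a)) (Ultrafilter.of l) (𝓝 (f F)) := by
    have h3 : Tendsto (fun a => (v a) f) (Ultrafilter.of l) (𝓝 (φ f)) :=
      ((WeakDual.eval_continuous f).tendsto φ).comp hφ
    have h4 : φ f = f F := by
      have := congrArg (fun g : StrongDual ℝ (StrongDual ℝ Y) => g f) hF
      simpa using this.symm
    rw [← h4]
    exact h3
  have h5 : ∀ᶠ a in (Ultrafilter.of l : Filter α), f (u a) ≤ s :=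
    (hu.filter_mono (Ultrafilter.of_le l)).mono fun a ha => (h1 _ ha).le
  exact absurd (le_of_tendsto hlim h5) (not_le.2 h2)

theorem Seminorm.convex_sub_le {Y : Type*} [NormedAddCommGroup Y] [NormedSpace ℝ Y]
    (N : Seminorm ℝ Y) (v : Y) (ε : ℝ) : Convex ℝ {w | N (w - v) ≤ ε} := by
  simpa [Seminorm.closedBall] using N.convex_closedBall v ε

theorem Seminorm.isClosed_sub_le {Y : Type*} [NormedAddCommGroup Y] [NormedSpace ℝ Y]
    (N : Seminorm ℝ Y) (hN : ∀ w, N w ≤ ‖w‖) (v : Y) (ε : ℝ) : IsClosed {w | N (w - v) ≤ ε} := by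
  have : Continuous N := Seminorm.continuous_of_le (q := normSeminorm ℝ Y) continuous_norm hN
  exact isClosed_le (this.comp (continuous_id.sub continuous_const)) continuous_const

/-- Truncation of `t` at the levels `±a`. -/
def clampAt (a t : ℝ) : ℝ := max (-a) (min t a)

theorem clampAt_zero (a : ℝ) (ha : 0 ≤ a) : clampAt a 0 = 0 := by simp [clampAt, ha]

theorem zero_clampAt (t : ℝ) : clampAt 0 t = 0 := by simp [clampAt]

theorem clampAt_of_abs_le {a t : ℝ} (h : |t| ≤ a) : clampAt a t = t := by
  rw [abs_le] at h; simp [clampAt, h.1, h.2]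

theorem abs_clampAt_sub_le (a s t : ℝ) : |clampAt a s - clampAt a t| ≤ |s - t| := by
  unfold clampAt
  calc _ ≤ |min s a - min t a| := by
        have := abs_max_sub_max_le_max (-a) (min s a) (-a) (min t a)
        simpa using this
    _ ≤ |s - t| := by
        have := abs_min_sub_min_le_max s a t a
        simpa using this

theorem lipschitzWith_clampAt (a : ℝ) : LipschitzWith 1 (clampAt a) :=
  LipschitzWith.of_dist_le_mul fun s t => by
    simpa [Real.dist_eq] using abs_clampAt_sub_le a s t

/-- Truncation of `t` to `[0, 1]`. -/
def unitClamp (t : ℝ) : ℝ := max 0 (min t 1)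

theorem unitClamp_zero : unitClamp 0 = 0 := by simp [unitClamp]

theorem unitClamp_of_one_le {t : ℝ} (h : 1 ≤ t) : unitClamp t = 1 := by simp [unitClamp, h]

theorem unitClamp_of_nonpos {t : ℝ} (h : t ≤ 0) : unitClamp t = 0 := by
  simp [unitClamp, h]

theorem unitClamp_nonneg (t : ℝ) : 0 ≤ unitClamp t := le_max_left _ _

theorem unitClamp_le_one (t : ℝ) : unitClamp t ≤ 1 := by simp [unitClamp]

theorem unitClamp_mono : Monotone unitClamp := fun s t h => by unfold unitClamp; gcongr

theorem abs_unitClamp_sub_le (s t : ℝ) : |unitClamp s - unitClamp t| ≤ |s - t| := by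
  unfold unitClamp
  calc _ ≤ |min s 1 - min t 1| := by
        have := abs_max_sub_max_le_max 0 (min s 1) 0 (min t 1)
        simpa using this
    _ ≤ |s - t| := by
        have := abs_min_sub_min_le_max s 1 t 1
        simpa using this

theorem lipschitzWith_unitClamp : LipschitzWith 1 unitClamp :=
  LipschitzWith.of_dist_le_mul fun s t => by
    simpa [Real.dist_eq] using abs_unitClamp_sub_le s t

/-! ### Seminorms attached to the energy, and lattice operations in the domain. -/

namespace PEnergyForm

section Basic

variable {p : ℝ} [Fact (1 < p)] {X : Type*} [MeasurableSpace X] {m : Measure X}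
  (𝓔 : PEnergyForm p m)

/-- The seminorm `E ^ (1/p)`. -/
def rootEnergy : Seminorm ℝ 𝓔.domain := 𝓔.isPEnergy.2.choose

theorem rootEnergy_apply (u : 𝓔.domain) : 𝓔.rootEnergy u = 𝓔.energy u ^ (1 / p) :=
  𝓔.isPEnergy.2.choose_spec u

theorem norm_ofSpace_symm (u : 𝓔.domain) :
    ‖𝓔.ofSpace.symm u‖ = ‖(u : Lp ℝ (ENNReal.ofReal p) m)‖ + 𝓔.rootEnergy u := by
  rw [rootEnergy_apply]; rfl

theorem rootEnergy_le_of_energy_le {u v : 𝓔.domain} (h : 𝓔.energy u ≤ 𝓔.energy v) :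
    𝓔.rootEnergy u ≤ 𝓔.rootEnergy v := by
  rw [rootEnergy_apply, rootEnergy_apply]
  have hp : 1 < p := Fact.out
  exact Real.rpow_le_rpow (𝓔.isPEnergy.1 u) h (by positivity)

theorem toFun_add (u v : 𝓔.domain) :
    𝓔.toFun (u + v) =ᵐ[m] fun x => 𝓔.toFun u x + 𝓔.toFun v x := Lp.coeFn_add _ _

theorem toFun_sub (u v : 𝓔.domain) :
    𝓔.toFun (u - v) =ᵐ[m] fun x => 𝓔.toFun u x - 𝓔.toFun v x := Lp.coeFn_sub _ _

theorem toFun_smul (c : ℝ) (u : 𝓔.domain) :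
    𝓔.toFun (c • u) =ᵐ[m] fun x => c * 𝓔.toFun u x := Lp.coeFn_smul _ _

theorem toFun_neg (u : 𝓔.domain) :
    𝓔.toFun (-u) =ᵐ[m] fun x => -𝓔.toFun u x := Lp.coeFn_neg _

theorem toFun_zero : 𝓔.toFun 0 =ᵐ[m] fun _ => 0 := Lp.coeFn_zero _ _ _

theorem toFun_sum {ι : Type*} (s : Finset ι) (c : ι → ℝ) (u : ι → 𝓔.domain) :
    𝓔.toFun (∑ i ∈ s, c i • u i) =ᵐ[m] fun x => ∑ i ∈ s, c i * 𝓔.toFun (u i) x := by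
  classical
  induction s using Finset.induction_on with
  | empty => simpa using 𝓔.toFun_zero
  | insert a s ha ih =>
    rw [Finset.sum_insert ha]
    filter_upwards [𝓔.toFun_add (c a • u a) (∑ i ∈ s, c i • u i), 𝓔.toFun_smul (c a) (u a), ih]
      with x h1 h2 h3
    rw [h1, h2, h3, Finset.sum_insert ha]

end Basic

section Lattice

variable {p : ℝ} [Fact (1 < p)] {X : Type*} [MetricSpace X] [MeasurableSpace X] {m : Measure X}
  {𝓔 : PEnergyForm p m} {Γ : 𝓔.domain → Measure X}

theorem IsRegularWithEnergyMeasures.exists_comp (h : 𝓔.IsRegularWithEnergyMeasures Γ)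
    (u : 𝓔.domain) {φ : ℝ → ℝ} (hφ : LipschitzWith 1 φ) (h0 : φ 0 = 0) :
    ∃ v : 𝓔.domain, (𝓔.toFun v =ᵐ[m] fun x => φ (𝓔.toFun u x)) ∧
      𝓔.rootEnergy v ≤ 𝓔.rootEnergy u := by
  obtain ⟨v, h1, h2⟩ := h.lipschitz_contraction u φ hφ h0
  exact ⟨v, h1, 𝓔.rootEnergy_le_of_energy_le h2⟩

/-- Uses `min a b = (a + b - |a - b|) / 2` and the contraction property for the absolute value. -/
theorem IsRegularWithEnergyMeasures.exists_min (h : 𝓔.IsRegularWithEnergyMeasures Γ)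
    (u v : 𝓔.domain) :
    ∃ w : 𝓔.domain, (𝓔.toFun w =ᵐ[m] fun x => min (𝓔.toFun u x) (𝓔.toFun v x)) ∧
      𝓔.rootEnergy w ≤ 𝓔.rootEnergy u + 𝓔.rootEnergy v := by
  obtain ⟨z, hz1, hz2⟩ := h.exists_comp (u - v) (φ := fun t => |t|)
    (LipschitzWith.of_dist_le_mul fun s t => by
      simpa [Real.dist_eq] using abs_abs_sub_abs_le_abs_sub s t) abs_zero
  refine ⟨(1 / 2 : ℝ) • (u + v - z), ?_, ?_⟩
  · filter_upwards [hz1, 𝓔.toFun_smul (1 / 2) (u + v - z), 𝓔.toFun_sub (u + v) z,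
      𝓔.toFun_add u v, 𝓔.toFun_sub u v] with x h1 h2 h3 h4 h5
    rw [h2, h3, h4, h1, h5]
    rcases le_total (𝓔.toFun u x) (𝓔.toFun v x) with hle | hle
    · rw [min_eq_left hle, abs_of_nonpos (by linarith)]; ring
    · rw [min_eq_right hle, abs_of_nonneg (by linarith)]; ring
  · rw [map_smul_eq_mul]
    have h1 := map_sub_le_add 𝓔.rootEnergy (u + v) z
    have h2 := map_add_le_add 𝓔.rootEnergy u v
    have h3 := map_sub_le_add 𝓔.rootEnergy u v
    norm_num
    linarith

theorem IsRegularWithEnergyMeasures.exists_max (h : 𝓔.IsRegularWithEnergyMeasures Γ)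
    (u v : 𝓔.domain) :
    ∃ w : 𝓔.domain, (𝓔.toFun w =ᵐ[m] fun x => max (𝓔.toFun u x) (𝓔.toFun v x)) ∧
      𝓔.rootEnergy w ≤ 𝓔.rootEnergy u + 𝓔.rootEnergy v := by
  obtain ⟨w, h1, h2⟩ := h.exists_min (-u) (-v)
  refine ⟨-w, ?_, by simpa using h2⟩
  filter_upwards [h1, 𝓔.toFun_neg w, 𝓔.toFun_neg u, 𝓔.toFun_neg v] with x k1 k2 k3 k4
  rw [k2, k1, k3, k4, min_neg_neg, neg_neg]

/-- The truncation level is itself an element of the domain. This allows localization by a cutoff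
function using lattice operations alone, with control of the energy. -/
theorem IsRegularWithEnergyMeasures.exists_clampAt (h : 𝓔.IsRegularWithEnergyMeasures Γ)
    (u v : 𝓔.domain) :
    ∃ w : 𝓔.domain, (𝓔.toFun w =ᵐ[m] fun x => clampAt (𝓔.toFun v x) (𝓔.toFun u x)) ∧
      𝓔.rootEnergy w ≤ 𝓔.rootEnergy u + 2 * 𝓔.rootEnergy v := by
  obtain ⟨w, h1, h2⟩ := h.exists_min u v
  obtain ⟨z, h3, h4⟩ := h.exists_max (-v) w
  refine ⟨z, ?_, ?_⟩
  · filter_upwards [h1, h3, 𝓔.toFun_neg v] with x k1 k2 k3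
    rw [k2, k1, k3, clampAt]
  · rw [map_neg_eq_map] at h4
    linarith

/-- The seminorm `Γ⟨·⟩(A) ^ (1/p)`. -/
def IsRegularWithEnergyMeasures.seminormOn (h : 𝓔.IsRegularWithEnergyMeasures Γ) {A : Set X}
    (hA : MeasurableSet A) : Seminorm ℝ 𝓔.domain := (h.measure_isPEnergy A hA).2.choose

theorem IsRegularWithEnergyMeasures.seminormOn_apply (h : 𝓔.IsRegularWithEnergyMeasures Γ)
    {A : Set X} (hA : MeasurableSet A) (u : 𝓔.domain) :
    h.seminormOn hA u = (Γ u).real A ^ (1 / p) :=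
  (h.measure_isPEnergy A hA).2.choose_spec u

theorem IsRegularWithEnergyMeasures.seminormOn_le_rootEnergy
    (h : 𝓔.IsRegularWithEnergyMeasures Γ) {A : Set X} (hA : MeasurableSet A) (u : 𝓔.domain) :
    h.seminormOn hA u ≤ 𝓔.rootEnergy u := by
  have hp : 1 < p := Fact.out
  have := h.finite u
  rw [h.seminormOn_apply, rootEnergy_apply, h.energy_eq]
  exact Real.rpow_le_rpow measureReal_nonneg (measureReal_mono (subset_univ A)) (by positivity)

theorem IsRegularWithEnergyMeasures.measureReal_eq (h : 𝓔.IsRegularWithEnergyMeasures Γ)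
    {A : Set X} (hA : MeasurableSet A) (u : 𝓔.domain) :
    (Γ u).real A = h.seminormOn hA u ^ p := by
  have hp : 1 < p := Fact.out
  rw [h.seminormOn_apply, ← Real.rpow_mul measureReal_nonneg, one_div,
    inv_mul_cancel₀ (by positivity), Real.rpow_one]

theorem IsRegularWithEnergyMeasures.measure_eq_zero_iff (h : 𝓔.IsRegularWithEnergyMeasures Γ)
    {A : Set X} (hA : MeasurableSet A) (u : 𝓔.domain) :
    Γ u A = 0 ↔ h.seminormOn hA u = 0 := by
  have hp : 1 < p := Fact.out
  have := h.finite u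
  rw [h.seminormOn_apply, Real.rpow_eq_zero measureReal_nonneg (by positivity),
    measureReal_eq_zero_iff]

theorem IsRegularWithEnergyMeasures.measure_zero (h : 𝓔.IsRegularWithEnergyMeasures Γ)
    {A : Set X} (hA : MeasurableSet A) : Γ 0 A = 0 := by
  rw [h.measure_eq_zero_iff hA, map_zero]

/-- Weak lower semicontinuity: a sequence bounded in the domain and converging in `L^p`
converges weakly in the domain. -/
theorem IsRegularWithEnergyMeasures.seminormOn_eq_zero_of_tendsto
    (h : 𝓔.IsRegularWithEnergyMeasures Γ) {A : Set X} (hA : MeasurableSet A)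
    (u : 𝓔.domain) (w : ℕ → 𝓔.domain) {M : ℝ} (hM : ∀ n, 𝓔.rootEnergy (w n) ≤ M)
    (hw : ∀ n, h.seminormOn hA (w n) = 0)
    (hlim : Tendsto (fun n => ‖((w n - u : 𝓔.domain) : Lp ℝ (ENNReal.ofReal p) m)‖) atTop (𝓝 0)) :
    h.seminormOn hA u = 0 := by
  obtain ⟨L, hL⟩ := hlim.bddAbove_range
  have hL' : ∀ n, ‖((w n - u : 𝓔.domain) : Lp ℝ (ENNReal.ofReal p) m)‖ ≤ L :=
    fun n => hL ⟨n, rfl⟩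
  obtain ⟨F, hF⟩ := exists_mem_of_eventually_mem_of_reflexive h.reflexive (l := atTop)
    (fun n => 𝓔.ofSpace.symm (w n)) (M := L + ‖(u : Lp ℝ (ENNReal.ofReal p) m)‖ + M) fun n => by
      rw [norm_ofSpace_symm]
      have h1 : ‖(w n : Lp ℝ (ENNReal.ofReal p) m)‖ ≤
          ‖((w n - u : 𝓔.domain) : Lp ℝ (ENNReal.ofReal p) m)‖
            + ‖(u : Lp ℝ (ENNReal.ofReal p) m)‖ := by
        rw [Submodule.coe_sub]
        exact norm_le_norm_sub_add _ _
      linarith [hL' n, hM n]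
  let NL : Seminorm ℝ 𝓔.Space := (normSeminorm ℝ (Lp ℝ (ENNReal.ofReal p) m)).comp
    (𝓔.domain.subtype.comp (𝓔.ofSpace : 𝓔.Space →ₗ[ℝ] 𝓔.domain))
  have hNL : ∀ w, NL w ≤ ‖w‖ := fun w => by
    have := 𝓔.norm_ofSpace_symm (𝓔.ofSpace w)
    have h2 := apply_nonneg 𝓔.rootEnergy (𝓔.ofSpace w)
    simp only [LinearEquiv.symm_apply_apply] at this
    rw [this]
    change ‖(𝓔.ofSpace w : Lp ℝ (ENNReal.ofReal p) m)‖ ≤ _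
    linarith
  let NA : Seminorm ℝ 𝓔.Space := (h.seminormOn hA).comp (𝓔.ofSpace : 𝓔.Space →ₗ[ℝ] 𝓔.domain)
  have hNA : ∀ w, NA w ≤ ‖w‖ := fun w => by
    have := 𝓔.norm_ofSpace_symm (𝓔.ofSpace w)
    have h2 := h.seminormOn_le_rootEnergy hA (𝓔.ofSpace w)
    simp only [LinearEquiv.symm_apply_apply] at this
    rw [this]
    change h.seminormOn hA (𝓔.ofSpace w) ≤ _
    linarith [norm_nonneg (𝓔.ofSpace w : Lp ℝ (ENNReal.ofReal p) m)]
  -- The weak limit is identified with `u`: every `L^p` ball around `u` is closed and convex in the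
  -- energy norm and eventually contains the sequence.
  have h1 : NL (F - 𝓔.ofSpace.symm u) ≤ 0 := by
    refine le_of_forall_pos_le_add fun ε hε => ?_
    rw [zero_add]
    refine hF {w | NL (w - 𝓔.ofSpace.symm u) ≤ ε} (NL.convex_sub_le _ _)
      (NL.isClosed_sub_le hNL _ _) ?_
    filter_upwards [hlim.eventually (ge_mem_nhds hε)] with n hn using hn
  have h2 : NA (F - 0) ≤ 0 := by
    refine hF {w | NA (w - 0) ≤ 0} (NA.convex_sub_le _ _)
      (NA.isClosed_sub_le hNA _ _) (Eventually.of_forall fun n => ?_)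
    rw [mem_ofPred_eq, sub_zero]
    exact (hw n).le
  have h3 : 𝓔.ofSpace F = u := by
    have h4 : ‖((𝓔.ofSpace F - u : 𝓔.domain) : Lp ℝ (ENNReal.ofReal p) m)‖ = 0 :=
      le_antisymm h1 (norm_nonneg _)
    have h5 := norm_eq_zero.1 h4
    exact sub_eq_zero.1 (Subtype.ext h5)
  rw [sub_zero] at h2
  rw [← h3]
  exact le_antisymm h2 (apply_nonneg _ _)

end Lattice

/-! ### Strong locality for bounded elements of the domain. -/

section Locality

variable {p : ℝ} [Fact (1 < p)] {X : Type*} [MetricSpace X] [LocallyCompactSpace X]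
  [MeasurableSpace X] [BorelSpace X] {m : Measure X}
  {𝓔 : PEnergyForm p m} {Γ : 𝓔.domain → Measure X}

/-- A Urysohn function is approximated uniformly by a continuous element of the domain, and the
error is removed by composing with a piecewise linear function that is exactly 0 or 1 near the
extreme values. -/
theorem IsRegularWithEnergyMeasures.exists_cutoff (h : 𝓔.IsRegularWithEnergyMeasures Γ)
    {V : Set X} (hV : IsOpen V) {x : X} (hx : x ∈ V) :
    ∃ (φ : 𝓔.domain) (g : C_c(X, ℝ)) (W : Set X), 𝓔.toFun φ =ᵐ[m] g ∧ IsOpen W ∧ x ∈ W ∧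
      (∀ y ∈ W, g y = 1) ∧ (∀ y ∉ V, g y = 0) ∧ ∀ y, 0 ≤ g y ∧ g y ≤ 1 := by
  obtain ⟨f, hf1, hf0, hfc, hf01⟩ := exists_continuous_one_zero_of_isCompact
    (isCompact_singleton (x := x)) hV.isClosed_compl
    (by rw [Set.disjoint_singleton_left]; simpa using hx)
  obtain ⟨u, k, huk, hk⟩ := h.dense_Cc ⟨f, hfc⟩ (1 / 4) (by norm_num)
  have hk : ∀ y, |f y - k y| < 1 / 4 := hk
  -- With error below `1/4`, the argument `2k - 1/2` is negative where the Urysohn function vanishes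
  -- and exceeds 1 where `k > 3/4`. The factor 2 is put on `u`, so that `τ` stays 1-Lipschitz.
  let τ : ℝ → ℝ := fun t => unitClamp (t - 1 / 2)
  have hτ0 : τ 0 = 0 := unitClamp_of_nonpos (by norm_num)
  obtain ⟨φ, hφ, -⟩ := h.exists_comp ((2 : ℝ) • u) (φ := τ)
    (LipschitzWith.of_dist_le_mul fun s t => by
      simpa [Real.dist_eq, τ] using abs_unitClamp_sub_le (s - 1 / 2) (t - 1 / 2)) hτ0
  have hτc : Continuous τ := lipschitzWith_unitClamp.continuous.comp (by fun_prop)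
  refine ⟨φ, ⟨⟨fun y => τ (2 * k y), hτc.comp (continuous_const.mul k.continuous)⟩, ?_⟩,
    {y | 3 / 4 < k y}, ?_, isOpen_lt continuous_const k.continuous, ?_, ?_, ?_, ?_⟩
  · refine k.hasCompactSupport.mono fun y hy => ?_
    contrapose! hy
    simp only [Function.mem_support, not_not] at hy ⊢
    simp [hy, hτ0]
  · filter_upwards [hφ, huk, 𝓔.toFun_smul 2 u] with y h1 h2 h3
    rw [h1, h3, h2]; rfl
  · have h1 : f x = 1 := hf1 rfl
    have h2 := abs_lt.1 (hk x)
    rw [mem_ofPred_eq]; linarith [h2.2]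
  · intro y (hy : 3 / 4 < k y)
    exact unitClamp_of_one_le (by linarith)
  · intro y hy
    have h1 : f y = 0 := hf0 hy
    have h2 := abs_lt.1 (hk y)
    exact unitClamp_of_nonpos (by linarith)
  · exact fun y => ⟨unitClamp_nonneg _, unitClamp_le_one _⟩

theorem IsRegularWithEnergyMeasures.measure_eq_zero_of_const
    (h : 𝓔.IsRegularWithEnergyMeasures Γ) (u : 𝓔.domain) (f : C_c(X, ℝ)) (hf : 𝓔.toFun u =ᵐ[m] f)
    {W : Set X} (hW : IsOpen W) (c : ℝ) (hc : ∀ y ∈ W, f y = c) : Γ u W = 0 := by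
  have h1 := h.strongly_local u 0 f 0 hf 𝓔.toFun_zero W hW ⟨c, fun x hx => by simp [hc x hx]⟩
  have h2 := congrArg (fun μ => μ W) h1
  simp only [Measure.restrict_apply_self] at h2
  rw [h2, h.measure_zero hW.measurableSet]

/-- The function `u` is approximated in `L^p`, with bounded energy, by continuous elements that
vanish identically on `W`. These have no energy on `W` by strong locality, and weak lower
semicontinuity carries this over to `u`. -/
theorem IsRegularWithEnergyMeasures.measure_eq_zero_of_cutoff
    (h : 𝓔.IsRegularWithEnergyMeasures Γ) (u : 𝓔.domain) {M : ℝ}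
    (hM : ∀ᵐ x ∂m, |𝓔.toFun u x| ≤ M) {V : Set X}
    (hu : ∀ᵐ x ∂m, x ∈ V → 𝓔.toFun u x = 0)
    {φ : 𝓔.domain} {g : C_c(X, ℝ)} {W : Set X} (hφ : 𝓔.toFun φ =ᵐ[m] g) (hW : IsOpen W)
    (hgW : ∀ y ∈ W, g y = 1) (hgV : ∀ y ∉ V, g y = 0) (hg : ∀ y, 0 ≤ g y) :
    Γ u W = 0 := by
  wlog hM0 : 0 ≤ M generalizing M
  · exact this (M := |M|) (hM.mono fun x hx => hx.trans (le_abs_self M)) (abs_nonneg M)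
  rw [h.measure_eq_zero_iff hW.measurableSet]
  -- For a continuous `k` close to `u`, the approximant is `clampAt M k - clampAt (M * g) k`. It is
  -- zero where `g = 1`, hence on `W`, and reduces to `clampAt M k` where `g = 0`, hence off `V`.
  have key : ∀ n : ℕ, ∃ w : 𝓔.domain,
      𝓔.rootEnergy w ≤ 2 * (𝓔.rootEnergy u + 1) + 2 * 𝓔.rootEnergy (M • φ) ∧
      h.seminormOn hW.measurableSet w = 0 ∧
      ‖((w - u : 𝓔.domain) : Lp ℝ (ENNReal.ofReal p) m)‖ ≤ 2 * (1 / ((n : ℝ) + 1)) := by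
    intro n
    obtain ⟨v', ⟨k, hk⟩, hvu⟩ := Metric.mem_closure_iff.1 (h.dense_domain (𝓔.ofSpace.symm u))
      (1 / ((n : ℝ) + 1)) Nat.one_div_pos_of_nat
    obtain ⟨v, rfl⟩ := 𝓔.ofSpace.symm.surjective v'
    rw [LinearEquiv.apply_symm_apply] at hk
    rw [dist_comm, dist_eq_norm, ← map_sub, norm_ofSpace_symm] at hvu
    have hn1 : (1 : ℝ) / ((n : ℝ) + 1) ≤ 1 := by
      rw [div_le_one (by positivity)]; linarith [(Nat.cast_nonneg n : (0 : ℝ) ≤ n)]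
    have hvu1 : ‖((v - u : 𝓔.domain) : Lp ℝ (ENNReal.ofReal p) m)‖ ≤ 1 / ((n : ℝ) + 1) := by
      linarith [apply_nonneg 𝓔.rootEnergy (v - u)]
    have hvE : 𝓔.rootEnergy v ≤ 𝓔.rootEnergy u + 1 := by
      have h1 := map_add_le_add 𝓔.rootEnergy (v - u) u
      rw [sub_add_cancel] at h1
      linarith [norm_nonneg ((v - u : 𝓔.domain) : Lp ℝ (ENNReal.ofReal p) m)]
    obtain ⟨w₁, hw₁, hw₁E⟩ := h.exists_comp v (lipschitzWith_clampAt M) (clampAt_zero M hM0)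
    obtain ⟨w₂, hw₂, hw₂E⟩ := h.exists_clampAt v (M • φ)
    have hw₂' : 𝓔.toFun w₂ =ᵐ[m] fun x => clampAt (M * g x) (k x) := by
      filter_upwards [hw₂, 𝓔.toFun_smul M φ, hφ, hk] with x h1 h2 h3 h4
      rw [h1, h2, h3, h4]
    have hw₁' : 𝓔.toFun w₁ =ᵐ[m] fun x => clampAt M (k x) := by
      filter_upwards [hw₁, hk] with x h1 h2
      rw [h1, h2]
    refine ⟨w₁ - w₂, ?_, ?_, ?_⟩
    · linarith [map_sub_le_add 𝓔.rootEnergy w₁ w₂]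
    · rw [← h.measure_eq_zero_iff]
      have hc : Continuous fun x => clampAt M (k x) - clampAt (M * g x) (k x) := by
        unfold clampAt; fun_prop
      refine h.measure_eq_zero_of_const _ ⟨⟨_, hc⟩, ?_⟩ ?_ hW 0 ?_
      · refine k.hasCompactSupport.mono fun y hy => ?_
        contrapose! hy
        simp only [Function.mem_support, not_not] at hy ⊢
        simp [hy, clampAt_zero M hM0, clampAt_zero _ (mul_nonneg hM0 (hg y))]
      · filter_upwards [𝓔.toFun_sub w₁ w₂, hw₁', hw₂'] with x h1 h2 h3
        rw [h1, h2, h3]; rfl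
      · intro y hy
        change clampAt M (k y) - clampAt (M * g y) (k y) = 0
        simp [hgW y hy]
    · refine le_trans ?_ (mul_le_mul_of_nonneg_left hvu1 zero_le_two)
      refine Lp.norm_le_mul_norm_of_ae_le_mul ?_
      filter_upwards [𝓔.toFun_sub (w₁ - w₂) u, 𝓔.toFun_sub w₁ w₂, hw₁', hw₂', 𝓔.toFun_sub v u, hk,
        hu, hM] with x h1 h2 h3 h4 h5 h6 h7 h8
      change ‖𝓔.toFun (w₁ - w₂ - u) x‖ ≤ 2 * ‖𝓔.toFun (v - u) x‖
      rw [h1, h2, h3, h4, h5, h6, Real.norm_eq_abs, Real.norm_eq_abs]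
      by_cases hx : x ∈ V
      -- On `V` the function `u` vanishes, so each clamp is at most `|k| = |k - u|`. Off `V` only
      -- the first clamp remains, and it fixes `u`.
      · have e1 := abs_clampAt_sub_le M (k x) 0
        have e2 := abs_clampAt_sub_le (M * g x) (k x) 0
        rw [clampAt_zero _ hM0] at e1
        rw [clampAt_zero _ (mul_nonneg hM0 (hg x))] at e2
        rw [h7 hx]
        simp only [sub_zero] at *
        exact (abs_sub _ _).trans (by linarith)
      · have e1 := abs_clampAt_sub_le M (k x) (𝓔.toFun u x)
        rw [clampAt_of_abs_le h8] at e1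
        rw [hgV x hx, mul_zero, zero_clampAt, sub_zero]
        linarith [abs_nonneg ((k : X → ℝ) x - 𝓔.toFun u x)]
  choose w hwE hw0 hwl using key
  refine h.seminormOn_eq_zero_of_tendsto _ u w hwE hw0 (squeeze_zero (fun _ => norm_nonneg _) hwl ?_)
  simpa using tendsto_one_div_add_atTop_nhds_zero_nat.const_mul (2 : ℝ)

/-- Strong locality for bounded functions in the domain. -/
theorem IsRegularWithEnergyMeasures.measure_eq_zero_of_ae_eq_const [SecondCountableTopology X]
    (h : 𝓔.IsRegularWithEnergyMeasures Γ) (u : 𝓔.domain) {M : ℝ}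
    (hM : ∀ᵐ x ∂m, |𝓔.toFun u x| ≤ M) {V : Set X} (hV : IsOpen V) (c : ℝ)
    (hu : ∀ᵐ x ∂m, x ∈ V → 𝓔.toFun u x = c) : Γ u V = 0 := by
  refine measure_null_of_locally_null V fun x hx => ?_
  -- Two nested cutoffs: `c • φ` carries the constant near `x` and has no energy on `W`. The
  -- difference `u - c • φ` vanishes on `W ∩ V`, so the second cutoff, supported there, disposes of
  -- it.
  obtain ⟨φ, g, W, hφ, hW, hxW, hgW, hgV, hg⟩ := h.exists_cutoff hV hx
  obtain ⟨φ', g', W', hφ', hW', hxW', hgW', hgV', hg'⟩ :=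
    h.exists_cutoff (hW.inter hV) ⟨hxW, hx⟩
  refine ⟨W' ∩ W, mem_nhdsWithin_of_mem_nhds ((hW'.inter hW).mem_nhds ⟨hxW', hxW⟩), ?_⟩
  have hO := (hW'.inter hW).measurableSet
  have h1 : Γ (u - c • φ) W' = 0 := by
    refine h.measure_eq_zero_of_cutoff _ (M := M + |c|) (V := W ∩ V) ?_ ?_ hφ' hW' hgW' hgV'
      fun y => (hg' y).1
    · filter_upwards [𝓔.toFun_sub u (c • φ), 𝓔.toFun_smul c φ, hφ, hM] with y h1 h2 h3 h4
      rw [h1, h2, h3]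
      refine (abs_sub _ _).trans (add_le_add h4 ?_)
      rw [abs_mul, abs_of_nonneg (hg y).1]
      exact mul_le_of_le_one_right (abs_nonneg _) (hg y).2
    · filter_upwards [𝓔.toFun_sub u (c • φ), 𝓔.toFun_smul c φ, hφ, hu] with y h1 h2 h3 h4 hy
      rw [h1, h2, h3, h4 hy.2, hgW y hy.1]; ring
  have h2 : Γ (c • φ) W = 0 := by
    refine h.measure_eq_zero_of_const _ (c • g) ?_ hW c ?_
    · filter_upwards [𝓔.toFun_smul c φ, hφ] with y h1 h2
      rw [h1, h2]; rfl
    · intro y hy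
      change c • g y = c
      simp [hgW y hy]
  rw [h.measure_eq_zero_iff hO]
  have h3 := (h.measure_eq_zero_iff hO _).1 (measure_mono_null inter_subset_left h1)
  have h4 := (h.measure_eq_zero_iff hO _).1 (measure_mono_null inter_subset_right h2)
  refine le_antisymm ?_ (apply_nonneg _ _)
  have h5 := map_add_le_add (h.seminormOn hO) (u - c • φ) (c • φ)
  rwa [sub_add_cancel, h3, h4, add_zero] at h5

end Locality

end PEnergyForm
end

/-! ### Consequences of volume doubling: packing, covering, properness, bounded overlap. -/

noncomputable section
open Filter Topology

universe u

section Doubling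

variable {X : Type u} [MetricSpace X] [MeasurableSpace X] {m : Measure X}

theorem VolumeDoubling.measure_ball_two_pow_le (h : VolumeDoubling m) :
    ∃ c : ℝ≥0, ∀ (k : ℕ) (x : X) (r : ℝ), 0 < r →
      m (ball x (2 ^ k * r)) ≤ c ^ k * m (ball x r) := by
  obtain ⟨c, -, hc⟩ := h
  refine ⟨c, fun k => ?_⟩
  induction k with
  | zero => intro x r _; simp
  | succ k ih =>
    intro x r hr
    have h1 := hc x (2 ^ k * r) (by positivity)
    rw [pow_succ', mul_assoc, pow_succ', mul_assoc]
    exact h1.trans (by gcongr; exact ih x r hr)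

theorem VolumeDoubling.exists_measure_ball_le (h : VolumeDoubling m) (K : ℝ) :
    ∃ C : ℝ≥0, ∀ (x y : X) (r : ℝ), 0 < r → dist x y ≤ K * r →
      m (ball x (K * r)) ≤ C * m (ball y r) := by
  obtain ⟨c, hc⟩ := h.measure_ball_two_pow_le
  obtain ⟨k, hk⟩ := pow_unbounded_of_one_lt (2 * K) (one_lt_two (α := ℝ))
  refine ⟨c ^ k, fun x y r hr hxy => ?_⟩
  rw [ENNReal.coe_pow]
  refine (measure_mono (ball_subset_ball' ?_)).trans (hc k y r hr)
  have := mul_le_mul_of_nonneg_right hk.le hr.le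
  linarith

theorem VolumeDoubling.measure_ball_lt_top [LocallyCompactSpace X] [IsFiniteMeasureOnCompacts m]
    (h : VolumeDoubling m) (x : X) (r : ℝ) : m (ball x r) < ∞ := by
  obtain ⟨s, hs, hsm⟩ := (m.finiteAt_nhds x).exists_mem_basis nhds_basis_ball
  obtain ⟨c, hc⟩ := h.exists_measure_ball_le (r / s)
  by_cases hr : r ≤ 0
  · simp [ball_eq_empty.2 hr]
  push Not at hr
  have h1 := hc x x s hs (by rw [dist_self]; exact mul_nonneg (div_nonneg hr.le hs.le) hs.le)
  rw [div_mul_cancel₀ _ hs.ne'] at h1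
  exact h1.trans_lt (ENNReal.mul_lt_top ENNReal.coe_lt_top hsm)

variable [OpensMeasurableSpace X] [m.IsOpenPosMeasure] [LocallyCompactSpace X]
  [IsFiniteMeasureOnCompacts m]

/-- Each of the disjoint balls carries a fixed fraction of the measure of one ball containing them
all, which is positive and finite. -/
theorem VolumeDoubling.exists_card_le (h : VolumeDoubling m) (K : ℝ) :
    ∃ N : ℕ, ∀ (ι : Type u) (y : X) (r : ℝ) (x : ι → X) (J : Finset ι), 0 < r →
      (∀ i ∈ J, dist (x i) y ≤ K * r) → (J : Set ι).PairwiseDisjoint (fun i => ball (x i) r) →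
      J.card ≤ N := by
  wlog hK : 0 ≤ K generalizing K
  · obtain ⟨N, hN⟩ := this |K| (abs_nonneg K)
    exact ⟨N, fun ι y r x J hr hJ hd => hN ι y r x J hr (fun i hi => (hJ i hi).trans
      (mul_le_mul_of_nonneg_right (le_abs_self K) hr.le)) hd⟩
  obtain ⟨C, hC⟩ := h.exists_measure_ball_le (K + 1)
  refine ⟨⌊C⌋₊, fun ι y r x J hr hJ hd => ?_⟩
  set M := m (ball y ((K + 1) * r)) with hM
  have hM0 : M ≠ 0 := (measure_ball_pos m y (by positivity)).ne'
  have hMt : M ≠ ∞ := (h.measure_ball_lt_top _ _).ne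
  have h1 : ∑ i ∈ J, m (ball (x i) r) ≤ M := by
    rw [← measure_biUnion_finset hd fun i _ => measurableSet_ball]
    refine measure_mono (iUnion₂_subset fun i hi => ball_subset_ball' ?_)
    linarith [hJ i hi]
  have h2 : J.card * M ≤ C * M := by
    calc J.card * M = ∑ i ∈ J, M := by simp
      _ ≤ ∑ i ∈ J, C * m (ball (x i) r) := Finset.sum_le_sum fun i hi => hC y (x i) r hr (by
          rw [dist_comm]; linarith [hJ i hi])
      _ = C * ∑ i ∈ J, m (ball (x i) r) := by rw [Finset.mul_sum]
      _ ≤ C * M := by gcongr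
  have h3 : (J.card : ℝ≥0∞) ≤ C := (ENNReal.mul_le_mul_iff_left hM0 hMt).1 h2
  rw [Nat.le_floor_iff (by positivity)]
  exact_mod_cast h3

theorem Set.finite_of_forall_card_le {α : Type*} {s : Set α} {N : ℕ}
    (h : ∀ J : Finset α, (J : Set α) ⊆ s → J.card ≤ N) : s.Finite := by
  by_contra hs
  obtain ⟨J, hJ, hc⟩ := Set.Infinite.exists_subset_card_eq hs (N + 1)
  have := h J hJ
  omega

theorem VolumeDoubling.exists_finset_cover (h : VolumeDoubling m) (K : ℝ) :
    ∃ N : ℕ, ∀ (y : X) (r : ℝ) (T : Set X), 0 < r → T ⊆ closedBall y (K * r) →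
      ∃ E : Finset X, (E : Set X) ⊆ T ∧ E.card ≤ N ∧ T ⊆ ⋃ e ∈ E, ball e r := by
  obtain ⟨N, hN⟩ := h.exists_card_le (K * 8)
  refine ⟨N, fun y r T hr hT => ?_⟩
  -- Disjoint closed balls of radius `r / 8` whose 4-fold enlargements have radius `r / 2 < r`; the
  -- packing bound is used at radius `r / 8`, whence the factor 8 in `K * 8`.
  obtain ⟨u, hu, hd, hcov⟩ := Vitali.exists_disjoint_subfamily_covering_enlargement_closedBall
    T id (fun _ => r / 8) (r / 8) (fun _ _ => le_rfl) 4 (by norm_num)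
  have hcard : ∀ J : Finset X, (J : Set X) ⊆ u → J.card ≤ N := fun J hJ => by
    refine hN X y (r / 8) id J (by positivity) (fun i hi => ?_) ?_
    · have := hT (hu (hJ hi))
      rw [mem_closedBall] at this
      simp only [id]
      linarith
    · exact (hd.subset hJ).mono_on fun i _ => ball_subset_closedBall
  have hfin := Set.finite_of_forall_card_le hcard
  refine ⟨hfin.toFinset, by simpa using hu, hcard _ (by simp), fun z hz => ?_⟩
  obtain ⟨b, hb, hzb⟩ := hcov z hz
  simp only [mem_iUnion, Finite.mem_toFinset]
  refine ⟨b, hb, ?_⟩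
  have := hzb (mem_closedBall_self (by positivity))
  simp only [id, mem_closedBall] at this
  rw [mem_ball]
  linarith

theorem VolumeDoubling.properSpace [CompleteSpace X] (h : VolumeDoubling m) : ProperSpace X := by
  refine ⟨fun x r => TotallyBounded.isCompact_of_isClosed ?_ isClosed_closedBall⟩
  rw [Metric.totallyBounded_iff]
  intro ε hε
  obtain ⟨N, hN⟩ := h.exists_finset_cover (r / ε)
  obtain ⟨E, -, -, hE⟩ := hN x ε (closedBall x r) hε (by rw [div_mul_cancel₀ _ hε.ne'])
  exact ⟨E, E.finite_toSet, by simpa using hE⟩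

end Doubling

/-- A measure charges a family of sets of multiplicity at most `N` by at most `N` times
its charge of the union. -/
theorem MeasureTheory.tsum_measure_le_of_card_le {X ι : Type*} [MeasurableSpace X] [Countable ι]
    (μ : Measure X) (A : ι → Set X) (hA : ∀ i, MeasurableSet (A i)) (N : ℕ)
    (hN : ∀ (x : X) (J : Finset ι), (∀ i ∈ J, x ∈ A i) → J.card ≤ N) {S : Set X}
    (hS : ∀ i, A i ⊆ S) : ∑' i, μ (A i) ≤ N * μ S := by
  classical
  calc ∑' i, μ (A i) = ∑' i, (∫⁻ x, (A i).indicator 1 x ∂μ) := by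
        simp_rw [lintegral_indicator_one (hA _)]
    _ = ∫⁻ x, ∑' i, (A i).indicator 1 x ∂μ :=
        (lintegral_tsum fun i => (measurable_one.indicator (hA i)).aemeasurable).symm
    -- `S` is not assumed measurable, so a measurable hull of the same measure replaces it.
    _ ≤ ∫⁻ x, (toMeasurable μ S).indicator (fun _ => (N : ℝ≥0∞)) x ∂μ := by
        refine lintegral_mono fun x => ?_
        rw [ENNReal.tsum_eq_iSup_sum]
        refine iSup_le fun J => ?_
        have h1 : ∑ i ∈ J, (A i).indicator (1 : X → ℝ≥0∞) x =
            ((J.filter fun i => x ∈ A i).card : ℝ≥0∞) := by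
          rw [Finset.card_filter, Nat.cast_sum]
          refine Finset.sum_congr rfl fun i _ => ?_
          by_cases h : x ∈ A i <;> simp [h]
        rw [h1]
        by_cases hx : x ∈ toMeasurable μ S
        · rw [indicator_of_mem hx]
          exact_mod_cast hN x _ fun i hi => (Finset.mem_filter.1 hi).2
        · have : J.filter (fun i => x ∈ A i) = ∅ := by
            rw [Finset.filter_eq_empty_iff]
            exact fun i _ hi => hx (subset_toMeasurable μ S (hS i hi))
          simp [this]
    _ = N * μ S := by
        rw [lintegral_indicator_const (measurableSet_toMeasurable μ S), measure_toMeasurable]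
end

/-! ### Chaining the Poincaré inequality along curves of a uniform domain. -/

noncomputable section
open Filter Topology

/-- A discrete chaining argument: by connectedness, net points with adjacent balls link any two
points of `K`, and a chain need not be longer than the net. The length of a curve therefore plays no
role, only the cardinality of a net in it. -/
theorem IsPreconnected.abs_sub_le_of_finset_cover {X : Type*} [PseudoMetricSpace X] {K : Set X}
    (hK : IsPreconnected K) (E : Finset X) (hEK : (E : Set X) ⊆ K) {r : ℝ} (hr : 0 < r)
    (hcov : K ⊆ ⋃ e ∈ E, ball e r) (h : X → ℝ) {M : ℝ}
    (hh : ∀ y ∈ K, ∀ y' ∈ K, dist y y' < 2 * r → |h y - h y'| ≤ M) {z w : X} (hz : z ∈ K)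
    (hw : w ∈ K) : |h z - h w| ≤ (E.card + 2) * M := by
  classical
  have hM : 0 ≤ M := (abs_nonneg _).trans (hh z hz z hz (by rw [dist_self]; linarith))
  have hnear : ∀ y ∈ K, ∃ e ∈ E, |h e - h y| ≤ M ∧ y ∈ ball e r := fun y hy => by
    obtain ⟨e, he, hye⟩ := mem_iUnion₂.1 (hcov hy)
    refine ⟨e, he, hh e (hEK he) y hy ?_, hye⟩
    rw [mem_ball, dist_comm] at hye
    linarith
  -- `S n` contains the net points reachable in `n` steps; it gains a point at each stage until it
  -- is all of `E`.
  let S : ℕ → Finset X := fun n => E.filter fun e => |h e - h z| ≤ (n + 1) * M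
  have hSmono : ∀ n, S n ⊆ S (n + 1) := fun n e he => by
    simp only [S, Finset.mem_filter] at he ⊢
    refine ⟨he.1, he.2.trans ?_⟩
    push_cast
    nlinarith
  have hS : ∀ n, S n = E ∨ n + 1 ≤ (S n).card := by
    intro n
    induction n with
    | zero =>
      right
      obtain ⟨e, he, h1, -⟩ := hnear z hz
      rw [zero_add, Nat.one_le_iff_ne_zero, ← Nat.pos_iff_ne_zero, Finset.card_pos]
      exact ⟨e, by simpa [S] using ⟨he, h1⟩⟩
    | succ n ih =>
      by_cases hSE : S n = E
      · left
        exact Finset.Subset.antisymm (Finset.filter_subset _ _) (hSE ▸ hSmono n)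
      right
      have hcard := ih.resolve_left hSE
      obtain ⟨e₀, he₀⟩ : (S n).Nonempty := Finset.card_pos.1 (by omega)
      obtain ⟨e₁, he₁, he₁S⟩ : ∃ e ∈ E, e ∉ S n := by
        by_contra! hcon
        exact hSE (Finset.Subset.antisymm (Finset.filter_subset _ _) hcon)
      -- The balls centred in `S n` and those centred in `E \ S n` are open, cover `K` and both meet
      -- it, so they share a point of `K`. Two centres are then within `2 * r`.
      obtain ⟨y, hyK, hy1, hy2⟩ := hK (⋃ e ∈ S n, ball e r) (⋃ e ∈ E \ S n, ball e r)
        (isOpen_biUnion fun _ _ => isOpen_ball) (isOpen_biUnion fun _ _ => isOpen_ball)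
        (fun y hy => by
          obtain ⟨e, he, hye⟩ := mem_iUnion₂.1 (hcov hy)
          by_cases heS : e ∈ S n
          · exact Or.inl (mem_iUnion₂.2 ⟨e, heS, hye⟩)
          · exact Or.inr (mem_iUnion₂.2 ⟨e, Finset.mem_sdiff.2 ⟨he, heS⟩, hye⟩))
        ⟨e₀, hEK (Finset.mem_filter.1 he₀).1, mem_iUnion₂.2 ⟨e₀, he₀, mem_ball_self hr⟩⟩
        ⟨e₁, hEK he₁, mem_iUnion₂.2 ⟨e₁, Finset.mem_sdiff.2 ⟨he₁, he₁S⟩, mem_ball_self hr⟩⟩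
      obtain ⟨e, he, hye⟩ := mem_iUnion₂.1 hy1
      obtain ⟨e', he', hye'⟩ := mem_iUnion₂.1 hy2
      rw [Finset.mem_sdiff] at he'
      have hee' : |h e' - h e| ≤ M := by
        refine hh e' (hEK he'.1) e (hEK (Finset.mem_filter.1 he).1) ?_
        rw [mem_ball] at hye hye'
        linarith [dist_triangle_left e' e y]
      have he'S : e' ∈ S (n + 1) := by
        have h1 := (Finset.mem_filter.1 he).2
        refine Finset.mem_filter.2 ⟨he'.1, ?_⟩
        have h2 := abs_sub_le (h e') (h e) (h z)
        push_cast
        linarith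
      have := Finset.card_lt_card (Finset.ssubset_iff_of_subset (hSmono n) |>.2 ⟨e', he'S, he'.2⟩)
      omega
  -- The other alternative would give `S E.card` more elements than `E`.
  have hE : S E.card = E := (hS E.card).resolve_right fun hc => by
    have := Finset.card_le_card (Finset.filter_subset (fun e => |h e - h z| ≤ (E.card + 1) * M) E)
    change (S E.card).card ≤ _ at this
    omega
  obtain ⟨e, he, hew, -⟩ := hnear w hw
  have h1 := (Finset.mem_filter.1 (hE.symm ▸ he : e ∈ S E.card)).2
  have h2 := abs_sub_le (h z) (h e) (h w)
  rw [abs_sub_comm] at h1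
  linarith

theorem convexOn_abs_sub_rpow {p : ℝ} (hp : 1 ≤ p) (c : ℝ) :
    ConvexOn ℝ univ fun t : ℝ => |t - c| ^ p := by
  refine ⟨convex_univ, fun x _ y _ a b ha hb hab => ?_⟩
  have h1 := (convexOn_rpow hp).2 (abs_nonneg (x - c)) (abs_nonneg (y - c)) ha hb hab
  refine le_trans ?_ h1
  refine Real.rpow_le_rpow (abs_nonneg _) ?_ (by linarith)
  simp only [smul_eq_mul]
  calc |a * x + b * y - c| = |a * (x - c) + b * (y - c)| := by
        congr 1; linear_combination c * hab
    _ ≤ |a * (x - c)| + |b * (y - c)| := abs_add_le _ _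
    _ = _ := by rw [abs_mul, abs_mul, abs_of_nonneg ha, abs_of_nonneg hb]

theorem abs_add_rpow_le {p : ℝ} (hp : 1 ≤ p) (x y : ℝ) :
    |x + y| ^ p ≤ 2 ^ p * (|x| ^ p + |y| ^ p) := by
  have h1 : |x + y| ≤ 2 * max |x| |y| := by
    have := abs_add_le x y
    linarith [le_max_left |x| |y|, le_max_right |x| |y|]
  calc |x + y| ^ p ≤ (2 * max |x| |y|) ^ p := by gcongr
    _ = 2 ^ p * max |x| |y| ^ p := Real.mul_rpow (by norm_num) (by positivity)
    _ ≤ 2 ^ p * (|x| ^ p + |y| ^ p) := by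
        gcongr
        rcases max_choice |x| |y| with h | h <;> rw [h]
        · linarith [Real.rpow_nonneg (abs_nonneg y) p]
        · linarith [Real.rpow_nonneg (abs_nonneg x) p]

/-- A function `g ∈ L^p(U)` with a measure `μ` that dominates `|g|^p m` and
controls the oscillation of `g` on balls well inside `U`. -/
structure LocalPoincare {X : Type*} [MetricSpace X] [MeasurableSpace X] (p : ℝ) (m : Measure X)
    (U : Set X) (Ψ : ℝ → ℝ) (C A : ℝ) (g : X → ℝ) (μ : Measure X) : Prop where
  memLp : MemLp g (ENNReal.ofReal p) (m.restrict U)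
  integral_le : ∀ s, MeasurableSet s → s ⊆ U → ∫ x in s, |g x| ^ p ∂m ≤ μ.real s
  poincare : ∀ (y : X) (r : ℝ), 0 < r → closedBall y (A * r) ⊆ U →
    ∫ x in ball y r, |g x - ⨍ z in ball y r, g z ∂m| ^ p ∂m ≤ C * Ψ r * μ.real (ball y (A * r))

namespace LocalPoincare

variable {X : Type*} [MetricSpace X] [MeasurableSpace X] {p : ℝ} {m μ : Measure X}
  {U : Set X} {Ψ : ℝ → ℝ} {C A : ℝ} {g : X → ℝ}

theorem memLp_sub_const (h : LocalPoincare p m U Ψ C A g μ) {D : Set X}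
    (hDU : D ⊆ U) (hD : m D ≠ ∞) (c : ℝ) :
    MemLp (fun x => g x - c) (ENNReal.ofReal p) (m.restrict D) := by
  have : IsFiniteMeasure (m.restrict D) := ⟨by simpa using hD.lt_top⟩
  exact (h.memLp.mono_measure (Measure.restrict_mono hDU le_rfl)).sub (memLp_const c)

theorem integrableOn (hp : 1 < p) (h : LocalPoincare p m U Ψ C A g μ) {D : Set X}
    (hDU : D ⊆ U) (hD : m D ≠ ∞) : IntegrableOn g D m := by
  have : IsFiniteMeasure (m.restrict D) := ⟨by simpa using hD.lt_top⟩
  have h1 := h.memLp_sub_const hDU hD 0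
  simp only [sub_zero] at h1
  exact h1.integrable (by simpa using hp.le)

theorem integrableOn_rpow (hp : 1 < p) (h : LocalPoincare p m U Ψ C A g μ) {D : Set X}
    (hDU : D ⊆ U) (hD : m D ≠ ∞) (c : ℝ) : IntegrableOn (fun x => |g x - c| ^ p) D m := by
  have h1 := (h.memLp_sub_const hDU hD c).integrable_norm_rpow (by simpa using by linarith)
    ENNReal.ofReal_ne_top
  simp only [ENNReal.toReal_ofReal (zero_le_one.trans hp.le), Real.norm_eq_abs] at h1
  exact h1

/-- Jensen's inequality for `t ↦ |t - c| ^ p`. -/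
theorem rpow_average_sub_le (hp : 1 < p) (h : LocalPoincare p m U Ψ C A g μ) {Q : Set X}
    (hQU : Q ⊆ U) (hQ0 : m Q ≠ 0) (hQ : m Q ≠ ∞) (c : ℝ) :
    |(⨍ x in Q, g x ∂m) - c| ^ p * m.real Q ≤ ∫ x in Q, |g x - c| ^ p ∂m := by
  have hcont : Continuous fun t : ℝ => |t - c| ^ p :=
    (continuous_abs.comp (continuous_id.sub continuous_const)).rpow_const
      fun _ => Or.inr (by linarith)
  have h1 := (convexOn_abs_sub_rpow hp.le c).map_set_average_le (f := g) (μ := m) (t := Q)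
    hcont.continuousOn isClosed_univ hQ0 hQ (by simp) (h.integrableOn hp hQU hQ)
    (h.integrableOn_rpow hp hQU hQ c)
  have hQpos : 0 < m.real Q := ENNReal.toReal_pos hQ0 hQ
  rw [setAverage_eq m (fun x => |g x - c| ^ p), smul_eq_mul, inv_mul_eq_div, le_div_iff₀ hQpos] at h1
  exact h1

theorem rpow_average_le (hp : 1 < p) (h : LocalPoincare p m U Ψ C A g μ) {Q : Set X}
    (hQm : MeasurableSet Q) (hQU : Q ⊆ U) (hQ0 : m Q ≠ 0) (hQ : m Q ≠ ∞) :
    |⨍ x in Q, g x ∂m| ^ p * m.real Q ≤ μ.real Q := by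
  have := h.rpow_average_sub_le hp hQU hQ0 hQ 0
  simp only [sub_zero] at this
  exact this.trans (h.integral_le Q hQm hQU)

theorem rpow_average_sub_average_le (hp : 1 < p) (h : LocalPoincare p m U Ψ C A g μ)
    (hA : 1 ≤ A) {y : X} {r : ℝ} (hr : 0 < r) (hU : closedBall y (A * r) ⊆ U)
    (hD : m (ball y r) ≠ ∞) {Q : Set X} (hQD : Q ⊆ ball y r) (hQ0 : m Q ≠ 0) :
    |(⨍ x in Q, g x ∂m) - ⨍ x in ball y r, g x ∂m| ^ p * m.real Q
      ≤ C * Ψ r * μ.real (ball y (A * r)) := by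
  have hDU : ball y r ⊆ U := ball_subset_closedBall.trans
    ((closedBall_subset_closedBall (by nlinarith)).trans hU)
  have hQ : m Q ≠ ∞ := measure_ne_top_of_subset hQD hD
  refine (h.rpow_average_sub_le hp (hQD.trans hDU) hQ0 hQ _).trans
    (le_trans ?_ (h.poincare y r hr hU))
  exact setIntegral_mono_set (h.integrableOn_rpow hp hDU hD _)
    (Eventually.of_forall fun x => by positivity) hQD.eventuallyLE

/-- Chaining along curves of a uniform domain. -/
theorem exists_chain_bound [OpensMeasurableSpace X] [LocallyCompactSpace X] [m.IsOpenPosMeasure]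
    [IsFiniteMeasureOnCompacts m] [IsFiniteMeasure μ] (hp : 1 < p)
    (h : LocalPoincare p m U Ψ C A g μ) (hVD : VolumeDoubling m) (hΨ : IsScaleFunction Ψ)
    (hC : 0 ≤ C) (hA : 1 ≤ A) {a : ℝ} (ha : 1 ≤ a)
    (hU : ∀ x ∈ U, ∀ y ∈ U, ∃ γ : Path x y, range γ ⊆ U ∧ diam (range γ) ≤ a * dist x y ∧
      ∀ z ∈ range γ, a⁻¹ * min (dist x z) (dist y z) ≤ infDist z Uᶜ)
    {c κ L κ' : ℝ} (hc : 0 < c) (hc1 : c ≤ 1) (hκ : κ = c / (12 * a * A)) (_hL : 0 ≤ L)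
    (hκ' : 0 < κ') :
    ∃ K : ℝ, 0 ≤ K ∧ ∀ (z w : X) (r t₁ t₂ : ℝ), 0 < r → c * r ≤ infDist z Uᶜ →
      c * r ≤ infDist w Uᶜ → dist z w ≤ L * r → κ' * r ≤ t₁ → t₁ ≤ κ * r → κ' * r ≤ t₂ →
      t₂ ≤ κ * r →
      |(⨍ x in ball z t₁, g x ∂m) - ⨍ x in ball w t₂, g x ∂m| ^ p * m.real (ball z r) ≤
        K * (Ψ r * μ.real {y | c / (4 * a) * r ≤ infDist y Uᶜ ∧ dist y z ≤ (a * L + 1) * r}) := by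
  have ha0 : 0 < a := by linarith
  have hA0 : 0 < A := by linarith
  have hκ0 : 0 < κ := by rw [hκ]; positivity
  -- This is why `κ = c / (12aA)`: points of the curve have depth at least `c / (2a) * r`, and the
  -- dilated Poincaré balls around them, of radius `A * 3κ * r`, use up only half of it.
  have h3κ : A * (3 * κ) = c / (4 * a) := by rw [hκ]; field_simp; norm_num
  have hca4 : c / (4 * a) ≤ 1 := by rw [div_le_one (by positivity)]; linarith
  have h3κ1 : 3 * κ ≤ 1 := by nlinarith
  have hsub : ∀ y : X, 0 < infDist y Uᶜ → y ∈ U := fun y hy => by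
    by_contra hyU
    exact hy.ne' (infDist_zero_of_mem (by simpa using hyU))
  obtain ⟨C₁, hC₁⟩ := hVD.exists_measure_ball_le (m := m) (max (1 / κ') (a * L / κ'))
  obtain ⟨N, hN⟩ := hVD.exists_finset_cover (m := m) (a * L / κ)
  refine ⟨((N : ℝ) * 2 + 8) ^ p * (C * C₁), by positivity, ?_⟩
  intro z w r t₁ t₂ hr hz hw hzw ht₁ ht₁' ht₂ ht₂'
  set Y := {y | c / (4 * a) * r ≤ infDist y Uᶜ ∧ dist y z ≤ (a * L + 1) * r} with hY
  have hzU : z ∈ U := hsub z (lt_of_lt_of_le (by positivity) hz)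
  have hwU : w ∈ U := hsub w (lt_of_lt_of_le (by positivity) hw)
  obtain ⟨γ, hγU, hγd, hγ⟩ := hU z hzU w hwU
  have hzγ : z ∈ range γ := ⟨0, γ.source⟩
  have hwγ : w ∈ range γ := ⟨1, γ.target⟩
  have hγc : IsCompact (range γ) := isCompact_range γ.continuous
  have hγz : ∀ y ∈ range γ, dist y z ≤ a * L * r := fun y hy => by
    refine (dist_le_diam_of_mem hγc.isBounded hy hzγ).trans (hγd.trans ?_)
    rw [mul_assoc]; gcongr
  -- The uniform condition is empty near the endpoints of the curve; there the depth of `z` or `w`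
  -- is used instead.
  have hγD : ∀ y ∈ range γ, c / (2 * a) * r ≤ infDist y Uᶜ := fun y hy => by
    have hca : c / (2 * a) * r ≤ c * r / 2 := by
      rw [div_mul_eq_mul_div, div_le_div_iff₀ (by positivity) (by norm_num)]
      nlinarith [mul_pos hc hr]
    by_cases h1 : dist z y ≤ c * r / 2
    · have := infDist_le_infDist_add_dist (s := Uᶜ) (x := z) (y := y)
      linarith
    by_cases h2 : dist w y ≤ c * r / 2
    · have := infDist_le_infDist_add_dist (s := Uᶜ) (x := w) (y := y)
      linarith
    push Not at h1 h2
    refine le_trans ?_ (hγ y hy)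
    calc c / (2 * a) * r = a⁻¹ * (c * r / 2) := by field_simp
      _ ≤ _ := by gcongr; exact le_min h1.le h2.le
  have hΨ0 : 0 < Ψ r := hΨ.bijOn.mapsTo hr
  have hmz : 0 < m.real (ball z r) := ENNReal.toReal_pos (measure_ball_pos m z hr).ne'
    (hVD.measure_ball_lt_top z r).ne
  -- `T` is the bound for the `p`-th power of the change of averages in one comparison; `M` is its
  -- `p`-th root.
  set T := C * C₁ * (Ψ r * μ.real Y) / m.real (ball z r) with hT
  have hT0 : 0 ≤ T := by positivity
  set M := T ^ (1 / p) with hM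
  have hM0 : 0 ≤ M := by positivity
  have hMp : M ^ p = T := by
    rw [hM, ← Real.rpow_mul hT0, one_div, inv_mul_cancel₀ (by linarith), Real.rpow_one]
  have hosc : ∀ y ∈ range γ, ∀ y' ∈ range γ, ∀ t, κ' * r ≤ t → ball y' t ⊆ ball y (3 * κ * r) →
      |(⨍ x in ball y' t, g x ∂m) - ⨍ x in ball y (3 * κ * r), g x ∂m| ≤ M := by
    intro y hy y' hy' t ht hsub'
    have ht0 : 0 < t := lt_of_lt_of_le (by positivity) ht
    have hball : ∀ q, dist q y ≤ A * (3 * κ * r) → q ∈ Y := fun q hq => by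
      have h1 := hγD y hy
      have h2 := infDist_le_infDist_add_dist (s := Uᶜ) (x := y) (y := q)
      have h3 : A * (3 * κ * r) = c / (4 * a) * r := by rw [← h3κ]; ring
      rw [h3] at hq
      have h4 : c / (2 * a) * r = c / (4 * a) * r + c / (4 * a) * r := by field_simp; norm_num
      have h5 : c / (4 * a) * r ≤ 1 * r := by
        gcongr
      refine ⟨?_, ?_⟩
      · rw [dist_comm] at hq; linarith
      · linarith [dist_triangle q y z, hγz y hy]
    have hYU : Y ⊆ U := fun q hq => hsub q (lt_of_lt_of_le (by positivity) hq.1)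
    have h1 := h.rpow_average_sub_average_le hp hA (y := y) (r := 3 * κ * r) (by positivity)
      (fun q hq => hYU (hball q hq)) (hVD.measure_ball_lt_top _ _).ne hsub'
      (measure_ball_pos m y' ht0).ne'
    have h2 : m.real (ball z r) ≤ C₁ * m.real (ball y' t) := by
      have h3 : m (ball z r) ≤ C₁ * m (ball y' t) := by
        refine le_trans ?_ ((hC₁ z y' (κ' * r) (by positivity) ?_).trans ?_)
        · refine measure_mono (ball_subset_ball ?_)
          calc r = 1 / κ' * (κ' * r) := by field_simp
            _ ≤ _ := by gcongr; exact le_max_left _ _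
        · rw [dist_comm]
          calc dist y' z ≤ a * L * r := hγz y' hy'
            _ = a * L / κ' * (κ' * r) := by field_simp
            _ ≤ _ := by gcongr; exact le_max_right _ _
        · gcongr
      have h4 := ENNReal.toReal_mono (ENNReal.mul_ne_top ENNReal.coe_ne_top
        (hVD.measure_ball_lt_top y' t).ne) h3
      simpa [Measure.real, ENNReal.toReal_mul] using h4
    have h5 : Ψ (3 * κ * r) ≤ Ψ r := hΨ.strictMonoOn.monotoneOn
      (mem_Ioi.2 (by positivity)) (mem_Ioi.2 hr) (by nlinarith)
    have h6 : μ.real (ball y (A * (3 * κ * r))) ≤ μ.real Y :=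
      measureReal_mono fun q hq => hball q (le_of_lt hq)
    rw [← Real.rpow_le_rpow_iff (abs_nonneg _) hM0 (by linarith : 0 < p), hMp, hT,
      le_div_iff₀ hmz]
    calc _ ≤ |(⨍ x in ball y' t, g x ∂m) - ⨍ x in ball y (3 * κ * r), g x ∂m| ^ p *
          (C₁ * m.real (ball y' t)) := by gcongr
      _ = C₁ * (|(⨍ x in ball y' t, g x ∂m) - ⨍ x in ball y (3 * κ * r), g x ∂m| ^ p *
          m.real (ball y' t)) := by ring
      _ ≤ C₁ * (C * Ψ (3 * κ * r) * μ.real (ball y (A * (3 * κ * r)))) := by gcongr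
      _ ≤ C₁ * (C * Ψ r * μ.real Y) := by gcongr
      _ = _ := by ring
  have hκr : 0 < κ * r := by positivity
  have hMr : ∀ y ∈ range γ, ∀ y' ∈ range γ, ∀ t t', κ' * r ≤ t → t ≤ κ * r → κ' * r ≤ t' →
      t' ≤ κ * r → dist y y' < 2 * (κ * r) →
      |(⨍ x in ball y t, g x ∂m) - ⨍ x in ball y' t', g x ∂m| ≤ 2 * M := by
    -- Both balls lie in `B(y, 3κr)`, so each average is compared with the average over that ball.
    intro y hy y' hy' t t' h1 h2 h3 h4 h5
    have e1 := hosc y hy y hy t h1 (ball_subset_ball (by linarith))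
    have e2 := hosc y hy y' hy' t' h3 (ball_subset_ball' (by rw [dist_comm] at h5; linarith))
    rw [abs_sub_comm] at e2
    have := abs_sub_le (⨍ x in ball y t, g x ∂m) (⨍ x in ball y (3 * κ * r), g x ∂m)
      (⨍ x in ball y' t', g x ∂m)
    linarith
  -- The size of the net depends only on the ratio of the diameter bound for the curve to `κ * r`,
  -- hence not on the curve.
  obtain ⟨E, hEγ, hEN, hEcov⟩ := hN z (κ * r) (range γ) hκr fun y hy => by
    rw [mem_closedBall]
    calc dist y z ≤ a * L * r := hγz y hy
      _ = _ := by field_simp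
  have hκκ : κ' * r ≤ κ * r := ht₁.trans ht₁'
  have hz1 := hMr z hzγ z hzγ t₁ (κ * r) ht₁ ht₁' hκκ le_rfl (by rw [dist_self]; linarith)
  have hw1 := hMr w hwγ w hwγ (κ * r) t₂ hκκ le_rfl ht₂ ht₂' (by rw [dist_self]; linarith)
  have hzw1 := (isPreconnected_range γ.continuous).abs_sub_le_of_finset_cover E hEγ hκr hEcov
    (fun y => ⨍ x in ball y (κ * r), g x ∂m)
    (fun y hy y' hy' hd => hMr y hy y' hy' _ _ hκκ le_rfl hκκ le_rfl hd) hzγ hwγ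
  have hEN' : (E.card : ℝ) ≤ N := by exact_mod_cast hEN
  -- `(N + 2) * 2M` for the chain, and `2M` at each end for changing the radius from `t₁` or `t₂` to
  -- `κ * r`.
  have hfin : |(⨍ x in ball z t₁, g x ∂m) - ⨍ x in ball w t₂, g x ∂m| ≤ (N * 2 + 8) * M := by
    have e1 := abs_sub_le (⨍ x in ball z t₁, g x ∂m) (⨍ x in ball z (κ * r), g x ∂m)
      (⨍ x in ball w t₂, g x ∂m)
    have e2 := abs_sub_le (⨍ x in ball z (κ * r), g x ∂m) (⨍ x in ball w (κ * r), g x ∂m)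
      (⨍ x in ball w t₂, g x ∂m)
    have e3 : ((E.card : ℝ) + 2) * (2 * M) ≤ (N + 2) * (2 * M) := by gcongr
    linarith
  calc _ ≤ ((N * 2 + 8) * M) ^ p * m.real (ball z r) := by gcongr
    _ = (N * 2 + 8) ^ p * (C * C₁ * (Ψ r * μ.real Y) / m.real (ball z r)) * m.real (ball z r) := by
        rw [Real.mul_rpow (by positivity) hM0, hMp]
    _ = _ := by field_simp

end LocalPoincare

/-- Corkscrew condition: near a point at distance less than `L * r` from a uniform domain `U`
there is a point of `U` at distance at least `r / a` from the complement. -/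
theorem exists_corkscrew {X : Type*} [MetricSpace X] {U : Set X} {a : ℝ} (ha : 1 ≤ a)
    (hU : ∀ x ∈ U, ∀ y ∈ U, ∃ γ : Path x y, range γ ⊆ U ∧ diam (range γ) ≤ a * dist x y ∧
      ∀ z ∈ range γ, a⁻¹ * min (dist x z) (dist y z) ≤ infDist z Uᶜ)
    {q₁ q₂ : X} (hq₁ : q₁ ∈ U) (hq₂ : q₂ ∈ U) {L r : ℝ} (hr : 0 < r) (hrq : 4 * r ≤ dist q₁ q₂)
    {x : X} (hx : infDist x U < L * r) :
    ∃ z, dist z x ≤ (L + 1) * r ∧ a⁻¹ * r ≤ infDist z Uᶜ := by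
  obtain ⟨x', hx'U, hxx'⟩ := (infDist_lt_iff ⟨q₁, hq₁⟩).1 hx
  -- Since `q₁` and `q₂` are `4r` apart, one of them is at least `2r` from `x'`. The point of the
  -- curve at distance exactly `r` from `x'` is then at least `r` from both ends.
  obtain ⟨y, hyU, hy⟩ : ∃ y ∈ U, 2 * r ≤ dist x' y := by
    by_contra! hcon
    have := dist_triangle_left q₁ q₂ x'
    linarith [hcon q₁ hq₁, hcon q₂ hq₂]
  obtain ⟨γ, hγU, -, hγ⟩ := hU x' hx'U y hyU
  have hcont : Continuous fun t => dist x' (γ t) := continuous_const.dist γ.continuous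
  obtain ⟨t, ht⟩ := mem_range_of_exists_le_of_exists_ge hcont (c := r)
    ⟨0, by simpa using hr.le⟩ ⟨1, by simp only [γ.target]; linarith⟩
  refine ⟨γ t, ?_, ?_⟩
  · have := dist_triangle (γ t) x' x
    rw [dist_comm (γ t) x', dist_comm x' x] at this
    linarith [show dist x' (γ t) = r from ht]
  · refine le_trans ?_ (hγ (γ t) ⟨t, rfl⟩)
    have h1 : dist x' (γ t) = r := ht
    have h2 := dist_triangle x' (γ t) y
    rw [dist_comm (γ t) y] at h2
    gcongr
    exact le_min (by linarith) (by linarith)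
end

/-! ### Ball covers of slowly varying radius, and partitions of unity of controlled energy. -/

noncomputable section
open Filter Topology

theorem IsScaleFunction.pos {Ψ : ℝ → ℝ} (h : IsScaleFunction Ψ) {r : ℝ} (hr : 0 < r) : 0 < Ψ r :=
  h.bijOn.mapsTo hr

theorem IsScaleFunction.mono {Ψ : ℝ → ℝ} (h : IsScaleFunction Ψ) {r R : ℝ} (hr : 0 < r)
    (hrR : r ≤ R) : Ψ r ≤ Ψ R :=
  h.strictMonoOn.monotoneOn (mem_Ioi.2 hr) (mem_Ioi.2 (hr.trans_le hrR)) hrR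

theorem IsScaleFunction.exists_le {Ψ : ℝ → ℝ} (h : IsScaleFunction Ψ) (K : ℝ) :
    ∃ C : ℝ, 0 < C ∧ ∀ r R : ℝ, 0 < r → 0 < R → R ≤ K * r → Ψ R ≤ C * Ψ r := by
  obtain ⟨C, β₁, β₂, hC, -, -, hb⟩ := h.bounds
  have hK1 : 1 ≤ max K 1 := le_max_right _ _
  refine ⟨C * max K 1 ^ β₂, by positivity, fun r R hr hR hRK => ?_⟩
  have hrK : r ≤ max K 1 * r := by nlinarith
  have h1 := (hb r (max K 1 * r) hr hrK).2
  rw [mul_div_cancel_right₀ _ hr.ne', div_le_iff₀ (h.pos hr)] at h1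
  exact (h.mono hR (hRK.trans (by gcongr; exact le_max_left _ _))).trans h1

theorem IsScaleFunction.tendsto_zero {Ψ : ℝ → ℝ} (h : IsScaleFunction Ψ) :
    Tendsto Ψ (𝓝[>] 0) (𝓝 0) := by
  rw [Metric.tendsto_nhdsWithin_nhds]
  intro ε hε
  obtain ⟨r, hr, hrε⟩ := h.bijOn.surjOn (mem_Ioi.2 hε)
  refine ⟨r, hr, fun {s} hs hsr => ?_⟩
  rw [Real.dist_eq, sub_zero, abs_of_pos (by simpa using hs)] at hsr
  rw [Real.dist_eq, sub_zero, abs_of_pos (h.pos hs), ← hrε]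
  exact h.strictMonoOn hs hr hsr

/-- The balls `B(x i, A * ρ i)` and `B(x j, A * ρ j)` intersect. -/
def BallsMeet {X ι : Type*} [MetricSpace X] (x : ι → X) (ρ : ι → ℝ) (A : ℝ) (i j : ι) : Prop :=
  (ball (x i) (A * ρ i) ∩ ball (x j) (A * ρ j)).Nonempty

theorem BallsMeet.symm {X ι : Type*} [MetricSpace X] {x : ι → X} {ρ : ι → ℝ} {A : ℝ} {i j : ι}
    (h : BallsMeet x ρ A i j) : BallsMeet x ρ A j i := by
  rwa [BallsMeet, inter_comm]

/-- A covering by balls `B(x i, ρ i)` with disjoint cores, in which balls whose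
`A`-dilations meet have comparable radii. -/
structure BallCover {X ι : Type*} [MetricSpace X] (x : ι → X) (ρ : ι → ℝ) (A : ℝ) : Prop where
  one_lt : 1 < A
  pos : ∀ i, 0 < ρ i
  cover : ∀ y, ∃ i, y ∈ ball (x i) (ρ i)
  disjoint : Pairwise fun i j => Disjoint (ball (x i) (ρ i / 6)) (ball (x j) (ρ j / 6))
  comparable : ∀ i j, BallsMeet x ρ A i j → ρ i ≤ 2 * ρ j

namespace BallCover

variable {X ι : Type*} [MetricSpace X] {x : ι → X} {ρ : ι → ℝ} {A : ℝ}

theorem meet_self (h : BallCover x ρ A) (i : ι) : BallsMeet x ρ A i i :=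
  ⟨x i, by simpa using mul_pos (zero_lt_one.trans h.one_lt) (h.pos i)⟩

theorem ball_subset (h : BallCover x ρ A) (i : ι) : ball (x i) (ρ i) ⊆ ball (x i) (A * ρ i) :=
  ball_subset_ball (le_mul_of_one_le_left (h.pos i).le h.one_lt.le)

theorem dist_le (h : BallCover x ρ A) {i j : ι} (hij : BallsMeet x ρ A i j) :
    dist (x i) (x j) ≤ 3 * A * ρ j := by
  obtain ⟨z, hz1, hz2⟩ := hij
  rw [mem_ball] at hz1 hz2
  have h1 := dist_triangle_left (x i) (x j) z
  have h2 := mul_le_mul_of_nonneg_left (h.comparable i j ⟨z, hz1, hz2⟩)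
    (zero_le_one.trans h.one_lt.le)
  linarith

theorem pairwiseDisjoint (h : BallCover x ρ A) (J : Set ι) {r : ℝ} (hr : ∀ i ∈ J, r ≤ ρ i / 6) :
    J.PairwiseDisjoint fun i => ball (x i) r := fun i hi j hj hij =>
  (h.disjoint hij).mono (ball_subset_ball (hr i hi)) (ball_subset_ball (hr j hj))

/-- Balls of radius given by a slowly varying function have a subcover with disjoint cores. -/
theorem exists_of_slowlyVarying (hA : 1 < A) (f : X → ℝ) {s R : ℝ} (hs : 0 < s)
    (hf : ∀ y, s ≤ f y ∧ f y ≤ R) (hlip : ∀ y z, 8 * A * (f y - f z) ≤ dist y z) :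
    ∃ T : Set X, BallCover (fun i : T => (i : X)) (fun i => f i) A := by
  -- The enlargement factor 4 applied to radius `f / 6` gives `2f / 3 < f`, so the full balls cover.
  obtain ⟨T, -, hd, hcov⟩ := Vitali.exists_disjoint_subfamily_covering_enlargement_closedBall
    (univ : Set X) id (fun y => f y / 6) (R / 6) (fun y _ => by linarith [(hf y).2]) 4
    (by norm_num)
  refine ⟨T, hA, fun i => hs.trans_le (hf i).1, fun y => ?_, fun i j hij => ?_, fun i j hij => ?_⟩
  · obtain ⟨b, hb, hyb⟩ := hcov y (mem_univ y)
    refine ⟨⟨b, hb⟩, ?_⟩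
    have h1 := hyb (mem_closedBall_self (by linarith [(hf y).1]))
    simp only [id, mem_closedBall] at h1
    rw [mem_ball]
    linarith [(hf b).1]
  · exact (hd i.2 j.2 fun h => hij (Subtype.ext h)).mono ball_subset_closedBall
      ball_subset_closedBall
  · obtain ⟨z, hz1, hz2⟩ := hij
    rw [mem_ball] at hz1 hz2
    have h1 := dist_triangle_left (i : X) (j : X) z
    have h2 := hlip i j
    -- From `8A(f i - f j) ≤ dist < A(f i + f j)`, so the ratio of the radii is at most `9 / 7`.
    have h3 : A * (7 * f i - 9 * f j) ≤ 0 := by linarith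
    have h4 : 7 * f i - 9 * f j ≤ 0 := by
      by_contra hcon
      push Not at hcon
      exact absurd h3 (not_le.2 (mul_pos (zero_lt_one.trans hA) hcon))
    change f i ≤ 2 * f j
    linarith [(hf j).1]

end BallCover

/-- Neighbours of `j` have comparable radii, so their disjoint cores contain balls of radius `ρ j /
12`, with centres within `3A * ρ j`; packing bounds their number. -/
theorem VolumeDoubling.exists_card_meet_le {X : Type u} [MetricSpace X] [MeasurableSpace X]
    {m : Measure X} [OpensMeasurableSpace X] [m.IsOpenPosMeasure] [LocallyCompactSpace X]
    [IsFiniteMeasureOnCompacts m] (hVD : VolumeDoubling m) (A : ℝ) :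
    ∃ N : ℕ, ∀ (ι : Type u) (x : ι → X) (ρ : ι → ℝ), BallCover x ρ A →
      ∃ nb : ι → Finset ι, (∀ i j, i ∈ nb j ↔ BallsMeet x ρ A i j) ∧ ∀ j, (nb j).card ≤ N := by
  obtain ⟨N, hN⟩ := hVD.exists_card_le (36 * A)
  refine ⟨N, fun ι x ρ h => ?_⟩
  have hcard : ∀ (j : ι) (J : Finset ι), (J : Set ι) ⊆ {i | BallsMeet x ρ A i j} →
      J.card ≤ N := fun j J hJ => by
    refine hN ι (x j) (ρ j / 12) x J (by linarith [h.pos j]) (fun i hi => ?_) ?_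
    · have := h.dist_le (hJ hi)
      linarith
    · refine h.pairwiseDisjoint _ fun i hi => ?_
      have : ρ j ≤ 2 * ρ i := h.comparable j i (BallsMeet.symm (hJ hi))
      linarith
  have hfin := fun j => Set.finite_of_forall_card_le (hcard j)
  exact ⟨fun j => (hfin j).toFinset, fun i j => by simp, fun j => hcard j _ (by simp)⟩

/-- Successive increments of `H` along partial sums. With `H = unitClamp` these increments form the
partition of unity, so no division by a sum of bumps is needed. -/
theorem Finset.sum_telescope_filter {ι : Type*} [LinearOrder ι] (F : Finset ι) (t : ι → ℝ)
    (H : ℝ → ℝ) :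
    ∑ i ∈ F, (H (∑ k ∈ F with k ≤ i, t k) - H (∑ k ∈ F with k < i, t k)) =
      H (∑ k ∈ F, t k) - H 0 := by
  classical
  induction F using Finset.induction_on_max with
  | empty => simp
  | insert a s has ih =>
    have ha : a ∉ s := fun h => lt_irrefl _ (has a h)
    rw [Finset.sum_insert ha]
    have h1 : (insert a s).filter (fun k => k ≤ a) = insert a s :=
      Finset.filter_true_of_mem fun k hk => by
        rcases Finset.mem_insert.1 hk with rfl | hk
        · exact le_rfl
        · exact (has k hk).le
    have h2 : (insert a s).filter (fun k => k < a) = s := by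
      rw [Finset.filter_insert, if_neg (lt_irrefl a), Finset.filter_true_of_mem has]
    have h3 : ∀ i ∈ s, (H (∑ k ∈ insert a s with k ≤ i, t k) - H (∑ k ∈ insert a s with k < i, t k))
        = H (∑ k ∈ s with k ≤ i, t k) - H (∑ k ∈ s with k < i, t k) := fun i hi => by
      rw [Finset.filter_insert, if_neg (not_le.2 (has i hi)), Finset.filter_insert,
        if_neg (not_lt.2 (has i hi).le)]
    rw [Finset.sum_congr rfl h3, ih, h1, h2]
    ring

namespace PEnergyForm

variable {p : ℝ} [Fact (1 < p)] {X : Type u} [MetricSpace X] [MeasurableSpace X] {m : Measure X}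
  {𝓔 : PEnergyForm p m} {Γ : 𝓔.domain → Measure X} {Ψ : ℝ → ℝ}

theorem CapacityUpperBound.exists_bump [LocallyCompactSpace X] [Nontrivial X]
    [m.IsOpenPosMeasure] [IsFiniteMeasureOnCompacts m]
    (hcap : 𝓔.CapacityUpperBound Ψ)
    (h : 𝓔.IsRegularWithEnergyMeasures Γ) (hΨ : IsScaleFunction Ψ) (hVD : VolumeDoubling m) :
    ∃ C A r₀ : ℝ, 0 ≤ C ∧ 1 < A ∧ 0 < r₀ ∧ ∀ (x : X) (r : ℝ), 0 < r → r ≤ r₀ →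
      ∃ φ : 𝓔.domain, (∀ᵐ y ∂m, 0 ≤ 𝓔.toFun φ y ∧ (y ∈ ball x r → 𝓔.toFun φ y = 1) ∧
        (y ∉ ball x (A * r) → 𝓔.toFun φ y = 0)) ∧
        𝓔.rootEnergy φ ≤ (C * (m.real (ball x r) / Ψ r)) ^ (1 / p) := by
  have hp : 1 < p := Fact.out
  obtain ⟨C, A, A₂, hC, hA, hA₂, hu⟩ := hcap
  have hdiam : 0 < ediam (univ : Set X) := Metric.ediam_pos_iff.2 nontrivial_univ
  -- The diameter may be infinite; a finite `q` below it provides the threshold `r₀`.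
  obtain ⟨q, hq0, hq⟩ := exists_between hdiam
  have hqt : q ≠ ∞ := (hq.trans_le le_top).ne
  have hq0' : 0 < q.toReal := ENNReal.toReal_pos hq0.ne' hqt
  refine ⟨2 * C, A, q.toReal / A₂, by linarith, hA, by positivity, fun x r hr hr₀ => ?_⟩
  have hcapr := hu x r hr (lt_of_le_of_lt (by
    rw [ENNReal.ofReal_le_iff_le_toReal hqt, ← le_div_iff₀' (by linarith)]
    exact hr₀) hq)
  have hm0 : 0 < m.real (ball x r) := ENNReal.toReal_pos (measure_ball_pos m x hr).ne'
    (hVD.measure_ball_lt_top x r).ne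
  have hΨr := hΨ.pos hr
  -- The infimum need not be attained; doubling the positive bound leaves room for an actual
  -- competitor.
  have hlt : ⨅ u ∈ 𝓔.capFunctions (ball x r) (ball x (A * r))ᶜ, ENNReal.ofReal (𝓔.energy u) <
      ENNReal.ofReal (2 * C * (m.real (ball x r) / Ψ r)) := by
    refine lt_of_le_of_lt hcapr ?_
    have h1 : m (ball x r) = ENNReal.ofReal (m.real (ball x r)) :=
      (ENNReal.ofReal_toReal (hVD.measure_ball_lt_top x r).ne).symm
    rw [h1, ← ENNReal.ofReal_mul (by linarith), ← ENNReal.ofReal_div_of_pos hΨr]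
    have hpos : 0 < C * (m.real (ball x r) / Ψ r) := by positivity
    rw [ENNReal.ofReal_lt_ofReal_iff (by linarith)]
    rw [mul_div_assoc]
    linarith
  simp only [iInf_lt_iff] at hlt
  obtain ⟨u, ⟨hu1, hu0⟩, huE⟩ := hlt
  obtain ⟨φ, hφ, hφE⟩ := h.exists_comp u lipschitzWith_unitClamp unitClamp_zero
  refine ⟨φ, ?_, hφE.trans ?_⟩
  · filter_upwards [hu1, hu0, hφ] with y h1 h0 h2
    rw [h2]
    refine ⟨unitClamp_nonneg _, fun hy => ?_, fun hy => ?_⟩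
    · rw [h1 hy, unitClamp_of_one_le le_rfl]
    · rw [h0 hy, unitClamp_zero]
  · rw [rootEnergy_apply]
    refine Real.rpow_le_rpow (𝓔.isPEnergy.1 u) ?_ (by positivity)
    exact (ENNReal.ofReal_lt_ofReal_iff_of_nonneg (𝓔.isPEnergy.1 u)).1 huE |>.le

/-- `ψ` is a partition of unity in the domain, subordinate to the balls `B(x i, A * ρ i)`, with
energies controlled by `D`. -/
structure SubordinatePartition (𝓔 : PEnergyForm p m) {ι : Type*} (Ψ : ℝ → ℝ) (x : ι → X)
    (ρ : ι → ℝ) (A D : ℝ) (ψ : ι → 𝓔.domain) : Prop where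
  rootEnergy_le : ∀ i, 𝓔.rootEnergy (ψ i) ≤
    D * (m.real (ball (x i) (ρ i)) / Ψ (ρ i)) ^ (1 / p)
  ae : ∀ᵐ y ∂m, (∀ i, 0 ≤ 𝓔.toFun (ψ i) y ∧ 𝓔.toFun (ψ i) y ≤ 1 ∧
      (y ∉ ball (x i) (A * ρ i) → 𝓔.toFun (ψ i) y = 0)) ∧
    ∀ j, y ∈ ball (x j) (ρ j) → ∀ F : Finset ι, (∀ i, BallsMeet x ρ A i j → i ∈ F) →
      ∑ i ∈ F, 𝓔.toFun (ψ i) y = 1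

/-- Partitions of unity with controlled energy, subordinate to covers by balls. -/
theorem CapacityUpperBound.exists_partition [OpensMeasurableSpace X] [LocallyCompactSpace X]
    [Nontrivial X] [m.IsOpenPosMeasure] [IsFiniteMeasureOnCompacts m]
    (hcap : 𝓔.CapacityUpperBound Ψ)
    (h : 𝓔.IsRegularWithEnergyMeasures Γ) (hΨ : IsScaleFunction Ψ) (hVD : VolumeDoubling m) :
    ∃ A r₀ D : ℝ, 1 < A ∧ 0 < r₀ ∧ 0 ≤ D ∧ ∀ (ι : Type u) [Countable ι] (x : ι → X)
      (ρ : ι → ℝ), BallCover x ρ A → (∀ i, ρ i ≤ r₀) → ∃ ψ : ι → 𝓔.domain,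
        𝓔.SubordinatePartition Ψ x ρ A D ψ := by
  have hp : 1 < p := Fact.out
  obtain ⟨C, A, r₀, hC, hA, hr₀, hbump⟩ := hcap.exists_bump h hΨ hVD
  obtain ⟨N, hN⟩ := hVD.exists_card_meet_le A
  obtain ⟨C₁, hC₁⟩ := hVD.exists_measure_ball_le (m := m) (3 * A)
  obtain ⟨C₂, hC₂, hΨ₂⟩ := hΨ.exists_le 2
  refine ⟨A, r₀, 2 * (N * (C * (C₁ * C₂)) ^ (1 / p)), hA, hr₀, by positivity, ?_⟩
  intro ι _ x ρ hcov hρ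
  obtain ⟨nb, hnb, hnbN⟩ := hN ι x ρ hcov
  choose φ hφ hφE using fun i => hbump (x i) (ρ i) (hcov.pos i) (hρ i)
  classical
  -- Any linear order serves; it only fixes the order in which the bumps are added.
  let _ : LinearOrder ι := linearOrderOfSTO WellOrderingRel
  have hcl := fun s : Finset ι => h.exists_comp (∑ j ∈ s, (1 : ℝ) • φ j) lipschitzWith_unitClamp
    unitClamp_zero
  choose V hV hVE using hcl
  have hEj : ∀ i, ∀ j ∈ nb i, 𝓔.rootEnergy (φ j) ≤
      (C * (C₁ * C₂)) ^ (1 / p) * (m.real (ball (x i) (ρ i)) / Ψ (ρ i)) ^ (1 / p) := by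
    intro i j hj
    have hij := (hnb j i).1 hj
    have hpi := hcov.pos i
    have hpj := hcov.pos j
    refine (hφE j).trans ?_
    have hΨi := hΨ.pos hpi
    have hΨj := hΨ.pos hpj
    rw [← Real.mul_rpow (by positivity) (by positivity)]
    refine Real.rpow_le_rpow (by positivity) ?_ (by positivity)
    have h1 : m.real (ball (x j) (ρ j)) ≤ C₁ * m.real (ball (x i) (ρ i)) := by
      have h2 : m (ball (x j) (ρ j)) ≤ C₁ * m (ball (x i) (ρ i)) := by
        refine (measure_mono (ball_subset_ball ?_)).trans
          (hC₁ (x j) (x i) (ρ i) hpi (hcov.dist_le hij))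
        nlinarith [hcov.comparable j i hij]
      have h4 := ENNReal.toReal_mono (ENNReal.mul_ne_top ENNReal.coe_ne_top
        (hVD.measure_ball_lt_top (x i) (ρ i)).ne) h2
      simpa [Measure.real, ENNReal.toReal_mul] using h4
    have h2 : Ψ (ρ i) ≤ C₂ * Ψ (ρ j) := hΨ₂ _ _ hpj hpi (hcov.comparable i j hij.symm)
    rw [mul_assoc]
    gcongr
    rw [div_le_iff₀ hΨj]
    calc m.real (ball (x j) (ρ j)) ≤ C₁ * m.real (ball (x i) (ρ i)) := h1
      _ = C₁ * m.real (ball (x i) (ρ i)) / Ψ (ρ i) * Ψ (ρ i) := by field_simp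
      _ ≤ C₁ * m.real (ball (x i) (ρ i)) / Ψ (ρ i) * (C₂ * Ψ (ρ j)) := by gcongr
      _ = _ := by ring
  have hVE' : ∀ i (s : Finset ι), s ⊆ nb i → 𝓔.rootEnergy (V s) ≤
      N * (C * (C₁ * C₂)) ^ (1 / p) * (m.real (ball (x i) (ρ i)) / Ψ (ρ i)) ^ (1 / p) := by
    intro i s hs
    have hΨi := hΨ.pos (hcov.pos i)
    calc 𝓔.rootEnergy (V s) ≤ 𝓔.rootEnergy (∑ j ∈ s, (1 : ℝ) • φ j) := hVE s
      _ ≤ ∑ j ∈ s, 𝓔.rootEnergy ((1 : ℝ) • φ j) :=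
        Finset.le_sum_of_subadditive _ (map_zero _).le (map_add_le_add _) _ _
      _ ≤ ∑ j ∈ s, (C * (C₁ * C₂)) ^ (1 / p) *
          (m.real (ball (x i) (ρ i)) / Ψ (ρ i)) ^ (1 / p) :=
        Finset.sum_le_sum fun j hj => by rw [one_smul]; exact hEj i j (hs hj)
      _ = s.card * ((C * (C₁ * C₂)) ^ (1 / p) *
          (m.real (ball (x i) (ρ i)) / Ψ (ρ i)) ^ (1 / p)) := by simp
      _ ≤ N * ((C * (C₁ * C₂)) ^ (1 / p) *
          (m.real (ball (x i) (ρ i)) / Ψ (ρ i)) ^ (1 / p)) := by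
        gcongr
        exact (Finset.card_le_card hs).trans (hnbN i)
      _ = _ := by ring
  -- `ψ i` is the increment of the clamped partial sum when the bump `φ i` is added. Restricting to
  -- the neighbours of `i` keeps the energy under control and changes nothing where `φ i` is
  -- nonzero.
  refine ⟨fun i => V {j ∈ nb i | j ≤ i} - V {j ∈ nb i | j < i}, fun i => ?_, ?_⟩
  · have h1 := hVE' i _ (Finset.filter_subset (fun j => j ≤ i) _)
    have h2 := hVE' i _ (Finset.filter_subset (fun j => j < i) _)
    have h3 := map_sub_le_add 𝓔.rootEnergy (V {j ∈ nb i | j ≤ i}) (V {j ∈ nb i | j < i})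
    linarith
  have hVs : ∀ᵐ y ∂m, ∀ s : Finset ι, 𝓔.toFun (V s) y = unitClamp (∑ j ∈ s, 𝓔.toFun (φ j) y) := by
    rw [ae_all_iff]
    intro s
    filter_upwards [hV s, 𝓔.toFun_sum s (fun _ => 1) φ] with y h1 h2
    rw [h1, h2]
    simp
  have hsub : ∀ᵐ y ∂m, ∀ i, 𝓔.toFun (V {j ∈ nb i | j ≤ i} - V {j ∈ nb i | j < i}) y =
      𝓔.toFun (V {j ∈ nb i | j ≤ i}) y - 𝓔.toFun (V {j ∈ nb i | j < i}) y := by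
    rw [ae_all_iff]
    exact fun i => 𝓔.toFun_sub _ _
  filter_upwards [hVs, hsub, ae_all_iff.2 hφ] with y h1 h2 h3
  set t : ι → ℝ := fun j => 𝓔.toFun (φ j) y with ht
  have hψ : ∀ i, 𝓔.toFun (V {j ∈ nb i | j ≤ i} - V {j ∈ nb i | j < i}) y =
      unitClamp (∑ j ∈ nb i with j ≤ i, t j) - unitClamp (∑ j ∈ nb i with j < i, t j) := fun i => by
    rw [h2, h1, h1]
  have hlele : ∀ (F : Finset ι) i, ∑ j ∈ F with j < i, t j ≤ ∑ j ∈ F with j ≤ i, t j := fun F i =>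
    Finset.sum_le_sum_of_subset_of_nonneg
      (Finset.monotone_filter_right _ fun j _ hj => le_of_lt hj) fun j _ _ => (h3 j).1
  have hzero : ∀ (F : Finset ι) i, t i = 0 → ∑ j ∈ F with j < i, t j = ∑ j ∈ F with j ≤ i, t j := by
    intro F i hi
    refine Finset.sum_subset (Finset.monotone_filter_right _ fun j _ hj => le_of_lt hj) ?_
    intro j hj hj'
    simp only [Finset.mem_filter, not_and, not_lt] at hj hj'
    rw [le_antisymm hj.2 (hj' hj.1), hi]
  have hψ0 : ∀ i, t i = 0 →
      𝓔.toFun (V {j ∈ nb i | j ≤ i} - V {j ∈ nb i | j < i}) y = 0 := fun i hi => by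
    rw [hψ, hzero _ _ hi, sub_self]
  refine ⟨fun i => ⟨?_, ?_, fun hy => hψ0 i ((h3 i).2.2 hy)⟩, fun j hj F hF => ?_⟩
  · rw [hψ]; linarith [unitClamp_mono (hlele (nb i) i)]
  · rw [hψ]
    linarith [unitClamp_nonneg (∑ j ∈ nb i with j < i, t j),
      unitClamp_le_one (∑ j ∈ nb i with j ≤ i, t j)]
  · have hne : ∀ k, t k ≠ 0 → y ∈ ball (x k) (A * ρ k) := fun k hk => by
      by_contra hcon
      exact hk ((h3 k).2.2 hcon)
    have hkF : ∀ k, t k ≠ 0 → k ∈ F := fun k hk =>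
      hF k ⟨y, hne k hk, hcov.ball_subset j hj⟩
    -- If `t i ≠ 0` at `y`, every bump that is nonzero at `y` belongs to a neighbour of `i` and also
    -- to `F`, so either index set gives the same partial sums and the increments telescope over
    -- `F`.
    have hsame : ∀ (i : ι) (P : ι → Prop) [DecidablePred P], t i ≠ 0 →
        ∑ k ∈ nb i with P k, t k = ∑ k ∈ F with P k, t k := by
      intro i P _ hi
      rw [Finset.sum_filter, Finset.sum_filter]
      have e1 : ∀ G : Finset ι, (∀ k, t k ≠ 0 → k ∈ G) →
          ∑ k ∈ G, (if P k then t k else 0) = ∑ k ∈ G ∪ F, (if P k then t k else 0) := by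
        intro G hG
        refine Finset.sum_subset Finset.subset_union_left fun k _ hk => ?_
        by_cases htk : t k = 0
        · simp [htk]
        · exact absurd (hG k htk) hk
      have e2 : ∑ k ∈ F, (if P k then t k else 0) = ∑ k ∈ nb i ∪ F, (if P k then t k else 0) := by
        refine Finset.sum_subset Finset.subset_union_right fun k _ hk => ?_
        by_cases htk : t k = 0
        · simp [htk]
        · exact absurd (hkF k htk) hk
      rw [e2]
      exact e1 (nb i) fun k hk => (hnb k i).2 ⟨y, hne k hk, hne i hi⟩
    have hterm : ∀ i ∈ F, 𝓔.toFun (V {j ∈ nb i | j ≤ i} - V {j ∈ nb i | j < i}) y =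
        unitClamp (∑ k ∈ F with k ≤ i, t k) - unitClamp (∑ k ∈ F with k < i, t k) := by
      intro i _
      by_cases hi : t i = 0
      · rw [hψ0 i hi, hzero _ _ hi, sub_self]
      · rw [hψ, hsame i _ hi, hsame i _ hi]
    rw [Finset.sum_congr rfl hterm, Finset.sum_telescope_filter, unitClamp_zero, sub_zero]
    refine unitClamp_of_one_le ?_
    rw [← (h3 j).2.1 hj]
    exact Finset.single_le_sum (f := t) (fun k _ => (h3 k).1) (hF j (hcov.meet_self j))

end PEnergyForm
end

/-! ### Pointwise and energy estimates for sums over the partition. -/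

noncomputable section
open Filter Topology

namespace PEnergyForm

namespace SubordinatePartition

variable {p : ℝ} [Fact (1 < p)] {X : Type u} [MetricSpace X] [MeasurableSpace X] {m : Measure X}
  {𝓔 : PEnergyForm p m} {Γ : 𝓔.domain → Measure X} {Ψ : ℝ → ℝ} {ι : Type u} {x : ι → X} {ρ : ι → ℝ}
  {A D : ℝ} {ψ : ι → 𝓔.domain}

/-- Lets a global finite sum be replaced on each ball by a sum over neighbours: the dropped terms
vanish because of `b` or because of the support of `ψ i`. -/
theorem ae_sum_eq (hψ : 𝓔.SubordinatePartition Ψ x ρ A D ψ) (hcov : BallCover x ρ A) (b : ι → ℝ)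
    (S : Finset ι) (hb : ∀ i ∉ S, b i = 0) :
    ∀ᵐ y ∂m, ∀ j, y ∈ ball (x j) (ρ j) → ∀ F : Finset ι, (∀ i, BallsMeet x ρ A i j → i ∈ F) →
      𝓔.toFun (∑ i ∈ S, b i • ψ i) y = ∑ i ∈ F, b i * 𝓔.toFun (ψ i) y := by
  classical
  filter_upwards [hψ.ae, 𝓔.toFun_sum S b ψ] with y h1 h2 j hj F hF
  rw [h2]
  have e1 : ∑ i ∈ S, b i * 𝓔.toFun (ψ i) y = ∑ i ∈ S ∪ F, b i * 𝓔.toFun (ψ i) y :=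
    Finset.sum_subset Finset.subset_union_left fun i _ hi => by rw [hb i hi, zero_mul]
  have e2 : ∑ i ∈ F, b i * 𝓔.toFun (ψ i) y = ∑ i ∈ S ∪ F, b i * 𝓔.toFun (ψ i) y := by
    refine Finset.sum_subset Finset.subset_union_right fun i _ hi => ?_
    rw [(h1.1 i).2.2 fun hy => hi (hF i ⟨y, hy, hcov.ball_subset j hj⟩), mul_zero]
  rw [e1, e2]

/-- At `y` the sum is a convex combination of the coefficients, so Jensen applies. It is used with
`c = 0` for the `L^p` norm and with `c = g y` for the approximation error. -/
theorem ae_rpow_sub_le (hψ : 𝓔.SubordinatePartition Ψ x ρ A D ψ) (hcov : BallCover x ρ A)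
    (b : ι → ℝ) (S : Finset ι) (hb : ∀ i ∉ S, b i = 0) :
    ∀ᵐ y ∂m, ∀ j, y ∈ ball (x j) (ρ j) → ∀ F : Finset ι, (∀ i, BallsMeet x ρ A i j → i ∈ F) →
      ∀ c : ℝ, |𝓔.toFun (∑ i ∈ S, b i • ψ i) y - c| ^ p ≤ ∑ i ∈ F, |b i - c| ^ p := by
  have hp : 1 < p := Fact.out
  filter_upwards [hψ.ae, hψ.ae_sum_eq hcov b S hb] with y h1 h2 j hj F hF c
  have hone := h1.2 j hj F hF
  have e1 : 𝓔.toFun (∑ i ∈ S, b i • ψ i) y - c = ∑ i ∈ F, 𝓔.toFun (ψ i) y * (b i - c) := by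
    rw [h2 j hj F hF]
    simp_rw [mul_sub]
    rw [Finset.sum_sub_distrib, ← Finset.sum_mul, hone, one_mul]
    simp_rw [mul_comm]
  calc |𝓔.toFun (∑ i ∈ S, b i • ψ i) y - c| ^ p
      ≤ (∑ i ∈ F, 𝓔.toFun (ψ i) y * |b i - c|) ^ p := by
        refine Real.rpow_le_rpow (abs_nonneg _) ?_ (by linarith)
        rw [e1]
        refine (Finset.abs_sum_le_sum_abs _ _).trans (Finset.sum_le_sum fun i _ => ?_)
        rw [abs_mul, abs_of_nonneg (h1.1 i).1]
    _ ≤ ∑ i ∈ F, 𝓔.toFun (ψ i) y * |b i - c| ^ p :=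
        Real.rpow_arith_mean_le_arith_mean_rpow F _ _ (fun i _ => (h1.1 i).1) hone
          (fun i _ => abs_nonneg _) hp.le
    _ ≤ ∑ i ∈ F, |b i - c| ^ p := Finset.sum_le_sum fun i _ =>
        mul_le_of_le_one_left (by positivity) (h1.1 i).2.1

theorem ae_abs_sum_le (hψ : 𝓔.SubordinatePartition Ψ x ρ A D ψ) (b : ι → ℝ) (S : Finset ι) :
    ∀ᵐ y ∂m, |𝓔.toFun (∑ i ∈ S, b i • ψ i) y| ≤ ∑ i ∈ S, |b i| := by
  filter_upwards [hψ.ae, 𝓔.toFun_sum S b ψ] with y h1 h2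
  rw [h2]
  refine (Finset.abs_sum_le_sum_abs _ _).trans (Finset.sum_le_sum fun i _ => ?_)
  rw [abs_mul, abs_of_nonneg (h1.1 i).1]
  exact mul_le_of_le_one_right (abs_nonneg _) (h1.1 i).2.1

/-- On the ball, `G` equals `b j` plus the sum `H` of `(b i - b j) • ψ i` over neighbours, because
the `ψ i` add up to one there. Locality removes the constant, and the triangle inequality for at
most `N` terms bounds what remains. -/
theorem measureReal_ball_le [LocallyCompactSpace X] [BorelSpace X] [SecondCountableTopology X]
    (h : 𝓔.IsRegularWithEnergyMeasures Γ) (hΨ : IsScaleFunction Ψ)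
    (hψ : 𝓔.SubordinatePartition Ψ x ρ A D ψ) (hcov : BallCover x ρ A) (hD : 0 ≤ D)
    (b : ι → ℝ) (S : Finset ι) (hb : ∀ i ∉ S, b i = 0) {j : ι} {F : Finset ι}
    (hF : ∀ i, i ∈ F ↔ BallsMeet x ρ A i j) {N : ℕ} (hN : F.card ≤ N) {τ : ℝ}
    (hτ : ∀ i, BallsMeet x ρ A i j →
      |b i - b j| ^ p * (m.real (ball (x i) (ρ i)) / Ψ (ρ i)) ≤ τ) :
    (Γ (∑ i ∈ S, b i • ψ i)).real (ball (x j) (ρ j)) ≤ (N * D) ^ p * τ := by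
  have hp : 1 < p := Fact.out
  set G := ∑ i ∈ S, b i • ψ i with hG
  set H := ∑ i ∈ F, (b i - b j) • ψ i with hH
  have hB : MeasurableSet (ball (x j) (ρ j)) := measurableSet_ball
  have hw : ∀ i, 0 ≤ m.real (ball (x i) (ρ i)) / Ψ (ρ i) := fun i =>
    div_nonneg measureReal_nonneg (hΨ.pos (hcov.pos i)).le
  have hτ0 : 0 ≤ τ := (mul_nonneg (by positivity) (hw j)).trans (hτ j (hcov.meet_self j))
  have hGH : Γ (G - H) (ball (x j) (ρ j)) = 0 := by
    refine h.measure_eq_zero_of_ae_eq_const (G - H)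
      (M := ∑ i ∈ S, |b i| + ∑ i ∈ F, |b i - b j|) ?_ isOpen_ball (b j) ?_
    · filter_upwards [hψ.ae_abs_sum_le b S, hψ.ae_abs_sum_le (fun i => b i - b j) F,
        𝓔.toFun_sub G H] with y h1 h2 h3
      rw [h3]
      exact (abs_sub _ _).trans (add_le_add h1 h2)
    · filter_upwards [hψ.ae, hψ.ae_sum_eq hcov b S hb, 𝓔.toFun_sum F (fun i => b i - b j) ψ,
        𝓔.toFun_sub G H] with y h1 h2 h3 h4 hy
      have hF' : ∀ i, BallsMeet x ρ A i j → i ∈ F := fun i => (hF i).2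
      rw [h4, hG, h2 j hy F hF', hH, h3, ← Finset.sum_sub_distrib]
      calc _ = ∑ i ∈ F, b j * 𝓔.toFun (ψ i) y := Finset.sum_congr rfl fun i _ => by ring
        _ = b j := by rw [← Finset.mul_sum, h1.2 j hy F hF', mul_one]
  have h1 : h.seminormOn hB G ≤ N * D * τ ^ (1 / p) := by
    have e1 := map_add_le_add (h.seminormOn hB) (G - H) H
    rw [sub_add_cancel, (h.measure_eq_zero_iff hB _).1 hGH, zero_add] at e1
    refine e1.trans ?_
    calc h.seminormOn hB H ≤ ∑ i ∈ F, h.seminormOn hB ((b i - b j) • ψ i) :=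
          Finset.le_sum_of_subadditive _ (map_zero _).le (map_add_le_add _) _ _
      _ ≤ ∑ i ∈ F, D * τ ^ (1 / p) := by
          refine Finset.sum_le_sum fun i hi => ?_
          rw [map_smul_eq_mul, Real.norm_eq_abs]
          have e2 := (h.seminormOn_le_rootEnergy hB (ψ i)).trans (hψ.rootEnergy_le i)
          calc |b i - b j| * h.seminormOn hB (ψ i)
              ≤ |b i - b j| * (D * (m.real (ball (x i) (ρ i)) / Ψ (ρ i)) ^ (1 / p)) := by gcongr
            _ = D * (|b i - b j| ^ p * (m.real (ball (x i) (ρ i)) / Ψ (ρ i))) ^ (1 / p) := by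
                rw [Real.mul_rpow (by positivity) (hw i), ← Real.rpow_mul (abs_nonneg _),
                  mul_one_div_cancel (by positivity), Real.rpow_one]
                ring
            _ ≤ D * τ ^ (1 / p) := by
                have := hw i
                gcongr
                exact hτ i ((hF i).1 hi)
      _ = F.card * (D * τ ^ (1 / p)) := by simp
      _ ≤ N * (D * τ ^ (1 / p)) := by gcongr
      _ = _ := by ring
  rw [h.measureReal_eq hB]
  calc h.seminormOn hB G ^ p ≤ (N * D * τ ^ (1 / p)) ^ p :=
        Real.rpow_le_rpow (apply_nonneg _ _) h1 (by linarith)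
    _ = (N * D) ^ p * τ := by
        rw [Real.mul_rpow (by positivity) (by positivity), ← Real.rpow_mul hτ0,
          one_div_mul_cancel (by positivity), Real.rpow_one]

end SubordinatePartition

end PEnergyForm
end

/-! ### Coefficients: averages over reflected balls inside the domain. -/

noncomputable section
open Filter Topology

theorem VolumeDoubling.exists_measureReal_ball_le {X : Type*} [MetricSpace X] [MeasurableSpace X]
    {m : Measure X} [LocallyCompactSpace X] [IsFiniteMeasureOnCompacts m]
    (h : VolumeDoubling m) (K : ℝ) :
    ∃ C : ℝ, 0 ≤ C ∧ ∀ (x y : X) (r t : ℝ), 0 < r → t ≤ K * r → dist x y ≤ K * r →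
      m.real (ball x t) ≤ C * m.real (ball y r) := by
  obtain ⟨C, hC⟩ := h.exists_measure_ball_le K
  refine ⟨C, C.2, fun x y r t hr ht hxy => ?_⟩
  have h1 : m (ball x t) ≤ C * m (ball y r) :=
    (measure_mono (ball_subset_ball ht)).trans (hC x y r hr hxy)
  have h2 := ENNReal.toReal_mono (ENNReal.mul_ne_top ENNReal.coe_ne_top
    (h.measure_ball_lt_top y r).ne) h1
  simpa [Measure.real, ENNReal.toReal_mul] using h2

/-- The part of `B(x, K * r)` at distance at least `c * r` from the complement of `U`. -/
def innerRegion {X : Type*} [MetricSpace X] (U : Set X) (c K : ℝ) (x : X) (r : ℝ) : Set X :=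
  {y | c * r ≤ infDist y Uᶜ ∧ dist y x ≤ K * r}

theorem innerRegion_subset {X : Type*} [MetricSpace X] {U : Set X} {c K : ℝ} {x : X} {r : ℝ}
    (hc : 0 < c) (hr : 0 < r) : innerRegion U c K x r ⊆ U := fun y hy => by
  by_contra hyU
  have h1 : infDist y Uᶜ = 0 := infDist_zero_of_mem (by simpa using hyU)
  have h2 := hy.1
  rw [h1] at h2
  exact absurd h2 (not_le.2 (mul_pos hc hr))

theorem measurableSet_innerRegion {X : Type*} [MetricSpace X] [MeasurableSpace X]
    [OpensMeasurableSpace X] (U : Set X) (c K : ℝ) (x : X) (r : ℝ) :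
    MeasurableSet (innerRegion U c K x r) :=
  (isClosed_le continuous_const (continuous_infDist_pt _)).measurableSet.inter
    (isClosed_le (continuous_id.dist continuous_const) continuous_const).measurableSet

namespace LocalPoincare

variable {X : Type u} [MetricSpace X] [MeasurableSpace X] {p : ℝ} {m μ : Measure X}
  {U : Set X} {Ψ : ℝ → ℝ} {C A : ℝ} {g : X → ℝ}

set_option maxHeartbeats 800000 in
/-- Coefficients of the extension: averages of `g` over reflected balls. -/
theorem exists_averages [OpensMeasurableSpace X] [LocallyCompactSpace X] [m.IsOpenPosMeasure]
    [IsFiniteMeasureOnCompacts m] [IsFiniteMeasure μ] (hp : 1 < p)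
    (h : LocalPoincare p m U Ψ C A g μ) (hVD : VolumeDoubling m) (hΨ : IsScaleFunction Ψ)
    (hC : 0 ≤ C) (hA : 1 ≤ A) {a : ℝ} (ha : 1 ≤ a)
    (hU : ∀ x ∈ U, ∀ y ∈ U, ∃ γ : Path x y, range γ ⊆ U ∧ diam (range γ) ≤ a * dist x y ∧
      ∀ z ∈ range γ, a⁻¹ * min (dist x z) (dist y z) ≤ infDist z Uᶜ)
    {q₁ q₂ : X} (hq₁ : q₁ ∈ U) (hq₂ : q₂ ∈ U) {r₀ : ℝ} (hr₀ : 4 * r₀ ≤ dist q₁ q₂)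
    {A₁ : ℝ} (hA₁ : 1 < A₁) :
    ∃ c K T : ℝ, 0 < c ∧ 1 ≤ K ∧ 0 ≤ T ∧ ∀ (ι : Type u) (x : ι → X) (ρ : ι → ℝ),
      BallCover x ρ A₁ → (∀ i, ρ i < r₀ → infDist (x i) U ≤ 8 * A₁ * ρ i) →
      ∃ α : ι → ℝ, (∀ i, r₀ ≤ ρ i → α i = 0) ∧
        (∀ i j, BallsMeet x ρ A₁ i j →
          |α i| ^ p * m.real (ball (x j) (ρ j)) ≤ T * μ.real (innerRegion U c K (x j) (ρ j))) ∧
        (∀ i j, BallsMeet x ρ A₁ i j → ρ i < r₀ → ρ j < r₀ →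
          |α i - α j| ^ p * m.real (ball (x i) (ρ i)) ≤
            T * Ψ (ρ i) * μ.real (innerRegion U c K (x j) (ρ j))) ∧
        (∀ i j, BallsMeet x ρ A₁ i j → ρ i < r₀ → closedBall (x j) (A * (K * ρ j)) ⊆ U →
          ∫ y in ball (x j) (ρ j), |g y - α i| ^ p ∂m ≤
            T * Ψ (K * ρ j) * μ.real (ball (x j) (A * (K * ρ j)))) := by
  have ha0 : 0 < a := by linarith
  have hA0 : 0 < A := by linarith
  have hA₁0 : 0 < A₁ := by linarith
  obtain ⟨κ, hκ⟩ : ∃ κ, κ = (1 / (2 * a)) / (12 * a * A) := ⟨_, rfl⟩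
  have hκ0 : 0 < κ := by rw [hκ]; positivity
  have hκa : κ ≤ 1 / (2 * a) := by
    rw [hκ]
    refine div_le_self (by positivity) ?_
    nlinarith
  have hκ1 : κ ≤ 1 := hκa.trans (by rw [div_le_one (by positivity)]; linarith)
  -- The corkscrew lemma needs a strict inequality, so it is applied with `8A₁ + 1` and adds one
  -- more.
  obtain ⟨K₁, hK₁⟩ : ∃ K₁, K₁ = 8 * A₁ + 2 := ⟨_, rfl⟩
  have hK₁0 : 0 ≤ K₁ := by rw [hK₁]; linarith
  -- Bounds `dist (z j) (z i) / ρ j` for neighbours: `K₁` for `z j`, `3A₁` between the centres, and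
  -- `2K₁` for `z i`, since `ρ i ≤ 2 * ρ j`.
  obtain ⟨L, hL⟩ : ∃ L, L = 3 * K₁ + 3 * A₁ := ⟨_, rfl⟩
  have hL0 : 0 ≤ L := by rw [hL]; positivity
  -- The chain runs at scale `ρ j`. The depth `ρ i / a` of the other centre is then only known to be
  -- at least `ρ j / (2a)`, and the radii `κ/2 * ρ i` and `κ/2 * ρ j` both lie in `[κ/4, κ] * ρ j`.
  obtain ⟨T₁, hT₁, hchain⟩ := h.exists_chain_bound hp hVD hΨ hC hA ha hU (c := 1 / (2 * a))
    (κ := κ) (L := L) (κ' := κ / 4) (by positivity)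
    (by rw [div_le_one (by positivity)]; linarith) hκ hL0 (by positivity)
  obtain ⟨C₁, hC₁, hm₁⟩ := hVD.exists_measureReal_ball_le (m := m) ((2 + 3 * A₁ + K₁) / (κ / 2))
  obtain ⟨C₂, hC₂, hm₂⟩ := hVD.exists_measureReal_ball_le (m := m) (2 + 3 * A₁ + K₁)
  obtain ⟨C₃, hC₃, hΨ₃⟩ := hΨ.exists_le 2
  obtain ⟨K, hK⟩ : ∃ K, K = a * L + 1 + 2 * (K₁ + 1) + 3 * A₁ := ⟨_, rfl⟩
  have hK1 : 1 ≤ K := by rw [hK]; nlinarith [mul_nonneg ha0.le hL0]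
  have haL : 0 ≤ a * L := mul_nonneg ha0.le hL0
  refine ⟨1 / (8 * a ^ 2), K, C₁ + C₂ * C₃ * T₁ + 2 ^ p * (1 + C₁) * C, by positivity, hK1,
    by positivity, ?_⟩
  intro ι x ρ hcov hρ
  -- For balls of maximal radius no corkscrew point is needed and the choice of `z` is a dummy;
  -- their coefficient is zero.
  have hz : ∀ i, ∃ z, ρ i < r₀ → dist z (x i) ≤ K₁ * ρ i ∧ a⁻¹ * ρ i ≤ infDist z Uᶜ := fun i => by
    by_cases hi : ρ i < r₀
    · have hρi := hcov.pos i
      obtain ⟨z, hz1, hz2⟩ := exists_corkscrew ha hU hq₁ hq₂ (L := 8 * A₁ + 1) (r := ρ i)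
        (x := x i) hρi (by linarith) (by linarith [hρ i hi])
      exact ⟨z, fun _ => ⟨hz1.trans_eq (by rw [hK₁]; ring), hz2⟩⟩
    · exact ⟨x i, fun h => absurd h hi⟩
  choose z hz using hz
  set Q : ι → Set X := fun i => ball (z i) (κ / 2 * ρ i) with hQ
  have hrad : ∀ i, 0 < κ / 2 * ρ i := fun i => mul_pos (by positivity) (hcov.pos i)
  have hQ0 : ∀ i, m (Q i) ≠ 0 := fun i => (measure_ball_pos m _ (hrad i)).ne'
  have hQt : ∀ i, m (Q i) ≠ ∞ := fun i => (hVD.measure_ball_lt_top _ _).ne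
  have hca : 1 / (8 * a ^ 2) ≤ 1 / (4 * a) / 2 := by
    rw [div_div, div_le_div_iff₀ (by positivity) (by positivity)]
    nlinarith
  have hQY : ∀ i j, BallsMeet x ρ A₁ i j → ρ i < r₀ →
      Q i ⊆ innerRegion U (1 / (8 * a ^ 2)) K (x j) (ρ j) := by
    intro i j hij hi y hy
    have hy' : dist y (z i) < κ / 2 * ρ i := hy
    obtain ⟨h1, h2⟩ := hz i hi
    have h3 := hcov.comparable i j hij
    have h4 := hcov.comparable j i hij.symm
    have hρi := hcov.pos i
    have hρj := hcov.pos j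
    constructor
    · have e1 := infDist_le_infDist_add_dist (s := Uᶜ) (x := z i) (y := y)
      rw [dist_comm] at e1
      have e2 : κ / 2 * ρ i ≤ 1 / (2 * a) * ρ i :=
        mul_le_mul_of_nonneg_right (by linarith) hρi.le
      have e3 : a⁻¹ * ρ i = 1 / (2 * a) * ρ i + 1 / (2 * a) * ρ i := by field_simp; norm_num
      have e4 : 1 / (8 * a ^ 2) * ρ j ≤ 1 / (4 * a) / 2 * (2 * ρ i) := by gcongr
      have e5 : 1 / (4 * a) / 2 * (2 * ρ i) = 1 / (2 * a) * ρ i / 2 := by field_simp; norm_num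
      have e6 : 0 ≤ 1 / (2 * a) * ρ i := by positivity
      linarith
    · have e1 := hcov.dist_le hij
      have e2 := dist_triangle y (z i) (x j)
      have e3 := dist_triangle (z i) (x i) (x j)
      have e4 : κ / 2 * ρ i ≤ 1 * ρ i := by gcongr; linarith
      have e5 : (K₁ + 1) * ρ i ≤ (K₁ + 1) * (2 * ρ j) := by gcongr
      have e6 : 0 ≤ (a * L + 1) * ρ j := by positivity
      rw [hK]
      linarith
  have hY : ∀ j, innerRegion U (1 / (8 * a ^ 2)) K (x j) (ρ j) ⊆ U := fun j =>
    innerRegion_subset (by positivity) (hcov.pos j)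
  have hQm : ∀ i j, BallsMeet x ρ A₁ i j → ρ i < r₀ →
      m.real (ball (x j) (ρ j)) ≤ C₁ * m.real (Q i) := by
    intro i j hij hi
    have hρi := hcov.pos i
    have e0 : (2 + 3 * A₁ + K₁) / (κ / 2) * (κ / 2 * ρ i) = (2 + 3 * A₁ + K₁) * ρ i := by
      field_simp
    have e1 := hcov.dist_le hij.symm
    have e2 := hcov.comparable j i hij.symm
    have e3 := (hz i hi).1
    refine hm₁ _ _ _ _ (hrad i) ?_ ?_
    · rw [e0]
      have : 0 ≤ (3 * A₁ + K₁) * ρ i := by positivity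
      linarith
    · rw [e0]
      have := dist_triangle (x j) (x i) (z i)
      rw [dist_comm (x i) (z i)] at this
      linarith
  have hQU : ∀ i, ρ i < r₀ → Q i ⊆ U := fun i hi =>
    (hQY i i (hcov.meet_self i) hi).trans (hY i)
  classical
  refine ⟨fun i => if ρ i < r₀ then ⨍ y in Q i, g y ∂m else 0, fun i hi => if_neg (not_lt.2 hi),
    fun i j hij => ?_, fun i j hij hi hj => ?_, fun i j hij hi hjU => ?_⟩
  · have hT : C₁ ≤ C₁ + C₂ * C₃ * T₁ + 2 ^ p * (1 + C₁) * C := by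
      have : 0 ≤ C₂ * C₃ * T₁ + 2 ^ p * (1 + C₁) * C := by positivity
      linarith
    beta_reduce
    split_ifs with hi
    · have e1 := h.rpow_average_le hp measurableSet_ball (hQU i hi) (hQ0 i) (hQt i)
      calc |⨍ y in Q i, g y ∂m| ^ p * m.real (ball (x j) (ρ j))
          ≤ |⨍ y in Q i, g y ∂m| ^ p * (C₁ * m.real (Q i)) := by gcongr; exact hQm i j hij hi
        _ = C₁ * (|⨍ y in Q i, g y ∂m| ^ p * m.real (Q i)) := by ring
        _ ≤ C₁ * μ.real (Q i) := by gcongr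
        _ ≤ _ := by
            gcongr
            · finiteness
            · exact hQY i j hij hi
    · rw [abs_zero, Real.zero_rpow (by linarith), zero_mul]
      positivity
  · beta_reduce
    rw [if_pos hi, if_pos hj]
    have h3 := hcov.comparable i j hij
    have h4 := hcov.comparable j i hij.symm
    have hρi := hcov.pos i
    have hρj := hcov.pos j
    have hzi := hz i hi
    have hzj := hz j hj
    have hdij := hcov.dist_le hij
    have e7 : K₁ * ρ i ≤ K₁ * (2 * ρ j) := by gcongr
    have hd : dist (z j) (z i) ≤ L * ρ j := by
      have e1 := dist_triangle (z j) (x j) (z i)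
      have e2 := dist_triangle (x j) (x i) (z i)
      rw [dist_comm (x i) (z i), dist_comm (x j) (x i)] at e2
      rw [hL]
      linarith
    have hinv : a⁻¹ = 1 / (2 * a) * 2 := by field_simp
    have hκj : 0 < κ * ρ j := mul_pos hκ0 hρj
    have hκij : κ * ρ i ≤ κ * (2 * ρ j) := mul_le_mul_of_nonneg_left h3 hκ0.le
    have hκji : κ * ρ j ≤ κ * (2 * ρ i) := mul_le_mul_of_nonneg_left h4 hκ0.le
    have e1 := hchain (z j) (z i) (ρ j) (κ / 2 * ρ j) (κ / 2 * ρ i) hρj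
      (by
        have := hzj.2
        rw [hinv] at this
        have e : 0 ≤ 1 / (2 * a) * ρ j := by positivity
        linarith)
      (by
        have := hzi.2
        rw [hinv] at this
        have e : 1 / (2 * a) * ρ j ≤ 1 / (2 * a) * (2 * ρ i) := by gcongr
        linarith) hd
      (by linarith) (by linarith) (by linarith) (by linarith)
    rw [abs_sub_comm] at e1
    have e2 : {y | 1 / (2 * a) / (4 * a) * ρ j ≤ infDist y Uᶜ ∧ dist y (z j) ≤ (a * L + 1) * ρ j} ⊆
        innerRegion U (1 / (8 * a ^ 2)) K (x j) (ρ j) := by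
      rintro y ⟨hy1, hy2⟩
      refine ⟨?_, ?_⟩
      · convert hy1 using 2
        field_simp; norm_num
      · have := dist_triangle y (z j) (x j)
        have e : 0 ≤ (K₁ + 2 + 3 * A₁) * ρ j := by positivity
        rw [hK]
        linarith [hzj.1]
    have e3 : m.real (ball (x i) (ρ i)) ≤ C₂ * m.real (ball (z j) (ρ j)) := by
      refine hm₂ _ _ _ _ hρj ?_ ?_
      · have e : 0 ≤ (3 * A₁ + K₁) * ρ j := by positivity
        linarith
      · have := dist_triangle (x i) (x j) (z j)
        rw [dist_comm (x j) (z j)] at this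
        linarith [hzj.1]
    have e4 := hΨ₃ (ρ i) (ρ j) hρi hρj h4
    have hΨi := hΨ.pos hρi
    have hΨj := hΨ.pos hρj
    set Y := innerRegion U (1 / (8 * a ^ 2)) K (x j) (ρ j)
    set d := |(⨍ y in Q i, g y ∂m) - ⨍ y in Q j, g y ∂m| ^ p with hd
    have hd0 : 0 ≤ d := by positivity
    calc d * m.real (ball (x i) (ρ i)) ≤ d * (C₂ * m.real (ball (z j) (ρ j))) := by gcongr
      _ = C₂ * (d * m.real (ball (z j) (ρ j))) := by ring
      _ ≤ C₂ * (T₁ * (Ψ (ρ j) * μ.real Y)) := by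
          refine mul_le_mul_of_nonneg_left (e1.trans ?_) hC₂
          gcongr
          finiteness
      _ ≤ C₂ * (T₁ * (C₃ * Ψ (ρ i) * μ.real Y)) := by gcongr
      _ = C₂ * C₃ * T₁ * Ψ (ρ i) * μ.real Y := by ring
      _ ≤ _ := by
          gcongr
          have : 0 ≤ C₁ + 2 ^ p * (1 + C₁) * C := by positivity
          linarith
  · beta_reduce
    rw [if_pos hi]
    have hρj := hcov.pos j
    have hρi := hcov.pos i
    have hKρ : 0 < K * ρ j := by positivity
    have hΨK := hΨ.pos hKρ
    -- Deep inside `U` no chaining is needed: `D` contains both `B j` and the averaging ball `Q i`,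
    -- so `g` and `α i` are both compared with the mean over `D`.
    set D := ball (x j) (K * ρ j) with hD
    set gD := ⨍ y in D, g y ∂m with hgD
    have hDt : m D ≠ ∞ := (hVD.measure_ball_lt_top _ _).ne
    have hDU : D ⊆ U := ball_subset_closedBall.trans
      ((closedBall_subset_closedBall (by nlinarith)).trans hjU)
    have hBD : ball (x j) (ρ j) ⊆ D := ball_subset_ball (by nlinarith)
    have hQD : Q i ⊆ D := by
      refine ball_subset_ball' ?_
      have e1 := hcov.dist_le hij
      have e2 := dist_triangle (z i) (x i) (x j)
      have e4 : κ / 2 * ρ i ≤ 1 * ρ i := by gcongr; linarith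
      have e5 : (K₁ + 1) * ρ i ≤ (K₁ + 1) * (2 * ρ j) := by
        gcongr; exact hcov.comparable i j hij
      have e6 : 0 ≤ (a * L + 1) * ρ j := by positivity
      rw [hK]
      linarith [(hz i hi).1]
    set W := C * Ψ (K * ρ j) * μ.real (ball (x j) (A * (K * ρ j))) with hW
    have hW0 : 0 ≤ W := by positivity
    have e1 : |(⨍ y in Q i, g y ∂m) - gD| ^ p * m.real (Q i) ≤ W :=
      h.rpow_average_sub_average_le hp hA hKρ hjU hDt hQD (hQ0 i)
    have e2 : ∫ y in ball (x j) (ρ j), |g y - gD| ^ p ∂m ≤ W :=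
      (setIntegral_mono_set (h.integrableOn_rpow hp hDU hDt gD)
        (Eventually.of_forall fun y => by positivity) hBD.eventuallyLE).trans
        (h.poincare (x j) (K * ρ j) hKρ hjU)
    have hint := h.integrableOn_rpow hp (hBD.trans hDU) (hVD.measure_ball_lt_top _ _).ne gD
    have hBt : m (ball (x j) (ρ j)) ≠ ∞ := (hVD.measure_ball_lt_top _ _).ne
    calc ∫ y in ball (x j) (ρ j), |g y - ⨍ y in Q i, g y ∂m| ^ p ∂m
        ≤ ∫ y in ball (x j) (ρ j), 2 ^ p * (|g y - gD| ^ p +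
            |(⨍ y in Q i, g y ∂m) - gD| ^ p) ∂m := by
          refine setIntegral_mono (h.integrableOn_rpow hp (hBD.trans hDU) hBt _) ?_ fun y => ?_
          · exact (hint.add (integrableOn_const hBt)).const_mul _
          · have := abs_add_rpow_le hp.le (g y - gD) (gD - ⨍ y in Q i, g y ∂m)
            rw [sub_add_sub_cancel, abs_sub_comm gD] at this
            exact this
      _ = 2 ^ p * (∫ y in ball (x j) (ρ j), |g y - gD| ^ p ∂m +
            |(⨍ y in Q i, g y ∂m) - gD| ^ p * m.real (ball (x j) (ρ j))) := by
          rw [integral_const_mul, integral_add hint (integrableOn_const hBt)]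
          simp [mul_comm]
      _ ≤ 2 ^ p * (W + |(⨍ y in Q i, g y ∂m) - gD| ^ p * (C₁ * m.real (Q i))) := by
          gcongr
          exact hQm i j hij hi
      _ = 2 ^ p * (W + C₁ * (|(⨍ y in Q i, g y ∂m) - gD| ^ p * m.real (Q i))) := by ring
      _ ≤ 2 ^ p * (W + C₁ * W) := by gcongr
      _ = 2 ^ p * (1 + C₁) * C * Ψ (K * ρ j) * μ.real (ball (x j) (A * (K * ρ j))) := by
          rw [hW]; ring
      _ ≤ _ := by
          gcongr
          have : 0 ≤ C₁ + C₂ * C₃ * T₁ := by positivity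
          linarith

end LocalPoincare
end

/-! ### Coefficients of finite support. -/

noncomputable section
open Filter Topology

namespace LocalPoincare

variable {X : Type u} [MetricSpace X] [MeasurableSpace X] {p : ℝ} {m μ : Measure X}
  {U : Set X} {Ψ : ℝ → ℝ} {C A : ℝ} {g : X → ℝ}

set_option maxHeartbeats 800000 in
/-- Finitely supported coefficients of the extension at a positive scale `s`. -/
theorem exists_coefficients [OpensMeasurableSpace X] [LocallyCompactSpace X] [m.IsOpenPosMeasure]
    [IsFiniteMeasureOnCompacts m] [IsFiniteMeasure μ] (hp : 1 < p)
    (h : LocalPoincare p m U Ψ C A g μ) (hVD : VolumeDoubling m) (hΨ : IsScaleFunction Ψ)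
    (hC : 0 ≤ C) (hA : 1 ≤ A) {a : ℝ} (ha : 1 ≤ a)
    (hU : ∀ x ∈ U, ∀ y ∈ U, ∃ γ : Path x y, range γ ⊆ U ∧ diam (range γ) ≤ a * dist x y ∧
      ∀ z ∈ range γ, a⁻¹ * min (dist x z) (dist y z) ≤ infDist z Uᶜ)
    {q₁ q₂ : X} (hq₁ : q₁ ∈ U) (hq₂ : q₂ ∈ U) {r₀ : ℝ} (hr₀ : 0 < r₀) (hr₀q : 4 * r₀ ≤ dist q₁ q₂)
    {A₁ : ℝ} (hA₁ : 1 < A₁) :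
    ∃ c K T : ℝ, 0 < c ∧ 1 ≤ K ∧ 0 ≤ T ∧ ∀ (ι : Type u) (x : ι → X) (ρ : ι → ℝ) (s : ℝ),
      BallCover x ρ A₁ → 0 < s → (∀ i, s ≤ ρ i ∧ ρ i ≤ r₀) →
      (∀ i, ρ i < r₀ → infDist (x i) U ≤ 8 * A₁ * ρ i) →
      ∃ (b : ι → ℝ) (S : Finset ι), (∀ i ∉ S, b i = 0) ∧
        (∀ i j, BallsMeet x ρ A₁ i j →
          |b i| ^ p * m.real (ball (x j) (ρ j)) ≤ T * μ.real (innerRegion U c K (x j) (ρ j))) ∧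
        (∀ i j, BallsMeet x ρ A₁ i j →
          |b i - b j| ^ p * (m.real (ball (x i) (ρ i)) / Ψ (ρ i)) ≤
            T * μ.real (innerRegion U c K (x j) (ρ j))) ∧
        (∀ i j, BallsMeet x ρ A₁ i j → ρ i < r₀ → closedBall (x j) (A * (K * ρ j)) ⊆ U →
          ∫ y in ball (x j) (ρ j), |g y - b i| ^ p ∂m ≤
            T * (Ψ (K * ρ j) * μ.real (ball (x j) (A * (K * ρ j))) +
              (s * dist (x i) q₁) ^ p * μ.real (innerRegion U c K (x j) (ρ j)))) := by
  obtain ⟨c, K, T, hc, hK, hT, hα⟩ := h.exists_averages hp hVD hΨ hC hA ha hU hq₁ hq₂ hr₀q hA₁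
  have hA₁0 : 0 < A₁ := by linarith
  obtain ⟨C₄, hC₄, hm₄⟩ := hVD.exists_measureReal_ball_le (m := m) (2 + 3 * A₁)
  have hΨ₀ : 0 < Ψ (r₀ / 2) := hΨ.pos (by positivity)
  have hP1 : (1 : ℝ) ≤ 2 ^ p := Real.one_le_rpow one_le_two (by linarith)
  refine ⟨c, K, 2 ^ p * T + 2 ^ p * (C₄ * T) + 2 ^ p * (2 * (C₄ * T)) / Ψ (r₀ / 2), hc, hK,
    by positivity, ?_⟩
  intro ι x ρ s hcov hs hρ hUρ
  obtain ⟨α, hα0, hα1, hα2, hα3⟩ := hα ι x ρ hcov hUρ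
  have hΨs := hΨ.pos hs
  -- The cutoff `χ` is `1/R`-Lipschitz. The first term makes `1 - χ i` at most `s * dist (x i) q₁`.
  -- The second makes `|χ i - χ j| ^ p` at most `Ψ s` for neighbours, which absorbs the division by
  -- `Ψ (ρ i)` in the energy estimate.
  set R := max (1 / s) (3 * A₁ * r₀ / Ψ s ^ (1 / p)) with hR
  have hR0 : 0 < R := lt_max_of_lt_left (by positivity)
  have hRs : 1 / R ≤ s := by
    rw [div_le_iff₀ hR0]
    have : 1 / s ≤ R := le_max_left _ _
    rwa [div_le_iff₀ hs, mul_comm] at this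
  have hRΨ : (3 * A₁ * r₀ / R) ^ p ≤ Ψ s := by
    have e1 : 3 * A₁ * r₀ / R ≤ Ψ s ^ (1 / p) := by
      have : 3 * A₁ * r₀ / Ψ s ^ (1 / p) ≤ R := le_max_right _ _
      rw [div_le_iff₀ (by positivity)] at this ⊢
      linarith
    calc _ ≤ (Ψ s ^ (1 / p)) ^ p := by gcongr
      _ = Ψ s := by
        rw [← Real.rpow_mul hΨs.le, one_div_mul_cancel (by linarith), Real.rpow_one]
  set χ : ι → ℝ := fun i => max 0 (1 - dist (x i) q₁ / R) with hχ
  have hχ0 : ∀ i, 0 ≤ χ i := fun i => le_max_left _ _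
  have hχ1 : ∀ i, χ i ≤ 1 := fun i => max_le zero_le_one (by
    have : 0 ≤ dist (x i) q₁ / R := by positivity
    linarith)
  have hχd : ∀ i j, |χ i - χ j| ≤ dist (x i) (x j) / R := fun i j => by
    have e1 : |χ i - χ j| ≤ |(1 - dist (x i) q₁ / R) - (1 - dist (x j) q₁ / R)| := by
      refine (abs_max_sub_max_le_max 0 (1 - dist (x i) q₁ / R) 0 (1 - dist (x j) q₁ / R)).trans ?_
      rw [sub_self, abs_zero]
      exact max_le (abs_nonneg _) le_rfl
    refine e1.trans ?_
    rw [sub_sub_sub_cancel_left, ← sub_div, abs_div, abs_of_pos hR0]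
    gcongr
    rw [abs_sub_comm]
    exact abs_dist_sub_le _ _ _
  -- The cores have radius at least `s / 6`; this finiteness is what a positive scale `s` provides.
  have hfin : {i | dist (x i) q₁ < R}.Finite := by
    obtain ⟨N, hN⟩ := hVD.exists_card_le (m := m) (R / (s / 6))
    refine Set.finite_of_forall_card_le (N := N) fun J hJ => ?_
    refine hN ι q₁ (s / 6) x J (by positivity) (fun i hi => ?_) ?_
    · rw [div_mul_cancel₀ _ (by positivity)]
      exact le_of_lt (hJ hi)
    · exact hcov.pairwiseDisjoint _ fun i _ => by linarith [(hρ i).1]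
  have hbα : ∀ i, |χ i * α i| ^ p ≤ |α i| ^ p := fun i => by
    refine Real.rpow_le_rpow (abs_nonneg _) ?_ (by linarith)
    rw [abs_mul, abs_of_nonneg (hχ0 i)]
    exact mul_le_of_le_one_left (abs_nonneg _) (hχ1 i)
  have hmij : ∀ i j, BallsMeet x ρ A₁ i j →
      m.real (ball (x i) (ρ i)) ≤ C₄ * m.real (ball (x j) (ρ j)) := fun i j hij => by
    have hρj := hcov.pos j
    have e : 0 ≤ A₁ * ρ j := by positivity
    exact hm₄ _ _ _ _ hρj (by linarith [hcov.comparable i j hij]) (by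
      linarith [hcov.dist_le hij])
  refine ⟨fun i => χ i * α i, hfin.toFinset, fun i hi => ?_, fun i j hij => ?_, fun i j hij => ?_,
    fun i j hij hi hjU => ?_⟩
  · have hi' : R ≤ dist (x i) q₁ := by simpa using hi
    have : χ i = 0 := max_eq_left (by
      rw [sub_nonpos, le_div_iff₀ hR0]; linarith)
    beta_reduce
    rw [this, zero_mul]
  · calc |χ i * α i| ^ p * m.real (ball (x j) (ρ j))
        ≤ |α i| ^ p * m.real (ball (x j) (ρ j)) :=
          mul_le_mul_of_nonneg_right (hbα i) measureReal_nonneg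
      _ ≤ T * μ.real (innerRegion U c K (x j) (ρ j)) := hα1 i j hij
      _ ≤ _ := by
        gcongr
        have e1 : 0 ≤ 2 ^ p * (C₄ * T) + 2 ^ p * (2 * (C₄ * T)) / Ψ (r₀ / 2) := by positivity
        nlinarith
  · beta_reduce
    have hρi := hcov.pos i
    have hΨi := hΨ.pos hρi
    have hmj := hmij i j hij
    set Y := μ.real (innerRegion U c K (x j) (ρ j))
    have hY : 0 ≤ Y := measureReal_nonneg
    rw [← mul_div_assoc, div_le_iff₀ hΨi]
    by_cases hboth : ρ i < r₀ ∧ ρ j < r₀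
    · have e1 : |χ i * α i - χ j * α j| ^ p ≤ 2 ^ p * (|α i - α j| ^ p + Ψ (ρ i) * |α j| ^ p) := by
        have e2 := abs_add_rpow_le hp.le (χ i * (α i - α j)) ((χ i - χ j) * α j)
        have e3 : χ i * (α i - α j) + (χ i - χ j) * α j = χ i * α i - χ j * α j := by ring
        rw [e3] at e2
        refine e2.trans ?_
        have e4 : |χ i * (α i - α j)| ^ p ≤ |α i - α j| ^ p := by
          refine Real.rpow_le_rpow (abs_nonneg _) ?_ (by linarith)
          rw [abs_mul, abs_of_nonneg (hχ0 i)]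
          exact mul_le_of_le_one_left (abs_nonneg _) (hχ1 i)
        have e5 : |χ i - χ j| ^ p ≤ Ψ (ρ i) := by
          refine le_trans ?_ (hRΨ.trans (hΨ.mono hs (hρ i).1))
          refine Real.rpow_le_rpow (abs_nonneg _) ((hχd i j).trans ?_) (by linarith)
          gcongr
          exact (hcov.dist_le hij).trans (by gcongr; exact (hρ j).2)
        rw [abs_mul (χ i - χ j), Real.mul_rpow (abs_nonneg _) (abs_nonneg _)]
        gcongr
      calc |χ i * α i - χ j * α j| ^ p * m.real (ball (x i) (ρ i))
          ≤ 2 ^ p * (|α i - α j| ^ p + Ψ (ρ i) * |α j| ^ p) * m.real (ball (x i) (ρ i)) := by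
            gcongr
        _ = 2 ^ p * (|α i - α j| ^ p * m.real (ball (x i) (ρ i)) +
              Ψ (ρ i) * |α j| ^ p * m.real (ball (x i) (ρ i))) := by ring
        _ ≤ 2 ^ p * (T * Ψ (ρ i) * Y +
              Ψ (ρ i) * |α j| ^ p * (C₄ * m.real (ball (x j) (ρ j)))) := by
            gcongr 2 ^ p * (?_ + Ψ (ρ i) * |α j| ^ p * ?_)
            exact hα2 i j hij hboth.1 hboth.2
        _ = 2 ^ p * (T * Ψ (ρ i) * Y +
              Ψ (ρ i) * C₄ * (|α j| ^ p * m.real (ball (x j) (ρ j)))) := by ring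
        _ ≤ 2 ^ p * (T * Ψ (ρ i) * Y + Ψ (ρ i) * C₄ * (T * Y)) := by
            gcongr 2 ^ p * (_ + Ψ (ρ i) * C₄ * ?_)
            exact hα1 j j (hcov.meet_self j)
        _ = (2 ^ p * T + 2 ^ p * (C₄ * T)) * Y * Ψ (ρ i) := by ring
        _ ≤ _ := by
            gcongr ?_ * Y * Ψ (ρ i)
            exact le_add_of_nonneg_right (by positivity)
    -- At least one of the two radii has reached `r₀`, so the averages cannot be compared by
    -- chaining. But `Ψ (ρ i)` is then bounded below, and the `L^p` bounds on both coefficients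
    -- suffice.
    · have hri : r₀ / 2 ≤ ρ i := by
        by_cases hi : ρ i < r₀
        · have : r₀ ≤ ρ j := by
            by_contra hcon
            exact hboth ⟨hi, not_le.1 hcon⟩
          linarith [hcov.comparable j i hij.symm]
        · linarith
      have hΨri : Ψ (r₀ / 2) ≤ Ψ (ρ i) := hΨ.mono (by positivity) hri
      have e1 : |χ i * α i - χ j * α j| ^ p ≤ 2 ^ p * (|α i| ^ p + |α j| ^ p) := by
        have e2 := abs_add_rpow_le hp.le (χ i * α i) (-(χ j * α j))
        rw [abs_neg, ← sub_eq_add_neg] at e2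
        refine e2.trans ?_
        gcongr 2 ^ p * (?_ + ?_)
        · exact hbα i
        · exact hbα j
      calc |χ i * α i - χ j * α j| ^ p * m.real (ball (x i) (ρ i))
          ≤ 2 ^ p * (|α i| ^ p + |α j| ^ p) * (C₄ * m.real (ball (x j) (ρ j))) := by gcongr
        _ = 2 ^ p * (C₄ * (|α i| ^ p * m.real (ball (x j) (ρ j))) +
              C₄ * (|α j| ^ p * m.real (ball (x j) (ρ j)))) := by ring
        _ ≤ 2 ^ p * (C₄ * (T * Y) + C₄ * (T * Y)) := by
            gcongr 2 ^ p * (C₄ * ?_ + C₄ * ?_)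
            · exact hα1 i j hij
            · exact hα1 j j (hcov.meet_self j)
        _ = 2 ^ p * (2 * (C₄ * T)) / Ψ (r₀ / 2) * Y * Ψ (r₀ / 2) := by field_simp; ring
        _ ≤ 2 ^ p * (2 * (C₄ * T)) / Ψ (r₀ / 2) * Y * Ψ (ρ i) := by gcongr
        _ ≤ _ := by
            gcongr ?_ * Y * Ψ (ρ i)
            exact le_add_of_nonneg_left (by positivity)
  · beta_reduce
    have hρj := hcov.pos j
    have hKρ : 0 < K * ρ j := by positivity
    have hΨK := hΨ.pos hKρ
    have hBU : ball (x j) (ρ j) ⊆ U := (ball_subset_closedBall.trans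
      (closedBall_subset_closedBall (by nlinarith [mul_le_mul_of_nonneg_right hK hρj.le]))).trans hjU
    have hBt : m (ball (x j) (ρ j)) ≠ ∞ := (hVD.measure_ball_lt_top _ _).ne
    have hint := h.integrableOn_rpow hp hBU hBt (α i)
    set Y := μ.real (innerRegion U c K (x j) (ρ j))
    set Z := μ.real (ball (x j) (A * (K * ρ j)))
    have hdiff : |α i - χ i * α i| ^ p ≤ (s * dist (x i) q₁) ^ p * |α i| ^ p := by
      rw [← Real.mul_rpow (by positivity) (abs_nonneg _)]
      refine Real.rpow_le_rpow (abs_nonneg _) ?_ (by linarith)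
      have e1 : α i - χ i * α i = (1 - χ i) * α i := by ring
      rw [e1, abs_mul, abs_of_nonneg (sub_nonneg.2 (hχ1 i))]
      gcongr
      have e2 : 1 - dist (x i) q₁ / R ≤ χ i := le_max_right _ _
      have e3 : dist (x i) q₁ / R ≤ s * dist (x i) q₁ := by
        rw [div_eq_mul_one_div, mul_comm]; gcongr
      linarith
    calc ∫ y in ball (x j) (ρ j), |g y - χ i * α i| ^ p ∂m
        ≤ ∫ y in ball (x j) (ρ j), 2 ^ p * (|g y - α i| ^ p +
            (s * dist (x i) q₁) ^ p * |α i| ^ p) ∂m := by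
          refine setIntegral_mono (h.integrableOn_rpow hp hBU hBt _) ?_ fun y => ?_
          · exact (hint.add (integrableOn_const hBt)).const_mul _
          · have e1 := abs_add_rpow_le hp.le (g y - α i) (α i - χ i * α i)
            rw [sub_add_sub_cancel] at e1
            exact e1.trans (by gcongr)
      _ = 2 ^ p * (∫ y in ball (x j) (ρ j), |g y - α i| ^ p ∂m +
            (s * dist (x i) q₁) ^ p * (|α i| ^ p * m.real (ball (x j) (ρ j)))) := by
          rw [integral_const_mul, integral_add hint (integrableOn_const hBt), setIntegral_const,
            smul_eq_mul]
          ring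
      _ ≤ 2 ^ p * (T * Ψ (K * ρ j) * Z + (s * dist (x i) q₁) ^ p * (T * Y)) := by
          gcongr 2 ^ p * (?_ + (s * dist (x i) q₁) ^ p * ?_)
          · exact hα3 i j hij hi hjU
          · exact hα1 i j hij
      _ = 2 ^ p * T * (Ψ (K * ρ j) * Z + (s * dist (x i) q₁) ^ p * Y) := by ring
      _ ≤ _ := by
          gcongr ?_ * _
          rw [add_assoc]
          exact le_add_of_nonneg_right (by positivity)

end LocalPoincare
end

/-! ### Bounded overlap of the inner regions, and radii adapted to the domain. -/

noncomputable section
open Filter Topology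

/-- Only balls of comparable radius can have an inner region through a given `y`. Either the radius
is `s`, or the centre lies outside `U`, in which case the distance from `y` to the complement is
between `c * ρ i` and `K * ρ i`. Packing bounds each kind. -/
theorem VolumeDoubling.exists_card_innerRegion_le {X : Type u} [MetricSpace X] [MeasurableSpace X]
    {m : Measure X} [OpensMeasurableSpace X] [m.IsOpenPosMeasure] [LocallyCompactSpace X]
    [IsFiniteMeasureOnCompacts m] (hVD : VolumeDoubling m) (U : Set X) {c K : ℝ} (hc : 0 < c)
    (hK : 1 ≤ K) (A₁ : ℝ) :
    ∃ N : ℕ, ∀ (ι : Type u) (x : ι → X) (ρ : ι → ℝ) (s : ℝ), BallCover x ρ A₁ → 0 < s →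
      (∀ i, ρ i = s ∨ 0 < infDist (x i) U) → ∀ (y : X) (J : Finset ι),
        (∀ i ∈ J, y ∈ innerRegion U c K (x i) (ρ i)) → J.card ≤ N := by
  classical
  obtain ⟨N₁, hN₁⟩ := hVD.exists_card_le (6 * K)
  obtain ⟨N₂, hN₂⟩ := hVD.exists_card_le (6 * K ^ 2 / c)
  refine ⟨N₁ + N₂, fun ι x ρ s hcov hs hρ y J hJ => ?_⟩
  have hconst : (J.filter fun i => ρ i = s).card ≤ N₁ := by
    refine hN₁ ι y (s / 6) x _ (by positivity) (fun i hi => ?_) ?_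
    · obtain ⟨hi, hit⟩ := Finset.mem_filter.1 hi
      have := (hJ i hi).2
      rw [hit, dist_comm] at this
      linarith
    · refine hcov.pairwiseDisjoint _ fun i hi => ?_
      rw [(Finset.mem_filter.1 hi).2]
  have hfar : (J.filter fun i => 0 < infDist (x i) U).card ≤ N₂ := by
    rcases (J.filter fun i => 0 < infDist (x i) U).eq_empty_or_nonempty with h0 | ⟨i₀, hi₀⟩
    · simp [h0]
    have hK0 : 0 < K := by linarith
    have hd : ∀ i ∈ J.filter fun i => 0 < infDist (x i) U, infDist y Uᶜ ≤ K * ρ i := fun i hi => by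
      obtain ⟨hi, hiU⟩ := Finset.mem_filter.1 hi
      have hx : x i ∈ Uᶜ := fun hx => hiU.ne' (infDist_zero_of_mem hx)
      exact (infDist_le_dist_of_mem hx).trans (hJ i hi).2
    have hy0 : 0 < infDist y Uᶜ := (mul_pos hc (hcov.pos i₀)).trans_le
      (hJ i₀ (Finset.mem_filter.1 hi₀).1).1
    refine hN₂ ι y (infDist y Uᶜ / (6 * K)) x _ (by positivity) (fun i hi => ?_) ?_
    · obtain ⟨h1, h2⟩ := hJ i (Finset.mem_filter.1 hi).1
      rw [dist_comm]
      refine h2.trans ?_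
      have e : 6 * K ^ 2 / c * (infDist y Uᶜ / (6 * K)) = K * (infDist y Uᶜ / c) := by
        field_simp
      rw [e]
      gcongr
      rw [le_div_iff₀ hc]
      linarith
    · refine hcov.pairwiseDisjoint _ fun i hi => ?_
      have := hd i hi
      rw [div_le_div_iff₀ (by positivity) (by norm_num)]
      linarith
  have hsub : J ⊆ (J.filter fun i => ρ i = s) ∪ J.filter fun i => 0 < infDist (x i) U := by
    intro i hi
    simp only [Finset.mem_union, Finset.mem_filter, hi, true_and]
    exact hρ i
  have h1 := Finset.card_le_card hsub
  have h2 := Finset.card_union_le (J.filter fun i => ρ i = s)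
    (J.filter fun i => 0 < infDist (x i) U)
  omega

/-- Passage from ball-by-ball estimates to global ones. Only balls that meet `E` are used, so that
local information about those balls may enter the estimate. -/
theorem MeasureTheory.measure_le_of_cover {X ι : Type*} [MeasurableSpace X] [Countable ι]
    (ν μ : Measure X) (B Y : ι → Set X) (hY : ∀ i, MeasurableSet (Y i)) {E S : Set X}
    (hE : E ⊆ ⋃ i, B i) (κ : ℝ≥0∞) (hν : ∀ i, (E ∩ B i).Nonempty → ν (B i) ≤ κ * μ (Y i)) (N : ℕ)
    (hN : ∀ (y : X) (J : Finset ι), (∀ i ∈ J, (E ∩ B i).Nonempty ∧ y ∈ Y i) → J.card ≤ N)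
    (hS : ∀ i, (E ∩ B i).Nonempty → Y i ⊆ S) : ν E ≤ κ * (N * μ S) := by
  classical
  let Z : ι → Set X := fun i => if (E ∩ B i).Nonempty then Y i else ∅
  have hZm : ∀ i, MeasurableSet (Z i) := fun i => by
    by_cases h : (E ∩ B i).Nonempty
    · simpa [Z, h] using hY i
    · simp [Z, h]
  calc ν E ≤ ν (⋃ i, E ∩ B i) := measure_mono (by rw [← inter_iUnion]; exact subset_inter le_rfl hE)
    _ ≤ ∑' i, ν (E ∩ B i) := measure_iUnion_le _
    _ ≤ ∑' i, κ * μ (Z i) := by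
        refine ENNReal.tsum_le_tsum fun i => ?_
        by_cases h : (E ∩ B i).Nonempty
        · simp only [Z, if_pos h]
          exact (measure_mono inter_subset_right).trans (hν i h)
        · rw [not_nonempty_iff_eq_empty.1 h]
          simp
    _ = κ * ∑' i, μ (Z i) := ENNReal.tsum_mul_left
    _ ≤ κ * (N * μ S) := by
        gcongr
        refine tsum_measure_le_of_card_le μ Z hZm N (fun y J hJ => hN y J fun i hi => ?_)
          fun i => ?_
        · have := hJ i hi
          by_cases h : (E ∩ B i).Nonempty
          · exact ⟨h, by simpa [Z, h] using this⟩
          · simp [Z, h] at this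
        · by_cases h : (E ∩ B i).Nonempty
          · simpa [Z, h] using hS i h
          · simp [Z, h]

/-- The radius at `y` of the covers adapted to `U`: comparable to the distance from `U`,
truncated at the levels `s` and `r₀`. -/
def coverRadius {X : Type*} [MetricSpace X] (U : Set X) (A s r₀ : ℝ) (y : X) : ℝ :=
  max s (min r₀ (infDist y U / (8 * A)))

section CoverRadius

variable {X : Type*} [MetricSpace X] {U : Set X} {A s r₀ : ℝ}

theorem coverRadius_mem (hsr : s ≤ r₀) (y : X) :
    s ≤ coverRadius U A s r₀ y ∧ coverRadius U A s r₀ y ≤ r₀ :=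
  ⟨le_max_left _ _, max_le hsr (min_le_left _ _)⟩

theorem coverRadius_lipschitz (hA : 0 < A) (y z : X) :
    8 * A * (coverRadius U A s r₀ y - coverRadius U A s r₀ z) ≤ dist y z := by
  have h1 : |coverRadius U A s r₀ y - coverRadius U A s r₀ z| ≤
      |infDist y U / (8 * A) - infDist z U / (8 * A)| := by
    refine (abs_max_sub_max_le_max _ _ _ _).trans (max_le (by simp) ?_)
    refine (abs_min_sub_min_le_max _ _ _ _).trans (max_le (by simp) le_rfl)
  have h2 : |infDist y U - infDist z U| ≤ dist y z := by
    rw [abs_le]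
    have e1 := infDist_le_infDist_add_dist (s := U) (x := y) (y := z)
    have e2 := infDist_le_infDist_add_dist (s := U) (x := z) (y := y)
    rw [dist_comm z y] at e2
    constructor <;> linarith
  rw [← sub_div, abs_div, abs_of_pos (by positivity : 0 < 8 * A)] at h1
  have h3 := (le_abs_self _).trans h1
  rw [le_div_iff₀ (by positivity)] at h3
  linarith

theorem coverRadius_of_infDist_eq_zero (hs : 0 < s) (hr₀ : 0 < r₀) {y : X} (hy : infDist y U = 0) :
    coverRadius U A s r₀ y = s := by
  rw [coverRadius, hy, zero_div, min_eq_right hr₀.le, max_eq_left hs.le]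

theorem infDist_le_of_coverRadius_lt (hA : 0 < A) {y : X} (hy : coverRadius U A s r₀ y < r₀) :
    infDist y U ≤ 8 * A * coverRadius U A s r₀ y := by
  have h1 : min r₀ (infDist y U / (8 * A)) ≤ coverRadius U A s r₀ y := le_max_right _ _
  rcases min_le_iff.1 h1 with h | h
  · exact absurd hy (not_lt.2 h)
  · rwa [div_le_iff₀' (by positivity)] at h

theorem coverRadius_eq_or_infDist_pos (hs : 0 < s) (hr₀ : 0 < r₀) (y : X) :
    coverRadius U A s r₀ y = s ∨ 0 < infDist y U := by
  rcases (infDist_nonneg (s := U) (x := y)).eq_or_lt with h | h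
  · exact Or.inl (coverRadius_of_infDist_eq_zero hs hr₀ h.symm)
  · exact Or.inr h

end CoverRadius
end

/-! ### Approximate extensions at scale `s`. -/

noncomputable section
open Filter Topology

theorem MeasureTheory.Lp.norm_le_of_lintegral_rpow_le {X : Type*} [MeasurableSpace X]
    {m : Measure X} {p : ℝ} (hp : 0 < p) (u : Lp ℝ (ENNReal.ofReal p) m) {T : ℝ} (hT : 0 ≤ T)
    (h : ∫⁻ y, ENNReal.ofReal (|u y| ^ p) ∂m ≤ ENNReal.ofReal T) : ‖u‖ ≤ T ^ (1 / p) := by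
  rw [Lp.norm_def, eLpNorm_eq_lintegral_rpow_enorm_toReal (by simpa using hp)
    ENNReal.ofReal_ne_top, ENNReal.toReal_ofReal hp.le]
  refine ENNReal.toReal_le_of_le_ofReal (by positivity) ?_
  rw [← ENNReal.ofReal_rpow_of_nonneg hT (by positivity)]
  refine ENNReal.rpow_le_rpow (le_trans (le_of_eq ?_) h) (by positivity)
  refine lintegral_congr fun y => ?_
  rw [← ENNReal.ofReal_rpow_of_nonneg (abs_nonneg _) hp.le, ← Real.norm_eq_abs, ofReal_norm]

namespace PEnergyForm

variable {p : ℝ} [Fact (1 < p)] {X : Type u} [MetricSpace X] [MeasurableSpace X] {m : Measure X}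
  {𝓔 : PEnergyForm p m} {Γ : 𝓔.domain → Measure X} {Ψ : ℝ → ℝ}

set_option maxHeartbeats 800000 in
/-- Approximations at scale `s` of the extension of a function on a uniform domain. -/
theorem exists_approximation [BorelSpace X] [LocallyCompactSpace X] [SecondCountableTopology X]
    [Nontrivial X] [m.IsOpenPosMeasure] [IsFiniteMeasureOnCompacts m]
    (hcap : 𝓔.CapacityUpperBound Ψ) (h : 𝓔.IsRegularWithEnergyMeasures Γ)
    (hΨ : IsScaleFunction Ψ) (hVD : VolumeDoubling m) {U : Set X} {C A : ℝ} {g : X → ℝ}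
    {μ : Measure X} [IsFiniteMeasure μ] (hg : LocalPoincare p m U Ψ C A g μ)
    (hC : 0 ≤ C) (hA : 1 ≤ A) {a : ℝ} (ha : 1 ≤ a)
    (hU : ∀ x ∈ U, ∀ y ∈ U, ∃ γ : Path x y, range γ ⊆ U ∧ diam (range γ) ≤ a * dist x y ∧
      ∀ z ∈ range γ, a⁻¹ * min (dist x z) (dist y z) ≤ infDist z Uᶜ)
    {q₁ q₂ : X} (hq₁ : q₁ ∈ U) (hq₂ : q₂ ∈ U) (hq : q₁ ≠ q₂) :
    ∃ T s₀ : ℝ, 0 < T ∧ 0 < s₀ ∧ ∀ s, 0 < s → s < s₀ → ∃ G : 𝓔.domain,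
      𝓔.rootEnergy G ≤ T ∧ ‖(G : Lp ℝ (ENNReal.ofReal p) m)‖ ≤ T ∧
      Γ G (frontier U) ≤ ENNReal.ofReal T * μ {y | y ∈ U ∧ infDist y Uᶜ ≤ T * s} ∧
      ∀ (y₀ : X) (δ : ℝ), closedBall y₀ (2 * δ) ⊆ U → T * s ≤ δ →
        ∫⁻ y in ball y₀ δ, ENNReal.ofReal (|𝓔.toFun G y - g y| ^ p) ∂m ≤
          ENNReal.ofReal (T * (Ψ (T * s) + (s * (2 * δ + dist y₀ q₁)) ^ p)) := by
  classical
  have hp : 1 < p := Fact.out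
  obtain ⟨A₁, r₁, D, hA₁, hr₁, hD, hpart⟩ := hcap.exists_partition h hΨ hVD
  have hA₁0 : 0 < A₁ := by linarith
  have hA0 : 0 < A := by linarith
  have hq0 : 0 < dist q₁ q₂ := dist_pos.2 hq
  obtain ⟨r₀, hr₀, hr₀1, hr₀q⟩ : ∃ r₀, 0 < r₀ ∧ r₀ ≤ r₁ ∧ 4 * r₀ ≤ dist q₁ q₂ :=
    ⟨min r₁ (dist q₁ q₂ / 4), by positivity, min_le_left _ _, by
      linarith [min_le_right r₁ (dist q₁ q₂ / 4)]⟩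
  obtain ⟨c, K, T₁, hc, hK, hT₁, hcoef⟩ :=
    hg.exists_coefficients hp hVD hΨ hC hA ha hU hq₁ hq₂ hr₀ hr₀q hA₁
  obtain ⟨N, hN⟩ := hVD.exists_card_meet_le A₁
  obtain ⟨N', hN'⟩ := hVD.exists_card_innerRegion_le U hc hK A₁
  obtain ⟨N'', hN''⟩ := hVD.exists_card_le (12 * (A * K))
  have hK0 : 0 < K := by linarith
  set M := μ.real univ with hM
  have hM0 : 0 ≤ M := measureReal_nonneg
  obtain ⟨TE, hTE⟩ : ∃ TE, TE = ((N : ℝ) * D) ^ p * T₁ := ⟨_, rfl⟩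
  have hTE0 : 0 ≤ TE := by rw [hTE]; positivity
  -- One constant dominates the finitely many bounds needed below; none of them involves `s`.
  obtain ⟨T, hT1, hTa, hTb, hTc, hTd, hTe, hTf, hTg⟩ : ∃ T : ℝ, 1 ≤ T ∧
      (TE * (N' * M)) ^ (1 / p) ≤ T ∧ (N * T₁ * (N' * M)) ^ (1 / p) ≤ T ∧
      TE * N' ≤ T ∧ 2 * (K + 1) ≤ T ∧ 2 * (1 + A * K) ≤ T ∧ 2 * (3 * A₁ + 1) ≤ T ∧
      N * T₁ * (N'' * M) ≤ T := by
    have hev : ∀ t : ℝ, ∀ᶠ T in atTop, t ≤ T := fun t => eventually_ge_atTop t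
    exact ((hev 1).and <| (hev _).and <| (hev _).and <| (hev _).and <| (hev _).and <|
      (hev _).and <| (hev _).and (hev _)).exists
  have hT0 : 0 < T := by linarith
  refine ⟨T, r₀ / 8, hT0, by positivity, fun s hs hsr => ?_⟩
  obtain ⟨Z, hcov⟩ := BallCover.exists_of_slowlyVarying hA₁ (coverRadius U A₁ s r₀) hs
    (fun y => coverRadius_mem (by linarith) y) (coverRadius_lipschitz hA₁0)
  set x : Z → X := fun i => (i : X) with hx
  set ρ : Z → ℝ := fun i => coverRadius U A₁ s r₀ i with hρ
  have hcount : Countable Z := by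
    refine (hcov.disjoint.countable_of_isOpen_disjoint (fun i => isOpen_ball) fun i => ?_)
    exact ⟨x i, mem_ball_self (by linarith [hcov.pos i])⟩
  have hρr : ∀ i, s ≤ ρ i ∧ ρ i ≤ r₀ := fun i => coverRadius_mem (by linarith) _
  obtain ⟨ψ, hψ⟩ := hpart Z x ρ hcov fun i => (hρr i).2.trans hr₀1
  obtain ⟨nb, hnb, hnbN⟩ := hN Z x ρ hcov
  have hnb' : ∀ j i, BallsMeet x ρ A₁ i j → i ∈ nb j := fun j i => (hnb i j).2
  obtain ⟨b, S, hbS, hb1, hb2, hb3⟩ := hcoef Z x ρ s hcov hs hρr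
    fun i hi => infDist_le_of_coverRadius_lt hA₁0 hi
  have hover := hN' Z x ρ s hcov hs fun i => coverRadius_eq_or_infDist_pos hs hr₀ _
  have hcovE : ∀ E : Set X, E ⊆ ⋃ i, ball (x i) (ρ i) := fun E y _ => mem_iUnion.2 (hcov.cover y)
  have hYm : ∀ j, MeasurableSet (innerRegion U c K (x j) (ρ j)) := fun j =>
    measurableSet_innerRegion _ _ _ _ _
  have hYU : ∀ j, innerRegion U c K (x j) (ρ j) ⊆ U := fun j => innerRegion_subset hc (hcov.pos j)
  -- A ball meeting the closure of `U` has radius of order `s`, because the cover radius equals `s`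
  -- there and is `1/(8A₁)`-Lipschitz.
  have hsmall : ∀ j y, infDist y U = 0 → y ∈ ball (x j) (ρ j) → ρ j ≤ 2 * s := fun j y hy hyj => by
    have e1 := coverRadius_lipschitz (U := U) (s := s) (r₀ := r₀) hA₁0 (x j) y
    rw [coverRadius_of_infDist_eq_zero hs hr₀ hy, dist_comm] at e1
    have e2 : dist y (x j) < ρ j := hyj
    change 8 * A₁ * (ρ j - s) ≤ _ at e1
    by_contra hcon
    push Not at hcon
    have e3 : 8 * 1 * (ρ j - s) ≤ 8 * A₁ * (ρ j - s) := by gcongr; linarith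
    linarith
  set G := ∑ i ∈ S, b i • ψ i with hG
  have hfinG := h.finite G
  have hΓball : ∀ j, Γ G (ball (x j) (ρ j)) ≤
      ENNReal.ofReal TE * μ (innerRegion U c K (x j) (ρ j)) := fun j => by
    have e1 := hψ.measureReal_ball_le h hΨ hcov hD b S hbS (fun i => hnb i j) (hnbN j)
      (τ := T₁ * μ.real (innerRegion U c K (x j) (ρ j))) fun i hij => hb2 i j hij
    rw [← mul_assoc, ← hTE] at e1
    rw [← ofReal_measureReal (μ := Γ G), ← ofReal_measureReal (μ := μ), ← ENNReal.ofReal_mul hTE0]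
    exact ENNReal.ofReal_le_ofReal e1
  have hΓ : ∀ E W : Set X, (∀ j, (E ∩ ball (x j) (ρ j)).Nonempty →
      innerRegion U c K (x j) (ρ j) ⊆ W) → Γ G E ≤ ENNReal.ofReal TE * (N' * μ W) := fun E W hEW =>
    measure_le_of_cover (Γ G) μ _ _ hYm (hcovE E) _ (fun j _ => hΓball j) N'
      (fun y J hJ => hover y J fun i hi => (hJ i hi).2) hEW
  refine ⟨G, ?_, ?_, ?_, fun y₀ δ hδU hδ => ?_⟩
  · refine le_trans ?_ hTa
    rw [rootEnergy_apply, h.energy_eq]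
    refine Real.rpow_le_rpow measureReal_nonneg ?_ (by positivity)
    have e1 := hΓ univ univ fun j _ => subset_univ _
    rw [← ofReal_measureReal (μ := μ), ← ENNReal.ofReal_natCast,
      ← ENNReal.ofReal_mul (by positivity), ← ENNReal.ofReal_mul hTE0] at e1
    exact ENNReal.toReal_le_of_le_ofReal (by positivity) e1
  · refine le_trans (Lp.norm_le_of_lintegral_rpow_le (by linarith)
      (G : Lp ℝ (ENNReal.ofReal p) m) (T := N * T₁ * (N' * M)) (by positivity) ?_) hTb
    have e1 : ∀ j, (m.withDensity fun y => ENNReal.ofReal (|𝓔.toFun G y| ^ p)) (ball (x j) (ρ j)) ≤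
        ENNReal.ofReal (N * T₁) * μ (innerRegion U c K (x j) (ρ j)) := fun j => by
      rw [withDensity_apply _ measurableSet_ball]
      have hBt : m (ball (x j) (ρ j)) ≠ ∞ := (hVD.measure_ball_lt_top _ _).ne
      calc ∫⁻ y in ball (x j) (ρ j), ENNReal.ofReal (|𝓔.toFun G y| ^ p) ∂m
          ≤ ∫⁻ y in ball (x j) (ρ j), ENNReal.ofReal (∑ i ∈ nb j, |b i| ^ p) ∂m := by
            refine lintegral_mono_ae ((ae_restrict_iff' measurableSet_ball).2 ?_)
            filter_upwards [hψ.ae_rpow_sub_le hcov b S hbS] with y hy hyj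
            have := hy j hyj (nb j) (hnb' j) 0
            simp only [sub_zero] at this
            exact ENNReal.ofReal_le_ofReal this
        _ = ENNReal.ofReal (∑ i ∈ nb j, |b i| ^ p * m.real (ball (x j) (ρ j))) := by
            rw [setLIntegral_const, ← Finset.sum_mul, ENNReal.ofReal_mul (by positivity),
              ofReal_measureReal hBt]
        _ ≤ ENNReal.ofReal (N * T₁ * μ.real (innerRegion U c K (x j) (ρ j))) := by
            refine ENNReal.ofReal_le_ofReal ?_
            calc _ ≤ ∑ i ∈ nb j, T₁ * μ.real (innerRegion U c K (x j) (ρ j)) :=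
                  Finset.sum_le_sum fun i hi => hb1 i j ((hnb i j).1 hi)
              _ = (nb j).card * (T₁ * μ.real (innerRegion U c K (x j) (ρ j))) := by simp
              _ ≤ N * (T₁ * μ.real (innerRegion U c K (x j) (ρ j))) := by
                  gcongr; exact hnbN j
              _ = _ := by ring
        _ = _ := by rw [ENNReal.ofReal_mul (by positivity), ofReal_measureReal]
    have e2 := measure_le_of_cover (m.withDensity fun y => ENNReal.ofReal (|𝓔.toFun G y| ^ p)) μ _ _
      hYm (hcovE univ) _ (fun j _ => e1 j) N' (fun y J hJ => hover y J fun i hi => (hJ i hi).2)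
      (fun j _ => subset_univ _)
    rw [withDensity_apply _ MeasurableSet.univ, Measure.restrict_univ] at e2
    refine e2.trans (le_of_eq ?_)
    rw [← ofReal_measureReal (μ := μ), ← ENNReal.ofReal_natCast,
      ← ENNReal.ofReal_mul (by positivity), ← ENNReal.ofReal_mul (by positivity)]
  · refine (hΓ (frontier U) {y | y ∈ U ∧ infDist y Uᶜ ≤ T * s} ?_).trans ?_
    -- Such an inner region stays within `(K + 1) * ρ j ≤ 2(K + 1) * s` of a boundary point, which
    -- places it in the layer.
    · rintro j ⟨y, hyU, hyj⟩ w hw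
      have hy0 : infDist y U = 0 := by
        rw [← infDist_closure]
        exact infDist_zero_of_mem hyU.1
      have hy1 : infDist y Uᶜ = 0 := by
        rw [← infDist_closure]
        refine infDist_zero_of_mem ?_
        rw [frontier_eq_closure_inter_closure] at hyU
        exact hyU.2
      have hρj := hsmall j y hy0 hyj
      refine ⟨hYU j hw, ?_⟩
      have e1 := infDist_le_infDist_add_dist (s := Uᶜ) (x := w) (y := y)
      have e2 := dist_triangle_right w y (x j)
      have e3 : dist y (x j) < ρ j := hyj
      have e4 : (K + 1) * ρ j ≤ (K + 1) * (2 * s) := by gcongr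
      have e5 : 2 * (K + 1) * s ≤ T * s := by gcongr
      linarith [hw.2]
    · rw [← mul_assoc]
      gcongr
      rw [← ENNReal.ofReal_natCast, ← ENNReal.ofReal_mul hTE0]
      exact ENNReal.ofReal_le_ofReal hTc
  · have hδ0 : 0 < δ := (mul_pos hT0 hs).trans_le hδ
    have hδ1 : 2 * (1 + A * K) * s ≤ δ := le_trans (by gcongr) hδ
    have hδ2 : 2 * (3 * A₁ + 1) * s ≤ δ := le_trans (by gcongr) hδ
    set d := dist y₀ q₁ with hd
    have hmeet : ∀ j, (ball y₀ δ ∩ ball (x j) (ρ j)).Nonempty → ρ j ≤ 2 * s ∧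
        dist (x j) y₀ ≤ δ + ρ j := by
      rintro j ⟨y, hy1, hy2⟩
      have hyU : y ∈ U := hδU ((ball_subset_closedBall.trans
        (closedBall_subset_closedBall (by linarith))) hy1)
      refine ⟨hsmall j y (infDist_zero_of_mem hyU) hy2, ?_⟩
      rw [mem_ball] at hy1 hy2
      linarith [dist_triangle_left (x j) y₀ y]
    have hballU : ∀ j, (ball y₀ δ ∩ ball (x j) (ρ j)).Nonempty →
        closedBall (x j) (A * (K * ρ j)) ⊆ U := fun j hj => by
      obtain ⟨h1, h2⟩ := hmeet j hj
      refine (closedBall_subset_closedBall' ?_).trans hδU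
      have : (1 + A * K) * ρ j ≤ (1 + A * K) * (2 * s) := by gcongr
      linarith
    set V := Ψ (T * s) + (s * (2 * δ + d)) ^ p with hV
    have hΨT := hΨ.pos (mul_pos hT0 hs)
    have hV0 : 0 ≤ V := by positivity
    have hint : ∀ j, (ball y₀ δ ∩ ball (x j) (ρ j)).Nonempty → ∀ i ∈ nb j,
        ∫ y in ball (x j) (ρ j), |g y - b i| ^ p ∂m ≤
          T₁ * V * μ.real (closedBall (x j) (A * (K * ρ j))) := fun j hj i hi => by
      have hij := (hnb i j).1 hi
      obtain ⟨h1, h2⟩ := hmeet j hj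
      have hρj := hcov.pos j
      have hρi := hcov.comparable i j hij
      refine (hb3 i j hij (by linarith) (hballU j hj)).trans ?_
      rw [mul_assoc]
      refine mul_le_mul_of_nonneg_left ?_ hT₁
      rw [hV, add_mul]
      have hfin' : μ (closedBall (x j) (A * (K * ρ j))) ≠ ∞ := measure_ne_top _ _
      have e1 : Ψ (K * ρ j) ≤ Ψ (T * s) := by
        refine hΨ.mono (by positivity) ?_
        calc K * ρ j ≤ K * (2 * s) := by gcongr
          _ = 2 * K * s := by ring
          _ ≤ T * s := by gcongr; linarith
      have e2 : dist (x i) q₁ ≤ 2 * δ + d := by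
        have f1 := dist_triangle (x i) (x j) q₁
        have f2 := dist_triangle (x j) y₀ q₁
        have f3 := hcov.dist_le hij
        have f4 : (3 * A₁ + 1) * ρ j ≤ (3 * A₁ + 1) * (2 * s) := by gcongr
        linarith
      have e3 : innerRegion U c K (x j) (ρ j) ⊆ closedBall (x j) (A * (K * ρ j)) := fun y hy => by
        rw [mem_closedBall]
        refine hy.2.trans ?_
        exact le_mul_of_one_le_left (by positivity) hA
      gcongr
      exact ball_subset_closedBall
    have e1 : ∀ j, (ball y₀ δ ∩ ball (x j) (ρ j)).Nonempty →
        (m.withDensity fun y => ENNReal.ofReal (|𝓔.toFun G y - g y| ^ p)) (ball (x j) (ρ j)) ≤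
        ENNReal.ofReal (N * T₁ * V) * μ (closedBall (x j) (A * (K * ρ j))) := fun j hj => by
      rw [withDensity_apply _ measurableSet_ball]
      have hρj := hcov.pos j
      have hBt : m (ball (x j) (ρ j)) ≠ ∞ := (hVD.measure_ball_lt_top _ _).ne
      have hBU : ball (x j) (ρ j) ⊆ U := (ball_subset_closedBall.trans
        (closedBall_subset_closedBall (by
          rw [← mul_assoc]
          exact le_mul_of_one_le_left hρj.le (one_le_mul_of_one_le_of_one_le hA hK)))).trans
        (hballU j hj)
      have hI : ∀ i, IntegrableOn (fun y => |g y - b i| ^ p) (ball (x j) (ρ j)) m := fun i =>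
        hg.integrableOn_rpow hp hBU hBt (b i)
      calc ∫⁻ y in ball (x j) (ρ j), ENNReal.ofReal (|𝓔.toFun G y - g y| ^ p) ∂m
          ≤ ∫⁻ y in ball (x j) (ρ j), ENNReal.ofReal (∑ i ∈ nb j, |g y - b i| ^ p) ∂m := by
            refine lintegral_mono_ae ((ae_restrict_iff' measurableSet_ball).2 ?_)
            filter_upwards [hψ.ae_rpow_sub_le hcov b S hbS] with y hy hyj
            have := hy j hyj (nb j) (hnb' j) (g y)
            simp_rw [abs_sub_comm (g y)]
            exact ENNReal.ofReal_le_ofReal this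
        _ = ENNReal.ofReal (∑ i ∈ nb j, ∫ y in ball (x j) (ρ j), |g y - b i| ^ p ∂m) := by
            rw [← integral_finsetSum _ fun i _ => hI i, ofReal_integral_eq_lintegral_ofReal]
            · exact integrable_finsetSum _ fun i _ => hI i
            · exact Eventually.of_forall fun y => Finset.sum_nonneg fun i _ => by positivity
        _ ≤ ENNReal.ofReal (N * T₁ * V * μ.real (closedBall (x j) (A * (K * ρ j)))) := by
            refine ENNReal.ofReal_le_ofReal ?_
            calc _ ≤ ∑ i ∈ nb j, T₁ * V * μ.real (closedBall (x j) (A * (K * ρ j))) :=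
                  Finset.sum_le_sum fun i hi => hint j hj i hi
              _ = (nb j).card * (T₁ * V * μ.real (closedBall (x j) (A * (K * ρ j)))) := by simp
              _ ≤ N * (T₁ * V * μ.real (closedBall (x j) (A * (K * ρ j)))) := by
                  gcongr; exact hnbN j
              _ = _ := by ring
        _ = _ := by rw [ENNReal.ofReal_mul (by positivity), ofReal_measureReal]
    -- The Poincaré balls themselves overlap boundedly here: their radii are at most `2 * A * K * s`
    -- and the cores of the cover have radius at least `s / 6`, whence the packing constant `12 * (A
    -- * K)`.
    have e2 := measure_le_of_cover
      (m.withDensity fun y => ENNReal.ofReal (|𝓔.toFun G y - g y| ^ p)) μ _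
      (fun j => closedBall (x j) (A * (K * ρ j))) (fun j => measurableSet_closedBall)
      (hcovE (ball y₀ δ)) _ e1 N'' (fun y J hJ => ?_) (fun j _ => subset_univ _)
    · rw [withDensity_apply _ measurableSet_ball] at e2
      refine e2.trans ?_
      rw [← ofReal_measureReal (μ := μ), ← ENNReal.ofReal_natCast,
        ← ENNReal.ofReal_mul (by positivity), ← ENNReal.ofReal_mul (by positivity)]
      refine ENNReal.ofReal_le_ofReal ?_
      calc N * T₁ * V * (N'' * M) = N * T₁ * (N'' * M) * V := by ring
        _ ≤ T * V := by gcongr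
    · refine hN'' Z y (s / 6) x J (by positivity) (fun i hi => ?_) ?_
      · obtain ⟨h1, h2⟩ := hJ i hi
        rw [mem_closedBall, dist_comm] at h2
        refine h2.trans ?_
        have := mul_le_mul_of_nonneg_left (hmeet i h1).1 (by positivity : 0 ≤ A * K)
        linarith
      · exact hcov.pairwiseDisjoint _ fun i _ => by linarith [(hρr i).1]

end PEnergyForm
end

/-! ### Functions on the domain, passage to the limit, and conclusion. -/

noncomputable section
open Filter Topology

namespace PEnergyForm

variable {p : ℝ} [Fact (1 < p)] {X : Type u} [MetricSpace X] [MeasurableSpace X] {m : Measure X}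
  {𝓔 : PEnergyForm p m} {Γ : 𝓔.domain → Measure X} {Ψ : ℝ → ℝ}

theorem measure_le_localEnergyMeasure {U A : Set X} {f : X →ₘ[m.restrict U] ℝ} {v : 𝓔.domain}
    (hA : IsRelCompactOpenIn A U) (hv : 𝓔.AgreesOn f A v) :
    Γ v A ≤ 𝓔.localEnergyMeasure Γ f A := by
  have h1 : (Γ v).restrict A ≤ 𝓔.localEnergyMeasure Γ f :=
    le_iSup_of_le A <| le_iSup_of_le v <| le_iSup_of_le ⟨hA, hv⟩ le_rfl
  have h2 := Measure.le_iff'.1 h1 A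
  rwa [Measure.restrict_apply_self] at h2

theorem isRelCompactOpenIn_ball [ProperSpace X] {U : Set X} {y : X} {r : ℝ}
    (h : closedBall y r ⊆ U) : IsRelCompactOpenIn (ball y r) U :=
  ⟨isOpen_ball, (isCompact_closedBall y r).of_isClosed_subset isClosed_closure
    closure_ball_subset_closedBall, closure_ball_subset_closedBall.trans h⟩

theorem AgreesOn.ae_restrict {U A : Set X} {f : X →ₘ[m.restrict U] ℝ} {v : 𝓔.domain}
    (hv : 𝓔.AgreesOn f A v) (hAU : A ⊆ U) (hA : MeasurableSet A) :
    ∀ᵐ x ∂(m.restrict A), f x = 𝓔.toFun v x := by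
  have h1 := ae_restrict_of_ae_restrict_of_subset hAU hv
  filter_upwards [h1, ae_restrict_mem hA] with x h2 h3 using h2 h3

/-- Functions of `F_p(U)` satisfy the Poincaré inequality on balls well inside `U`. -/
theorem PoincareInequality.exists_localPoincare [BorelSpace X] [ProperSpace X]
    (hPI : 𝓔.PoincareInequality Γ Ψ) (hΨ : IsScaleFunction Ψ) :
    ∃ C A : ℝ, 0 ≤ C ∧ 1 ≤ A ∧ ∀ (U : Set X) (f : X →ₘ[m.restrict U] ℝ), IsOpen U →
      f ∈ 𝓔.domainOn Γ U → ∃ μ : Measure X, IsFiniteMeasure μ ∧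
        LocalPoincare p m U Ψ C A f μ := by
  have hp : 1 < p := Fact.out
  have hp0 : 0 < p := by linarith
  obtain ⟨C, A, hC, hA, hPI⟩ := hPI
  refine ⟨C, A, hC.le, hA, fun U f hU hf => ?_⟩
  obtain ⟨hloc, hfin⟩ := hf
  set μ₁ := (𝓔.localEnergyMeasure Γ f).restrict U with hμ₁
  set μ₂ := (m.restrict U).withDensity fun x => ENNReal.ofReal (|f x| ^ p) with hμ₂
  have hfin1 : IsFiniteMeasure μ₁ := ⟨by
    rw [hμ₁, Measure.restrict_apply_univ]
    exact lt_of_le_of_lt le_add_self hfin⟩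
  have hfin2' : ∫⁻ x in U, ENNReal.ofReal (|f x| ^ p) ∂m < ∞ := lt_of_le_of_lt le_self_add hfin
  have hfin2 : IsFiniteMeasure μ₂ := ⟨by
    rw [hμ₂, withDensity_apply _ MeasurableSet.univ, Measure.restrict_univ]
    exact hfin2'⟩
  have hmeas := f.aestronglyMeasurable
  have hcont : ∀ c : ℝ, Continuous fun t : ℝ => |t - c| ^ p := fun c =>
    (continuous_abs.comp (continuous_id.sub continuous_const)).rpow_const
      fun _ => Or.inr hp0.le
  refine ⟨μ₁ + μ₂, inferInstance, ⟨hmeas, ?_⟩, fun s hs hsU => ?_, fun y r hr hyU => ?_⟩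
  · rw [eLpNorm_lt_top_iff_lintegral_rpow_enorm_lt_top (by simpa using hp0) ENNReal.ofReal_ne_top,
      ENNReal.toReal_ofReal hp0.le]
    refine lt_of_le_of_lt (le_of_eq (lintegral_congr fun x => ?_)) hfin2'
    rw [← ENNReal.ofReal_rpow_of_nonneg (abs_nonneg _) hp0.le, ← Real.norm_eq_abs, ofReal_norm]
  · have hms : AEStronglyMeasurable (fun x => |f x| ^ p) (m.restrict s) := by
      have := (hcont 0).comp_aestronglyMeasurable
        (hmeas.mono_measure (Measure.restrict_mono hsU le_rfl))
      simpa using this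
    rw [integral_eq_lintegral_of_nonneg_ae (Eventually.of_forall fun x => by positivity) hms]
    refine ENNReal.toReal_mono (measure_ne_top _ _) ?_
    rw [Measure.add_apply, hμ₂, withDensity_apply _ hs, Measure.restrict_restrict hs,
      inter_eq_self_of_subset_left hsU]
    exact le_add_self
  · have hrel : IsRelCompactOpenIn (ball y (A * r)) U := isRelCompactOpenIn_ball hyU
    -- The Poincaré inequality concerns elements of the domain, so it is applied to one that agrees
    -- with `f` on the dilated ball.
    obtain ⟨v, hv⟩ := hloc _ hrel
    have hDD : ball y r ⊆ ball y (A * r) := ball_subset_ball (le_mul_of_one_le_left hr.le hA)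
    have hAU : ball y (A * r) ⊆ U := subset_closure.trans hrel.2.2
    have hfv : ∀ᵐ x ∂(m.restrict (ball y r)), f x = 𝓔.toFun v x :=
      ae_restrict_of_ae_restrict_of_subset hDD (hv.ae_restrict hAU measurableSet_ball)
    have havg : ⨍ z in ball y r, f z ∂m = ⨍ z in ball y r, 𝓔.toFun v z ∂m := average_congr hfv
    have hms : AEStronglyMeasurable (fun x => |f x - ⨍ z in ball y r, f z ∂m| ^ p)
        (m.restrict (ball y r)) := (hcont _).comp_aestronglyMeasurable
          (hmeas.mono_measure (Measure.restrict_mono (hDD.trans hAU) le_rfl))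
    have hΨr := hΨ.pos hr
    rw [integral_eq_lintegral_of_nonneg_ae (Eventually.of_forall fun x => by positivity) hms]
    refine ENNReal.toReal_le_of_le_ofReal (by positivity) ?_
    have h1 : ∫⁻ x in ball y r, ENNReal.ofReal (|f x - ⨍ z in ball y r, f z ∂m| ^ p) ∂m =
        ∫⁻ x in ball y r, ENNReal.ofReal
          (|𝓔.toFun v x - ⨍ z in ball y r, 𝓔.toFun v z ∂m| ^ p) ∂m := by
      refine lintegral_congr_ae ?_
      filter_upwards [hfv] with x hx
      rw [hx, havg]
    rw [h1, ENNReal.ofReal_mul (by positivity), ofReal_measureReal]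
    refine (hPI y r hr v).trans ?_
    refine mul_le_mul' le_rfl ?_
    rw [Measure.add_apply, hμ₁, Measure.restrict_apply measurableSet_ball,
      inter_eq_self_of_subset_left hAU]
    exact (measure_le_localEnergyMeasure hrel hv).trans le_self_add

/-- A bounded sequence in the domain that converges to `f` locally in `U` in `L^p` and whose
energies of `B` tend to zero has a limit in the domain extending `f` without energy on `B`. -/
theorem IsRegularWithEnergyMeasures.exists_extension_of_bounded [BorelSpace X] [ProperSpace X]
    (h : 𝓔.IsRegularWithEnergyMeasures Γ) {U B : Set X} (hU : IsOpen U) (hB : MeasurableSet B)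
    (f : X →ₘ[m.restrict U] ℝ) (hf : f ∈ 𝓔.localDomain U) (G : ℕ → 𝓔.domain) {T : ℝ}
    (hGE : ∀ n, 𝓔.rootEnergy (G n) ≤ T)
    (hGL : ∀ n, ‖(G n : Lp ℝ (ENNReal.ofReal p) m)‖ ≤ T)
    (hGB : Tendsto (fun n => Γ (G n) B) atTop (𝓝 0))
    (hGf : ∀ y₀ ∈ U, ∃ δ, 0 < δ ∧ closedBall y₀ δ ⊆ U ∧ Tendsto (fun n =>
      ∫⁻ y in ball y₀ δ, ENNReal.ofReal (|𝓔.toFun (G n) y - f y| ^ p) ∂m) atTop (𝓝 0)) :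
    ∃ F : 𝓔.domain, (∀ᵐ x ∂(m.restrict U), f x = 𝓔.toFun F x) ∧ Γ F B = 0 := by
  have hp : 1 < p := Fact.out
  have hp0 : 0 < p := by linarith
  obtain ⟨F, hF⟩ := exists_mem_of_eventually_mem_of_reflexive h.reflexive (l := atTop)
    (fun n => 𝓔.ofSpace.symm (G n)) (M := T + T) fun n => by
      rw [norm_ofSpace_symm]
      linarith [hGE n, hGL n]
  have hnorm : ∀ w, ‖w‖ = ‖(𝓔.ofSpace w : Lp ℝ (ENNReal.ofReal p) m)‖
      + 𝓔.rootEnergy (𝓔.ofSpace w) := fun w => by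
    simpa only [LinearEquiv.symm_apply_apply] using 𝓔.norm_ofSpace_symm (𝓔.ofSpace w)
  refine ⟨𝓔.ofSpace F, ?_, ?_⟩
  · have hloc : ∀ y₀ ∈ U, ∃ δ, 0 < δ ∧
        ∀ᵐ x ∂(m.restrict (ball y₀ δ)), f x = 𝓔.toFun (𝓔.ofSpace F) x := by
      intro y₀ hy₀
      obtain ⟨δ, hδ, hδU, hlim⟩ := hGf y₀ hy₀
      refine ⟨δ, hδ, ?_⟩
      have hrel : IsRelCompactOpenIn (ball y₀ δ) U := isRelCompactOpenIn_ball hδU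
      -- `f` itself is not in the domain; `v` stands for it on the ball, so that local `L^p`
      -- closeness to `f` becomes a closed convex condition on the energy space.
      obtain ⟨v, hv⟩ := hf _ hrel
      have hfv := hv.ae_restrict (ball_subset_closedBall.trans hδU) measurableSet_ball
      let R := LpToLpRestrictCLM X ℝ ℝ m (ENNReal.ofReal p) (ball y₀ δ)
      let NR : Seminorm ℝ 𝓔.Space :=
        (normSeminorm ℝ (Lp ℝ (ENNReal.ofReal p) (m.restrict (ball y₀ δ)))).comp
          ((R : Lp ℝ (ENNReal.ofReal p) m →ₗ[ℝ] _).comp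
            (𝓔.domain.subtype.comp (𝓔.ofSpace : 𝓔.Space →ₗ[ℝ] 𝓔.domain)))
      have hNR : ∀ w, NR w = ‖R (𝓔.ofSpace w : Lp ℝ (ENNReal.ofReal p) m)‖ := fun w => rfl
      have hNRle : ∀ w, NR w ≤ ‖w‖ := fun w => by
        have h1 : ‖R (𝓔.ofSpace w : Lp ℝ (ENNReal.ofReal p) m)‖ ≤
            ‖(𝓔.ofSpace w : Lp ℝ (ENNReal.ofReal p) m)‖ := norm_Lp_toLp_restrict_le _ _
        rw [hNR, hnorm]
        linarith [apply_nonneg 𝓔.rootEnergy (𝓔.ofSpace w)]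
      have h0 : NR (F - 𝓔.ofSpace.symm v) ≤ 0 := by
        refine le_of_forall_pos_le_add fun ε hε => ?_
        rw [zero_add]
        refine hF {w | NR (w - 𝓔.ofSpace.symm v) ≤ ε} (NR.convex_sub_le _ _)
          (NR.isClosed_sub_le hNRle _ _) ?_
        have hεp : 0 < ENNReal.ofReal (ε ^ p) := by simp only [ENNReal.ofReal_pos]; positivity
        filter_upwards [hlim.eventually (ge_mem_nhds hεp)] with n hn
        rw [hNR, ← map_sub, LinearEquiv.apply_symm_apply]
        have h2 := Lp.norm_le_of_lintegral_rpow_le hp0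
          (R ((G n - v : 𝓔.domain) : Lp ℝ (ENNReal.ofReal p) m)) (T := ε ^ p) (by positivity) ?_
        · rwa [← Real.rpow_mul hε.le, mul_one_div_cancel hp0.ne', Real.rpow_one] at h2
        · refine le_trans (le_of_eq (lintegral_congr_ae ?_)) hn
          filter_upwards [LpToLpRestrictCLM_coeFn ℝ (ball y₀ δ)
            ((G n - v : 𝓔.domain) : Lp ℝ (ENNReal.ofReal p) m), hfv,
            ae_restrict_of_ae (𝓔.toFun_sub (G n) v)] with x h3 h4 h5
          rw [h3, h4, ← h5]
          rfl
      have h1 : R ((𝓔.ofSpace F - v : 𝓔.domain) : Lp ℝ (ENNReal.ofReal p) m) = 0 :=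
        norm_eq_zero.1 (le_antisymm h0 (norm_nonneg _))
      have h2 := LpToLpRestrictCLM_coeFn ℝ (ball y₀ δ)
            ((𝓔.ofSpace F - v : 𝓔.domain) : Lp ℝ (ENNReal.ofReal p) m)
      change R _ =ᵐ[_] _ at h2
      rw [h1] at h2
      filter_upwards [h2, Lp.coeFn_zero ℝ (ENNReal.ofReal p) (m.restrict (ball y₀ δ)), hfv,
        ae_restrict_of_ae (𝓔.toFun_sub (𝓔.ofSpace F) v)] with x h3 h4 h5 h6
      rw [h5]
      have h7 : 𝓔.toFun (𝓔.ofSpace F - v) x = 0 := by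
        change ((𝓔.ofSpace F - v : 𝓔.domain) : Lp ℝ (ENNReal.ofReal p) m) x = 0
        rw [← h3, h4]; rfl
      linarith
    rw [ae_restrict_iff' hU.measurableSet]
    refine measure_null_of_locally_null _ fun x hx => ?_
    simp only [mem_compl_iff, mem_ofPred_eq, Classical.not_imp] at hx
    obtain ⟨δ, hδ, hae⟩ := hloc x hx.1
    rw [ae_restrict_iff' measurableSet_ball] at hae
    refine ⟨_, inter_mem_nhdsWithin _ (ball_mem_nhds x hδ), measure_mono_null ?_ hae⟩
    rintro y ⟨hy1, hy2⟩ hy3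
    simp only [mem_compl_iff, mem_ofPred_eq, Classical.not_imp] at hy1
    exact hy1.2 (hy3 hy2)
  · let NB : Seminorm ℝ 𝓔.Space := (h.seminormOn hB).comp (𝓔.ofSpace : 𝓔.Space →ₗ[ℝ] 𝓔.domain)
    have hNB : ∀ w, NB w = h.seminormOn hB (𝓔.ofSpace w) := fun w => rfl
    have hNBle : ∀ w, NB w ≤ ‖w‖ := fun w => by
      rw [hNB, hnorm]
      linarith [h.seminormOn_le_rootEnergy hB (𝓔.ofSpace w),
        norm_nonneg (𝓔.ofSpace w : Lp ℝ (ENNReal.ofReal p) m)]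
    have hlim : Tendsto (fun n => h.seminormOn hB (G n)) atTop (𝓝 0) := by
      have h1 : Tendsto (fun n => (Γ (G n)).real B) atTop (𝓝 0) := by
        have := (ENNReal.tendsto_toReal ENNReal.zero_ne_top).comp hGB
        rwa [ENNReal.toReal_zero] at this
      have h2 := h1.rpow_const (p := 1 / p) (Or.inr (by positivity))
      rw [Real.zero_rpow (by positivity)] at h2
      simpa only [h.seminormOn_apply] using h2
    rw [h.measure_eq_zero_iff hB]
    refine le_antisymm (le_of_forall_pos_le_add fun ε hε => ?_) (apply_nonneg _ _)
    rw [zero_add]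
    -- Sublevel sets of the seminorm `Γ(B)^(1/p)` are closed and convex, so a limit zero along the
    -- sequence forces the value zero at `F`.
    have h3 : NB (F - 0) ≤ ε := hF {w | NB (w - 0) ≤ ε} (NB.convex_sub_le _ _)
      (NB.isClosed_sub_le hNBle _ _) (by
        filter_upwards [hlim.eventually (ge_mem_nhds hε)] with n hn
        rwa [sub_zero, hNB, LinearEquiv.apply_symm_apply])
    rwa [sub_zero] at h3

theorem extensionProperty_of_nontrivial [BorelSpace X] [LocallyCompactSpace X]
    [SecondCountableTopology X] [ProperSpace X] [Nontrivial X] [m.IsOpenPosMeasure]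
    [IsFiniteMeasureOnCompacts m] (hcap : 𝓔.CapacityUpperBound Ψ)
    (h : 𝓔.IsRegularWithEnergyMeasures Γ) (hΨ : IsScaleFunction Ψ) (hVD : VolumeDoubling m)
    (hPI : 𝓔.PoincareInequality Γ Ψ) {U : Set X} (hU : IsUniformDomain U) {q₁ q₂ : X}
    (hq₁ : q₁ ∈ U) (hq₂ : q₂ ∈ U) (hq : q₁ ≠ q₂) : 𝓔.ExtensionProperty Γ U := by
  have hp : 1 < p := Fact.out
  have hp0 : 0 < p := by linarith
  intro f hf
  obtain ⟨hUo, -, hUne, a, ha, hUc⟩ := hU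
  obtain ⟨C, A, hC, hA, hLP⟩ := hPI.exists_localPoincare hΨ
  obtain ⟨μ, hμ, hg⟩ := hLP U f hUo hf
  obtain ⟨T, s₀, hT, hs₀, happ⟩ :=
    exists_approximation hcap h hΨ hVD hg hC hA ha hUc hq₁ hq₂ hq
  -- The shift by 2 makes even the first term strictly smaller than `s₀`.
  set s : ℕ → ℝ := fun n => s₀ / ((n : ℝ) + 2) with hs
  have hs0 : ∀ n, 0 < s n := fun n => by positivity
  have hs1 : ∀ n, s n < s₀ := fun n => by
    rw [hs, div_lt_iff₀ (by positivity)]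
    nlinarith [(Nat.cast_nonneg n : (0 : ℝ) ≤ n)]
  have hsanti : Antitone s := fun k n hkn => by
    simp only [hs]
    gcongr
  have hslim : Tendsto s atTop (𝓝 0) := by
    refine Tendsto.div_atTop tendsto_const_nhds ?_
    exact tendsto_atTop_add_const_right _ _ tendsto_natCast_atTop_atTop
  choose G hGE hGL hGB hGf using fun n => happ (s n) (hs0 n) (hs1 n)
  have hUcne : (Uᶜ).Nonempty := nonempty_compl.2 hUne
  have hTs : Tendsto (fun n => T * s n) atTop (𝓝 0) := by simpa using hslim.const_mul T
  refine h.exists_extension_of_bounded hUo isClosed_frontier.measurableSet f hf.1 G hGE hGL ?_ ?_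
  · set W : ℕ → Set X := fun n => {y | y ∈ U ∧ infDist y Uᶜ ≤ T * s n} with hW
    have hWlim : Tendsto (fun n => μ (W n)) atTop (𝓝 0) := by
      -- Each point of the open set `U` has positive distance to the nonempty complement, so it
      -- leaves the layers; `μ` is finite, hence continuous along them.
      have hempty : ⋂ n, W n = ∅ := by
        refine eq_empty_of_forall_notMem fun y hy => ?_
        rw [mem_iInter] at hy
        have h1 : 0 < infDist y Uᶜ :=
          (hUo.isClosed_compl.notMem_iff_infDist_pos hUcne).1 (by simpa using (hy 0).1)
        exact absurd (ge_of_tendsto' hTs fun n => (hy n).2) (not_le.2 h1)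
      rw [← measure_empty (μ := μ), ← hempty]
      refine tendsto_measure_iInter_atTop (fun n => ?_) (fun k n hkn y hy => ?_)
        ⟨0, measure_ne_top _ _⟩
      · exact (hUo.measurableSet.inter
          (isClosed_le (continuous_infDist_pt _) continuous_const).measurableSet).nullMeasurableSet
      · exact ⟨hy.1, hy.2.trans (by gcongr; exact hsanti hkn)⟩
    refine tendsto_of_tendsto_of_tendsto_of_le_of_le tendsto_const_nhds ?_ (fun _ => zero_le) hGB
    simpa using ENNReal.Tendsto.const_mul hWlim (Or.inr (ENNReal.ofReal_ne_top (r := T)))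
  · intro y₀ hy₀
    obtain ⟨ε, hε, hεU⟩ := Metric.isOpen_iff.1 hUo y₀ hy₀
    have h4 : closedBall y₀ (2 * (ε / 4)) ⊆ U :=
      (closedBall_subset_ball (by linarith)).trans hεU
    refine ⟨ε / 4, by positivity, (closedBall_subset_closedBall (by linarith)).trans h4, ?_⟩
    have hlim : Tendsto (fun n => ENNReal.ofReal
        (T * (Ψ (T * s n) + (s n * (2 * (ε / 4) + dist y₀ q₁)) ^ p))) atTop (𝓝 0) := by
      have e1 : Tendsto (fun n => Ψ (T * s n)) atTop (𝓝 0) :=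
        hΨ.tendsto_zero.comp (tendsto_nhdsWithin_iff.2
          ⟨hTs, Eventually.of_forall fun n => mul_pos hT (hs0 n)⟩)
      have e2 : Tendsto (fun n => (s n * (2 * (ε / 4) + dist y₀ q₁)) ^ p) atTop (𝓝 0) := by
        have := (hslim.mul_const (2 * (ε / 4) + dist y₀ q₁)).rpow_const (p := p) (Or.inr hp0.le)
        rwa [zero_mul, Real.zero_rpow hp0.ne'] at this
      have e3 := ENNReal.tendsto_ofReal ((e1.add e2).const_mul T)
      simpa using e3
    refine tendsto_of_tendsto_of_tendsto_of_le_of_le' tendsto_const_nhds hlim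
      (Eventually.of_forall fun _ => zero_le) ?_
    filter_upwards [hTs.eventually (ge_mem_nhds (by positivity : 0 < ε / 4))] with n hn
    exact hGf n y₀ (ε / 4) h4 hn

/-- Indicators of isolated points belong to the domain. -/
theorem extensionProperty_singleton [BorelSpace X] [LocallyCompactSpace X]
    (h : 𝓔.IsRegularWithEnergyMeasures Γ) {x : X} (hx : IsOpen ({x} : Set X)) :
    𝓔.ExtensionProperty Γ {x} := by
  intro f _
  obtain ⟨φ, g, W, hφ, -, hxW, hgW, -, -⟩ := h.exists_cutoff hx (mem_singleton x)
  refine ⟨f x • φ, ?_, ?_⟩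
  · filter_upwards [ae_restrict_of_ae (𝓔.toFun_smul (f x) φ), ae_restrict_of_ae hφ,
      ae_restrict_mem (measurableSet_singleton x)] with y h1 h2 hy
    rw [mem_singleton_iff.1 hy] at h1 h2 ⊢
    rw [h1, h2, hgW x hxW, mul_one]
  · have : frontier ({x} : Set X) = ∅ := IsClopen.frontier_eq ⟨isClosed_singleton, hx⟩
    rw [this, measure_empty]

end PEnergyForm

end

theorem mainTheorem5 {X : Type*} [MetricSpace X] [LocallyCompactSpace X]
    [TopologicalSpace.SeparableSpace X] [CompleteSpace X] [Nontrivial X]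
    [MeasurableSpace X] [BorelSpace X]
    (m : Measure X) [m.Regular] [m.IsOpenPosMeasure]
    (p : ℝ) [Fact (1 < p)]
    (𝓔 : PEnergyForm p m) (Γ : 𝓔.domain → Measure X)
    (h𝓔 : 𝓔.IsRegularWithEnergyMeasures Γ)
    (Ψ : ℝ → ℝ) (hΨ : IsScaleFunction Ψ)
    (hVD : VolumeDoubling m)
    (hPI : 𝓔.PoincareInequality Γ Ψ)
    (hcap : 𝓔.CapacityUpperBound Ψ)
    (U : Set X) (hU : IsUniformDomain U) :
    𝓔.ExtensionProperty Γ U := by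
  have : SecondCountableTopology X := UniformSpace.secondCountable_of_separable X
  have : ProperSpace X := hVD.properSpace
  obtain ⟨q, hq⟩ := hU.2.1.nonempty
  -- The construction takes its reference scale from two distinct points of `U`. A one-point domain
  -- is an isolated point and is treated separately.
  by_cases hne : ∃ q' ∈ U, q ≠ q'
  · obtain ⟨q', hq', hqq'⟩ := hne
    exact PEnergyForm.extensionProperty_of_nontrivial hcap h𝓔 hΨ hVD hPI hU hq hq' hqq'
  · push Not at hne
    obtain rfl : U = {q} :=
      Subset.antisymm (fun y hy => (hne y hy).symm) (singleton_subset_iff.2 hq)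
    exact PEnergyForm.extensionProperty_singleton h𝓔 hU.1
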